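/- Let $k\ge 2$ be an integer. Literals are variables $v$ and their complements $\overline v$, the variables being taken from an infinite set; clauses are finite sets of literals not containing a literal together with its complement, and clause-sets are finite sets of clauses. A 2-MU is a clause-set $F$ all of whose clauses have length at most $2$, which is unsatisfiable, while removal of any clause makes it satisfiable; its deficiency is the number of clauses minus the number of variables. Let $\mathcal M_k$ be the class of 2-MUs of deficiency $k$. (For $k\ge 2$ its members do not contain the empty clause.) For $F\in\mathcal M_k$ the implication digraph has as vertices all literals over the variables of $F$, and each clause $\{x,y\}\in F$ (possibly $x=y$) yields the arcs $\overline x\to y$ and $\overline y\to x$ (one arc if $x=y$). The implication multigraph is obtained by forgetting directions while keeping multiplicities. Its smoothing is obtained by repeating, as long as possible, the following step (at the first possible vertex in some fixed linear order): a vertex $v$ of degree $2$ not adjacent to itself is deleted together with its edges, and an edge joining $u$ and $w$ is added, where $\{u,w\}$ (possibly $u=w$) is the set of neighbours of $v$. Two elements of $\mathcal M_k$ have the same homeomorphism type if the smoothings of their implication multigraphs are isomorphic. Two binary strings of length $k$ are equivalent (define the same bracelet) if one is obtained from the other by a rotation or a reflection. Then: 1. The homeomorphism types of elements of $\mathcal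 M_k$ are in one-to-one correspondence with the equivalence classes of binary bracelets of length $k$. The correspondence is as follows: $F$ corresponds to the class of $w\in\{0,1\}^k$ if and only if the smoothing of the implication multigraph of $F$ is isomorphic to the cycle of $2k$ small cycles whose $2k$ consecutive overlaps are, in cyclic order, given by the string $ww$, the overlap being a single vertex for $0$ and a single edge for $1$. More precisely, this is the multigraph obtained from the double $2k$-cycle digraph (vertices $i\in\mathbb Z/2k$, arcs $i\to i+1$ and $i+1\to i$) by splitting every vertex $i$ with $(ww)_i=1$ into $u_i\to v_i$, where $u_i$ takes over the incoming and $v_i$ the outgoing arcs, and then forgetting directions. 2. Every $F\in\mathcal M_k$ has a unique normal form under 1-singular DP-reduction (repeatedly replacing the two clauses containing a variable that occurs exactly once positively and exactly once negatively by their resolvents on that variable). This normal form is again in $\mathcal M_k$ and has no such variable. The isomorphism types (under complement-preserving bijections of the literals) of the elements of $\mathcal M_k$ without such variables are in one-to-one correspondence with the equivalence classes of binary bracelets of length $k$, in such a way that the isomorphism type of the normal form of $F$ corresponds to the same bracelet as the homeomorphism type of $F$. -/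

import Mathlib

namespace MU2

/-! ### Literals, clause-sets, minimal unsatisfiability -/

/-- A literal: a variable together with a sign (`true` for `v`, `false` for its complement). -/
@[ext] structure Lit (V : Type*) where
  var : V
  sign : Bool

/-- The complement of a literal. -/
def Lit.compl {V : Type*} (x : Lit V) : Lit V := ⟨x.var, !x.sign⟩

/-- The linear order on literals induced by a linear order on variables. -/
instance Lit.instLinearOrder {V : Type*} [LinearOrder V] : LinearOrder (Lit V) :=
  LinearOrder.lift' (fun x : Lit V => toLex (x.var, x.sign)) (fun x y h => by
    have h' : (x.var, x.sign) = (y.var, y.sign) := toLex.injective h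
    exact Lit.ext (congrArg Prod.fst h') (congrArg Prod.snd h'))

/-- A clause is a finite set of literals. Clash-freeness is the predicate `Clause.ClashFree`. -/
abbrev Clause (V : Type*) := Finset (Lit V)

/-- A clause is clash-free if it does not contain a literal together with its complement. -/
def Clause.ClashFree {V : Type*} (C : Clause V) : Prop := ∀ x ∈ C, x.compl ∉ C

/-- A finite set of clauses. -/
abbrev ClauseSet (V : Type*) := Finset (Clause V)

namespace ClauseSet

variable {V : Type*} [LinearOrder V]

/-- The variables occurring in `F`. -/
def vars (F : ClauseSet V) : Finset V := F.biUnion fun C => C.image Lit.var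

/-- The literals whose variable occurs in `F`. -/
def lits (F : ClauseSet V) : Finset (Lit V) :=
  (F.vars ×ˢ (Finset.univ : Finset Bool)).image fun p => ⟨p.1, p.2⟩

/-- The deficiency: number of clauses minus number of variables. -/
def deficiency (F : ClauseSet V) : ℤ := (F.card : ℤ) - (F.vars.card : ℤ)

/-- The literal-degree: the number of clauses containing `x`. -/
def ldeg (F : ClauseSet V) (x : Lit V) : ℕ := (F.filter fun C => x ∈ C).card

/-- Some assignment makes at least one literal of every clause true. -/
def Satisfiable (F : ClauseSet V) : Prop :=
  ∃ τ : V → Bool, ∀ C ∈ F, ∃ x ∈ C, τ x.var = x.sign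

/-- `F` is a minimally unsatisfiable 2-CNF: a set of clash-free clauses of length at most two,
unsatisfiable, while the removal of any clause yields a satisfiable clause-set. -/
structure IsTwoMU (F : ClauseSet V) : Prop where
  clashFree : ∀ C ∈ F, C.ClashFree
  card_le_two : ∀ C ∈ F, C.card ≤ 2
  unsatisfiable : ¬ F.Satisfiable
  minimal : ∀ C ∈ F, ClauseSet.Satisfiable (F.erase C)

/-- Isomorphism of clause-sets: a complement-preserving bijection `f` from the literals of `F` to
the literals of `G` with `f(F) = G`. -/
def Isomorphic (F G : ClauseSet V) : Prop :=
  ∃ f : Lit V → Lit V, Set.BijOn f (F.lits : Set (Lit V)) (G.lits : Set (Lit V)) ∧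
    (∀ x ∈ F.lits, f x.compl = (f x).compl) ∧
    F.image (fun C => C.image f) = G

/-! ### DP-reduction -/

/-- DP-reduction: all clauses containing the variable `v` are replaced by all their resolvents
on `v`, where clauses `C`, `D` are resolvable on `v` if `v` is the only clash between them. -/
def dp (v : V) (F : ClauseSet V) : ClauseSet V :=
  (F.filter fun C => v ∉ C.image Lit.var) ∪
    ((F ×ˢ F).filter fun p => p.1 ∩ p.2.image Lit.compl = {⟨v, true⟩}).image
      fun p => p.1.erase ⟨v, true⟩ ∪ p.2.erase ⟨v, false⟩

/-- A variable is 1-singular if it occurs exactly once positively and exactly once negatively. -/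
def OneSingular (F : ClauseSet V) (v : V) : Prop :=
  F.ldeg ⟨v, true⟩ = 1 ∧ F.ldeg ⟨v, false⟩ = 1

/-- One step of 1-singular DP-reduction. -/
def OneDPStep (F G : ClauseSet V) : Prop := ∃ v, F.OneSingular v ∧ G = dp v F

/-- `N` is obtained from `F` by 1-singular DP-reductions, and no such reduction applies to `N`. -/
def IsOneDPNormalForm (F N : ClauseSet V) : Prop :=
  Relation.ReflTransGen OneDPStep F N ∧ ∀ v, ¬ N.OneSingular v

theorem mem_lits {F : ClauseSet V} {x : Lit V} : x ∈ F.lits ↔ x.var ∈ F.vars := by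
  constructor
  · intro h
    obtain ⟨p, hp, rfl⟩ := Finset.mem_image.1 h
    exact (Finset.mem_product.1 hp).1
  · intro h
    exact Finset.mem_image.2 ⟨(x.var, x.sign), Finset.mem_product.2 ⟨h, Finset.mem_univ _⟩, rfl⟩

theorem subset_lits {F : ClauseSet V} {C : Clause V} (hC : C ∈ F) : C ⊆ F.lits := by
  intro x hx
  exact mem_lits.2 (Finset.mem_biUnion.2 ⟨C, hC, Finset.mem_image_of_mem _ hx⟩)

theorem isomorphic_equivalence : Equivalence (Isomorphic (V := V)) where
  refl F := ⟨id, Set.bijOn_id _, fun _ _ => rfl, by simp⟩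
  symm := by
    rintro F G ⟨f, hf, hc, hF⟩
    refine Exists.elim (p := fun g : Lit V → Lit V => Set.InvOn g f (F.lits : Set (Lit V))
      (G.lits : Set (Lit V))) ?_ ?_
    · by_cases hne : Nonempty (Lit V)
      · exact ⟨Function.invFunOn f F.lits, hf.invOn_invFunOn⟩
      · exact ⟨id, fun x => (hne ⟨x⟩).elim, fun x => (hne ⟨x⟩).elim⟩
    intro g hg
    have hgb : Set.BijOn g (G.lits : Set (Lit V)) (F.lits : Set (Lit V)) := hf.symm hg.symm
    refine ⟨g, hgb, ?_, ?_⟩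
    · intro y hy
      have hgy : g y ∈ F.lits := hgb.mapsTo hy
      have h1 : f (g y).compl = y.compl := by rw [hc _ hgy, hg.2 hy]
      have h2 : (g y).compl ∈ F.lits :=  by
        have h3 : (g y).var ∈ F.vars := mem_lits.1 hgy
        exact mem_lits.2 h3
      rw [← h1, hg.1 h2]
    · rw [← hF, Finset.image_image]
      conv_rhs => rw [← Finset.image_id (s := F)]
      refine Finset.image_congr ?_
      intro C hC
      simp only [Function.comp, Finset.image_image, id]
      conv_rhs => rw [← Finset.image_id (s := C)]
      refine Finset.image_congr ?_
      intro x hx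
      exact hg.1 (subset_lits hC hx)
  trans := by
    rintro F G H ⟨f, hf, hfc, hF⟩ ⟨g, hg, hgc, hG⟩
    refine ⟨g ∘ f, hg.comp hf, ?_, ?_⟩
    · intro x hx
      simp only [Function.comp]
      rw [hfc x hx, hgc _ (hf.mapsTo hx)]
    · rw [← hG, ← hF, Finset.image_image]
      refine Finset.image_congr ?_
      intro C _
      simp [Finset.image_image]

end ClauseSet

/-! ### Digraphs, multigraphs, smoothing -/

/-- A finite digraph with vertices in `α`, without parallel arcs. (All digraphs used below are
loop-free.) -/
structure FinDigraph (α : Type*) where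
  verts : Finset α
  arcs : Finset (α × α)
  mem_verts : ∀ e ∈ arcs, e.1 ∈ verts ∧ e.2 ∈ verts

/-- A finite multigraph with vertices in `α`: every unordered pair of vertices, and every single
vertex (the diagonal pairs, giving loops), has a multiplicity. -/
structure Multigraph (α : Type*) where
  verts : Finset α
  mult : Sym2 α → ℕ
  mem_verts : ∀ e, mult e ≠ 0 → ∀ x ∈ e, x ∈ verts

/-- Forgetting the directions of the arcs, without contracting edges. -/
def FinDigraph.toMultigraph {α : Type*} [DecidableEq α] (D : FinDigraph α) : Multigraph α where
  verts := D.verts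
  mult e := (D.arcs.filter fun a => s(a.1, a.2) = e).card
  mem_verts := by
    intro e he x hx
    obtain ⟨a, ha⟩ := Finset.card_ne_zero.1 he
    obtain ⟨hD, rfl⟩ := Finset.mem_filter.1 ha
    rcases Sym2.mem_iff.1 hx with rfl | rfl
    · exact (D.mem_verts a hD).1
    · exact (D.mem_verts a hD).2

namespace Multigraph

/-- Isomorphism of multigraphs. -/
def Isomorphic {α β : Type*} (G : Multigraph α) (H : Multigraph β) : Prop :=
  ∃ f : {x // x ∈ G.verts} ≃ {x // x ∈ H.verts},
    ∀ v w, H.mult s((f v : β), (f w : β)) = G.mult s((v : α), (w : α))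

section

variable {α : Type*} [DecidableEq α]

/-- The degree of `v` is `∑ w, E({v, w})`. In particular a loop is counted once. -/
def deg (G : Multigraph α) (v : α) : ℕ := ∑ w ∈ G.verts, G.mult s(v, w)

/-- The neighbours of `v`. -/
def nbrs (G : Multigraph α) (v : α) : Finset α := G.verts.filter fun w => G.mult s(v, w) ≠ 0

/-- The vertices to which a smoothing step applies: linear vertices not adjacent to themselves. -/
def smoothable (G : Multigraph α) : Finset α :=
  G.verts.filter fun v => G.deg v = 2 ∧ v ∉ G.nbrs v

/-- The smoothing step at `v`: the vertex `v` is removed together with its edges, and an edge is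
added between `u` and `w`, where `{u, w}` (possibly `u = w`) is the set of neighbours of `v`. -/
def smoothAt (G : Multigraph α) (v : α) : Multigraph α where
  verts := G.verts.erase v
  mult e := if v ∈ e then 0 else G.mult e + if e.toFinset = G.nbrs v then 1 else 0
  mem_verts := by
    intro e he x hx
    by_cases hv : v ∈ e
    · simp [hv] at he
    · have hxv : x ≠ v := fun h => hv (h ▸ hx)
      refine Finset.mem_erase.2 ⟨hxv, ?_⟩
      by_cases h0 : G.mult e = 0
      · by_cases hn : e.toFinset = G.nbrs v
        · have : x ∈ G.nbrs v := hn ▸ Sym2.mem_toFinset.2 hx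
          exact (Finset.mem_filter.1 this).1
        · simp [hv, h0, hn] at he
      · exact G.mem_verts e h0 x hx

end

/-- The result of performing smoothing steps as long as possible, where in case of a choice the
first element in the given linear order is chosen. -/
def smooth {α : Type*} [LinearOrder α] (G : Multigraph α) : Multigraph α :=
  if h : G.smoothable.Nonempty then smooth (G.smoothAt (G.smoothable.min' h)) else G
termination_by G.verts.card
decreasing_by
  exact Finset.card_erase_lt_of_mem (Finset.mem_filter.1 (G.smoothable.min'_mem h)).1

/-- Two multigraphs are homeomorphic if their smoothings are isomorphic. -/
def Homeomorphic {α β : Type*} [LinearOrder α] [LinearOrder β]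
    (G : Multigraph α) (H : Multigraph β) : Prop :=
  G.smooth.Isomorphic H.smooth

theorem Isomorphic.refl {α : Type*} (G : Multigraph α) : G.Isomorphic G :=
  ⟨Equiv.refl _, fun _ _ => rfl⟩

theorem Isomorphic.symm {α β : Type*} {G : Multigraph α} {H : Multigraph β}
    (h : G.Isomorphic H) : H.Isomorphic G := by
  obtain ⟨f, hf⟩ := h
  exact ⟨f.symm, fun v w => by simpa using (hf (f.symm v) (f.symm w)).symm⟩

theorem Isomorphic.trans {α β γ : Type*} {G : Multigraph α} {H : Multigraph β} {K : Multigraph γ}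
    (h : G.Isomorphic H) (h' : H.Isomorphic K) : G.Isomorphic K := by
  obtain ⟨f, hf⟩ := h
  obtain ⟨g, hg⟩ := h'
  exact ⟨f.trans g, fun v w => by simpa using (hg (f v) (f w)).trans (hf v w)⟩

end Multigraph

/-! ### Implication digraph and multigraph -/

section

variable {V : Type*} [LinearOrder V]

/-- The implication digraph of a 2-CNF without the empty clause: the vertices are the literals of
`F`, and every clause `{x, y}` (possibly `x = y`) yields the arcs from the complement of `x` to `y`
and from the complement of `y` to `x`. -/
def ClauseSet.idg (F : ClauseSet V) : FinDigraph (Lit V) where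
  verts := F.lits
  arcs := (F.lits ×ˢ F.lits).filter fun e => ({e.1.compl, e.2} : Clause V) ∈ F
  mem_verts _ he := Finset.mem_product.1 (Finset.mem_filter.1 he).1

/-- The implication multigraph of a 2-CNF without the empty clause. -/
def ClauseSet.img (F : ClauseSet V) : Multigraph (Lit V) := F.idg.toMultigraph

end

/-! ### The classes of 2-MUs of deficiency `k` and their types -/

section

variable (V : Type*) [LinearOrder V]

/-- The 2-MUs of deficiency `k`. -/
def TwoMU (k : ℕ) : Type _ := {F : ClauseSet V // F.IsTwoMU ∧ F.deficiency = k}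

/-- The 2-MUs of deficiency `k` without 1-singular variables. -/
def TwoMUPlus (k : ℕ) : Type _ :=
  {F : ClauseSet V // F.IsTwoMU ∧ F.deficiency = k ∧ ∀ v, ¬ F.OneSingular v}

/-- Two 2-MUs are equivalent if their implication multigraphs are homeomorphic. -/
def homeoSetoid (k : ℕ) : Setoid (TwoMU V k) where
  r F G := F.1.img.Homeomorphic G.1.img
  iseqv := ⟨fun _ => .refl _, fun h => h.symm, fun h h' => h.trans h'⟩

/-- The homeomorphism types of 2-MUs of deficiency `k`. -/
def HomeoType (k : ℕ) : Type _ := Quotient (homeoSetoid V k)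

/-- Isomorphism of 2-MUs of deficiency `k` without 1-singular variables. -/
def plusSetoid (k : ℕ) : Setoid (TwoMUPlus V k) :=
  Setoid.comap Subtype.val ⟨ClauseSet.Isomorphic, ClauseSet.isomorphic_equivalence⟩

/-- The isomorphism types of 2-MUs of deficiency `k` without 1-singular variables. -/
def PlusIsoType (k : ℕ) : Type _ := Quotient (plusSetoid V k)

variable {V}

/-- The homeomorphism type of a 2-MU. -/
def TwoMU.homeoType {k : ℕ} (F : TwoMU V k) : HomeoType V k := Quotient.mk (homeoSetoid V k) F

/-- The isomorphism type of a 2-MU without 1-singular variables. -/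
def TwoMUPlus.isoType {k : ℕ} (F : TwoMUPlus V k) : PlusIsoType V k :=
  Quotient.mk (plusSetoid V k) F

end

/-! ### Binary bracelets -/

/-- Binary strings of length `k`, indexed cyclically, are equivalent if one is obtained from the
other by a rotation or by a reflection. -/
def braceletSetoid (k : ℕ) : Setoid (ZMod k → Bool) where
  r w w' := ∃ c : ZMod k, (∀ i, w' i = w (c + i)) ∨ (∀ i, w' i = w (c - i))
  iseqv := by
    refine ⟨fun w => ⟨0, Or.inl fun i => by simp⟩, ?_, ?_⟩
    · rintro w w' ⟨c, h | h⟩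
      · exact ⟨-c, Or.inl fun i => by simp [h]⟩
      · exact ⟨c, Or.inr fun i => by simp [h]⟩
    · rintro w w' w'' ⟨c, h | h⟩ ⟨d, h' | h'⟩
      · exact ⟨c + d, Or.inl fun i => by rw [h', h, add_assoc]⟩
      · exact ⟨c + d, Or.inr fun i => by rw [h', h, add_sub_assoc]⟩
      · exact ⟨c - d, Or.inr fun i => by rw [h', h, sub_sub]⟩
      · exact ⟨c - d, Or.inl fun i => by rw [h', h, sub_sub_eq_add_sub, add_sub_right_comm]⟩

/-- Equivalence classes of binary bracelets of length `k`. -/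
def Bracelet (k : ℕ) : Type := Quotient (braceletSetoid k)

/-- The class of a binary string. -/
def Bracelet.mk {k : ℕ} (w : ZMod k → Bool) : Bracelet k := Quotient.mk (braceletSetoid k) w

/-! ### The weak double cycle of a binary string -/

/-- For `m ≥ 3`, the digraph obtained from the double `m`-cycle (vertices `i`, arcs `i → i + 1` and
`i + 1 → i`) by splitting the vertices `i` with `s i = true`. Splitting `i` gives the vertices
`(i, false)`, which receives the arcs going into `i`, and `(i, true)`, which emits the arcs going
out of `i`, and an arc from `(i, false)` to `(i, true)`. An unsplit vertex is `(i, false)`. So this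
is a big cycle of `m` small cycles, where the `i`-th overlap of neighbouring small cycles is a
single vertex if `s i = false`, and a single arc if `s i = true`. -/
def nonlinearWDC (m : ℕ) [NeZero m] (s : ZMod m → Bool) : FinDigraph (ZMod m × Bool) where
  verts := Finset.univ.filter fun p => p.2 = true → s p.1 = true
  arcs := (Finset.univ ×ˢ Finset.univ).filter fun e =>
    ((e.2.1 = e.1.1 + 1 ∨ e.1.1 = e.2.1 + 1) ∧ e.1.2 = s e.1.1 ∧ e.2.2 = false) ∨
    (e.1.1 = e.2.1 ∧ s e.1.1 = true ∧ e.1.2 = false ∧ e.2.2 = true)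
  mem_verts := by
    rintro ⟨⟨i, b⟩, ⟨j, c⟩⟩ he
    simp only [Finset.mem_filter, Finset.mem_univ, true_and, Finset.mem_product] at he ⊢
    rcases he with ⟨-, rfl, rfl⟩ | ⟨rfl, hs, rfl, rfl⟩
    · simp
    · simp [hs]

/-- The string `w w` of length `2 k`. -/
def doubled {k : ℕ} (w : ZMod k → Bool) : ZMod (2 * k) → Bool :=
  fun j => w (ZMod.castHom (dvd_mul_left k 2) (ZMod k) j)

/-- The smooth multigraph encoded by a binary string `w` of length `k`: the big cycle of `2 k`
small cycles, whose consecutive overlaps are given by the string `w w`. -/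
def braceletMultigraph {k : ℕ} [NeZero k] (w : ZMod k → Bool) :
    Multigraph (ZMod (2 * k) × Bool) :=
  (nonlinearWDC (2 * k) (doubled w)).toMultigraph

end MU2

set_option linter.unusedSectionVars false

namespace MU2

variable {V : Type*}

/-! ### Literals -/

/-! An unsatisfiable 2-CNF without the empty clause has a literal `x` such that `x` and its
complement reach each other in the implication digraph. A shortest walk from `x` to its complement,
cut at the first clash, is a lasso: a path on distinct variables that returns to the complement of
one of its vertices. A lasso from `x` and one from its complement refute both values of `x`, so by
minimality their clauses make up the whole 2-MU (`IsTwoMU.eq_union_walkClauses`).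

Suppose first that every literal occurs at least twice. Counting occurrences along two opposite
lassos shows that each lasso closes at the complement of its start and visits every variable. Such a
path extends arc by arc to a closed walk through all literals (`Lasso.exists_pres`), and the
implication digraph is a double cycle on which complementation is the antipodal map. If a literal
`x` occurs once, in `{x, a}`, substituting `a` for its complement keeps minimal unsatisfiability and
the deficiency. When no variable is 1-singular, a degree count shows that undoing this substitution
splits two antipodal overlaps of the big cycle. By induction such a clause-set has a presentation
`Pres k F s q` with antipodally periodic `s`, that is, `s` has the form `w w`. The string determines
the clause-set up to isomorphism, rotations and reflections merely reindex a presentation, and every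
periodic string occurs.

With 1-singular variables, the smoothable vertices of the implication multigraph are exactly the
literals of these variables. The order on literals places complementary literals next to each other,
so smoothing handles them in pairs, and one pair amounts to one DP-reduction
(`IsPureTwoMU.exists_smooth_dp`). The smoothing is therefore the implication multigraph of a normal
form. Reductions at different variables commute (`Bridge.dp_comm`), so the normal form is unique.

Finally the multigraph remembers the bracelet. Degrees 3 and 4 tell split from unsplit overlaps, and
an isomorphism that respects adjacency of overlaps around the big cycle can only rotate or reflect
them (`NonlinearWDC.exists_symmetry`). -/

@[simp] theorem Lit.compl_compl (x : Lit V) : x.compl.compl = x := by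
  cases x; simp [Lit.compl]

@[simp] theorem Lit.compl_var (x : Lit V) : x.compl.var = x.var := rfl

@[simp] theorem Lit.compl_sign (x : Lit V) : x.compl.sign = !x.sign := rfl

@[simp] theorem Lit.compl_ne (x : Lit V) : x.compl ≠ x := by
  intro h
  have := congrArg Lit.sign h
  simp at this

@[simp] theorem Lit.ne_compl (x : Lit V) : x ≠ x.compl := x.compl_ne.symm

theorem Lit.compl_injective : Function.Injective (Lit.compl (V := V)) := fun x y h => by
  rw [← x.compl_compl, h, y.compl_compl]

@[simp] theorem Lit.compl_inj {x y : Lit V} : x.compl = y.compl ↔ x = y :=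
  Lit.compl_injective.eq_iff

theorem Lit.compl_eq_iff {x y : Lit V} : x.compl = y ↔ x = y.compl := by
  rw [← Lit.compl_inj, Lit.compl_compl]

theorem Lit.var_eq_iff {x y : Lit V} : x.var = y.var ↔ x = y ∨ x = y.compl := by
  constructor
  · intro h
    by_cases hs : x.sign = y.sign
    · exact Or.inl (Lit.ext h hs)
    · refine Or.inr (Lit.ext h ?_)
      revert hs
      cases h1 : x.sign <;> cases h2 : y.sign <;> simp [h2]
  · rintro (rfl | rfl) <;> simp

/-- The literal `x` is true under the assignment `τ`. -/
def Lit.Holds (τ : V → Bool) (x : Lit V) : Prop := τ x.var = x.sign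

@[simp] theorem Lit.holds_compl {τ : V → Bool} {x : Lit V} : x.compl.Holds τ ↔ ¬ x.Holds τ := by
  unfold Lit.Holds
  rw [Lit.compl_var, Lit.compl_sign]
  cases τ x.var <;> cases x.sign <;> simp

variable [LinearOrder V]

/-! ### Implications, reachability and the satisfiability criterion -/

namespace ClauseSet

variable {F G : ClauseSet V} {x y : Lit V}

theorem Satisfiable.mono (h : G.Satisfiable) (hFG : F ⊆ G) : F.Satisfiable := by
  obtain ⟨τ, hτ⟩ := h
  exact ⟨τ, fun C hC => hτ C (hFG hC)⟩

theorem IsTwoMU.eq_of_subset (hF : F.IsTwoMU) (hGF : G ⊆ F) (hG : ¬ G.Satisfiable) : G = F := by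
  by_contra hne
  obtain ⟨C, hC, hCG⟩ := Finset.exists_of_ssubset (hGF.ssubset_of_ne hne)
  exact hG ((hF.minimal C hC).mono fun D hD =>
    Finset.mem_erase.2 ⟨fun h => hCG (h ▸ hD), hGF hD⟩)

/-- The arcs of the implication digraph. -/
def Imp (F : ClauseSet V) (x y : Lit V) : Prop := ({x.compl, y} : Clause V) ∈ F

theorem Imp.contra (h : F.Imp x y) : F.Imp y.compl x.compl := by
  unfold Imp at *
  rwa [Lit.compl_compl, Finset.pair_comm]

theorem Imp.holds {τ : V → Bool} (hτ : ∀ C ∈ F, ∃ x ∈ C, x.Holds τ) (h : F.Imp x y)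
    (hx : x.Holds τ) : y.Holds τ := by
  obtain ⟨z, hz, hzτ⟩ := hτ _ h
  rcases Finset.mem_insert.1 hz with rfl | hz
  · exact absurd hx (Lit.holds_compl.1 hzτ)
  · rwa [← Finset.mem_singleton.1 hz]

theorem mem_vars {v : V} : v ∈ F.vars ↔ ∃ C ∈ F, ∃ x ∈ C, x.var = v := by
  simp [vars]

theorem var_mem_vars {C : Clause V} (hC : C ∈ F) (hx : x ∈ C) : x.var ∈ F.vars :=
  mem_vars.2 ⟨C, hC, x, hx, rfl⟩

theorem Imp.left_mem (h : F.Imp x y) : x ∈ F.lits :=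
  mem_lits.2 (var_mem_vars (x := x.compl) h (by simp))

theorem Imp.right_mem (h : F.Imp x y) : y ∈ F.lits :=
  mem_lits.2 (var_mem_vars h (by simp))

/-- Reachability in the implication digraph. -/
abbrev Reach (F : ClauseSet V) : Lit V → Lit V → Prop := Relation.ReflTransGen F.Imp

theorem Reach.contra (h : F.Reach x y) : F.Reach y.compl x.compl := by
  induction h with
  | refl => exact .refl
  | tail _ h ih => exact .head h.contra ih

theorem exists_pair {C : Clause V} (h0 : C ≠ ∅) (h2 : C.card ≤ 2) : ∃ x y, C = {x, y} := by
  have h1 : 0 < C.card := Finset.card_pos.2 (Finset.nonempty_iff_ne_empty.2 h0)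
  rcases (by omega : C.card = 1 ∨ C.card = 2) with h | h
  · obtain ⟨x, rfl⟩ := Finset.card_eq_one.1 h
    exact ⟨x, x, by simp⟩
  · obtain ⟨x, y, -, rfl⟩ := Finset.card_eq_two.1 h
    exact ⟨x, y, rfl⟩

/-- The satisfiability criterion for 2-CNFs. -/
theorem exists_contradictory_cycle (h0 : ∅ ∉ F) (h2 : ∀ C ∈ F, C.card ≤ 2)
    (hF : ¬ F.Satisfiable) : ∃ x, F.Reach x x.compl ∧ F.Reach x.compl x := by
  by_contra! hno
  -- Consistent sets of literals closed under implication. A maximal one will decide every variable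
  -- and thus define an assignment; Zorn is needed since `V` may be infinite.
  let 𝒮 : Set (Set (Lit V)) := {S | (∀ x ∈ S, x.compl ∉ S) ∧ ∀ x ∈ S, ∀ y, F.Imp x y → y ∈ S}
  obtain ⟨S, ⟨⟨hcons, hclosed⟩, hmax⟩⟩ := zorn_subset 𝒮 (by
    intro c hc hchain
    refine ⟨⋃₀ c, ⟨?_, ?_⟩, fun s hs => Set.subset_sUnion_of_mem hs⟩
    · rintro x ⟨s, hs, hxs⟩ ⟨t, ht, hxt⟩
      rcases hchain.total hs ht with h | h
      · exact (hc ht).1 x (h hxs) hxt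
      · exact (hc hs).1 x hxs (h hxt)
    · rintro x ⟨s, hs, hxs⟩ y hxy
      exact ⟨s, hs, (hc hs).2 x hxs y hxy⟩)
  have hreach : ∀ x ∈ S, ∀ y, F.Reach x y → y ∈ S := by
    intro x hx y hxy
    induction hxy with
    | refl => exact hx
    | tail _ h ih => exact hclosed _ ih _ h
  -- Adjoin everything reachable from `x`. If both `y` and its complement are reachable,
  -- contraposition gives a walk from `x` to its complement; a clash with `S` would put the
  -- complement of `x` into the closed set `S`.
  have key : ∀ x, ¬ F.Reach x x.compl → x.compl ∉ S → x ∈ S := by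
    intro x hx hxS
    have hmem : S ∪ {y | F.Reach x y} ∈ 𝒮 := by
      refine ⟨?_, ?_⟩
      · rintro y (hy | hy) (hy' | hy')
        · exact hcons y hy hy'
        · have := Reach.contra hy'
          rw [Lit.compl_compl] at this
          exact hxS (hreach y hy _ this)
        · exact hxS (hreach _ hy' _ (Reach.contra hy))
        · have := Reach.contra hy'
          rw [Lit.compl_compl] at this
          exact hx (Relation.ReflTransGen.trans hy this)
      · rintro y (hy | hy) z hyz
        · exact Or.inl (hclosed y hy z hyz)
        · exact Or.inr (Relation.ReflTransGen.tail hy hyz)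
    exact hmax hmem Set.subset_union_left (Or.inr .refl)
  have total : ∀ x, x ∈ S ∨ x.compl ∈ S := by
    intro x
    by_contra! h
    by_cases hx : F.Reach x x.compl
    · have := key x.compl (by rw [Lit.compl_compl]; exact hno x hx) (by
        rw [Lit.compl_compl]; exact h.1)
      exact h.2 this
    · exact h.1 (key x hx h.2)
  classical
  apply hF
  refine ⟨fun v => decide ((⟨v, true⟩ : Lit V) ∈ S), fun C hC => ?_⟩
  have hτ : ∀ x ∈ S, decide ((⟨x.var, true⟩ : Lit V) ∈ S) = x.sign := by
    rintro ⟨v, b⟩ hx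
    cases b
    · have := hcons _ hx
      simpa [Lit.compl] using this
    · simpa using hx
  obtain ⟨x, y, rfl⟩ := exists_pair (fun h => h0 (h ▸ hC)) (h2 C hC)
  rcases total x with hx | hx
  · exact ⟨x, by simp, hτ x hx⟩
  · refine ⟨y, by simp, hτ y (hclosed _ hx y ?_)⟩
    simpa [Imp] using hC

/-! ### Lassos -/

/-- A lasso in the implication digraph: a path `p 0, …, p m` on distinct variables, together with
an arc from `p m` to the complement of some `p j`. -/
structure Lasso (F : ClauseSet V) (p : ℕ → Lit V) (m j : ℕ) : Prop where
  le : j ≤ m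
  imp : ∀ i ≤ m, F.Imp (p i) (p (i + 1))
  last : p (m + 1) = (p j).compl
  inj : ∀ i ≤ m, ∀ l ≤ m, (p i).var = (p l).var → i = l

/-- The clauses used by the first `m + 1` arcs of a walk. -/
def walkClauses (p : ℕ → Lit V) (m : ℕ) : ClauseSet V :=
  (Finset.range (m + 1)).image fun i => {(p i).compl, p (i + 1)}

theorem mem_walkClauses {p : ℕ → Lit V} {m : ℕ} {C : Clause V} :
    C ∈ walkClauses p m ↔ ∃ i ≤ m, C = {(p i).compl, p (i + 1)} := by
  simp [walkClauses, eq_comm]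

theorem exists_walk (h : F.Reach x y) :
    ∃ (p : ℕ → Lit V) (n : ℕ), p 0 = x ∧ p n = y ∧ ∀ i < n, F.Imp (p i) (p (i + 1)) := by
  induction h with
  | refl => exact ⟨fun _ => x, 0, rfl, rfl, by simp⟩
  | @tail b c _ h ih =>
    obtain ⟨p, n, h0, hn, hp⟩ := ih
    refine ⟨fun i => if i ≤ n then p i else c, n + 1, by simpa using h0, by simp, ?_⟩
    intro i hi
    rcases Nat.lt_succ_iff_lt_or_eq.1 hi with hi | rfl
    · simpa [hi.le, Nat.succ_le_of_lt hi] using hp i hi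
    · simpa [hn] using h

/-- A shortest walk from `x` to its complement has no repeated literal. Stopped at the first arc
that hits the complement of an earlier vertex, it has no repeated variable either. -/
theorem exists_lasso (h : F.Reach x x.compl) :
    ∃ (p : ℕ → Lit V) (m j : ℕ), p 0 = x ∧ Lasso F p m j := by
  classical
  have hex : ∃ n, ∃ p : ℕ → Lit V, p 0 = x ∧ p n = x.compl ∧ ∀ i < n, F.Imp (p i) (p (i + 1)) := by
    obtain ⟨p, n, hp⟩ := exists_walk h
    exact ⟨n, p, hp⟩
  obtain ⟨p, h0, hn, hp⟩ := Nat.find_spec hex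
  set n := Nat.find hex with hndef
  -- The segment between two equal vertices could be cut out, giving a shorter walk.
  have hinj : ∀ i l, i < l → l ≤ n → p i ≠ p l := by
    intro i l hil hl heq
    refine Nat.find_min hex (m := n - (l - i)) (by omega)
      ⟨fun t => if t ≤ i then p t else p (t + (l - i)), by simpa using h0, ?_, ?_⟩
    · by_cases hc : n - (l - i) ≤ i
      · have e1 : n - (l - i) = i := by omega
        have e2 : l = n := by omega
        simp only [e1, le_refl, if_true]
        rw [heq, e2, hn]
      · simp only [hc, if_false]
        rw [show n - (l - i) + (l - i) = n by omega, hn]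
    · intro t ht
      rcases lt_trichotomy t i with hti | rfl | hti
      · simpa [hti.le, Nat.succ_le_of_lt hti] using hp t (by omega)
      · simp only [le_refl, if_true, Nat.not_succ_le_self, if_false]
        rw [heq, show t + 1 + (l - t) = l + 1 by omega]
        exact hp l (by omega)
      · simp only [show ¬ t ≤ i by omega, show ¬ t + 1 ≤ i by omega, if_false]
        rw [show t + 1 + (l - i) = t + (l - i) + 1 by omega]
        exact hp _ (by omega)
  have hnpos : 0 < n := by
    rcases Nat.eq_zero_or_pos n with h | h
    · rw [h, h0] at hn
      exact absurd hn (by simp)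
    · exact h
  have hex2 : ∃ m, ∃ j ≤ m, p (m + 1) = (p j).compl :=
    ⟨n - 1, 0, by omega, by rw [show n - 1 + 1 = n by omega, hn, h0]⟩
  obtain ⟨j, hj, hlast⟩ := Nat.find_spec hex2
  set m := Nat.find hex2 with hmdef
  have hmn : m ≤ n - 1 := Nat.find_min' hex2
    ⟨0, by omega, by rw [show n - 1 + 1 = n by omega, hn, h0]⟩
  have hno : ∀ i l, i < l → l ≤ m → (p i).var ≠ (p l).var := by
    intro i l hil hl heq
    rcases Lit.var_eq_iff.1 heq with h | h
    · exact hinj i l hil (by omega) h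
    · refine Nat.find_min hex2 (m := l - 1) (by omega) ⟨i, by omega, ?_⟩
      rw [show l - 1 + 1 = l by omega, h, Lit.compl_compl]
  refine ⟨p, m, j, h0, hj, fun i hi => hp i (by omega), hlast, fun i hi l hl heq => ?_⟩
  rcases lt_trichotomy i l with h | h | h
  · exact absurd heq (hno i l h hl)
  · exact h
  · exact absurd heq.symm (hno l i h hi)

namespace Lasso

variable {p : ℕ → Lit V} {m j : ℕ}

theorem walkClauses_subset (h : Lasso F p m j) : walkClauses p m ⊆ F := by
  intro C hC
  obtain ⟨i, hi, rfl⟩ := mem_walkClauses.1 hC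
  exact h.imp i hi

/-- Truth propagates along the path and would reach both `p j` and its complement. -/
theorem not_holds (h : Lasso F p m j) {τ : V → Bool}
    (hτ : ∀ C ∈ walkClauses p m, ∃ x ∈ C, x.Holds τ) : ¬ (p 0).Holds τ := by
  intro h0
  have : ∀ i, i ≤ m + 1 → (p i).Holds τ := by
    intro i
    induction i with
    | zero => exact fun _ => h0
    | succ i ih =>
      intro hi
      exact Imp.holds hτ (mem_walkClauses.2 ⟨i, by omega, rfl⟩) (ih (by omega))
  have h1 := this (m + 1) le_rfl
  rw [h.last, Lit.holds_compl] at h1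
  exact h1 (this j (by have := h.le; omega))

theorem reach_of_le (h : Lasso F p m j) {i l : ℕ} (hil : i ≤ l) (hl : l ≤ m + 1) :
    F.Reach (p i) (p l) := by
  induction l, hil using Nat.le_induction with
  | base => exact .refl
  | succ l _ ih => exact .tail (ih (by omega)) (h.imp l (by omega))

/-- After the closing arc, the contrapositive of the initial segment leads from the complement of `p
j` back to that of `p 0`. -/
theorem reach_last (h : Lasso F p m j) {i : ℕ} (hi : i ≤ m + 1) :
    F.Reach (p i) (p 0).compl := by
  refine (h.reach_of_le hi le_rfl).trans ?_
  rw [h.last]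
  exact Reach.contra (h.reach_of_le (Nat.zero_le j) (by have := h.le; omega))

end Lasso

variable {p p' : ℕ → Lit V} {m m' j j' : ℕ}

/-- One lasso refutes `p 0` and the other its complement, so together their clauses are
unsatisfiable, and minimality leaves room for nothing else. -/
theorem IsTwoMU.eq_union_walkClauses (hF : F.IsTwoMU) (h : Lasso F p m j) (h' : Lasso F p' m' j')
    (h0 : p' 0 = (p 0).compl) : walkClauses p m ∪ walkClauses p' m' = F := by
  refine hF.eq_of_subset (Finset.union_subset h.walkClauses_subset h'.walkClauses_subset) ?_
  rintro ⟨τ, hτ⟩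
  have h1 := h.not_holds (τ := τ) fun C hC => hτ C (Finset.mem_union_left _ hC)
  have h2 := h'.not_holds (τ := τ) fun C hC => hτ C (Finset.mem_union_right _ hC)
  rw [h0, Lit.holds_compl] at h2
  exact h2 h1

/-- The implication digraph of a 2-MU is strongly connected. -/
theorem IsTwoMU.reach (hF : F.IsTwoMU) (h0 : ∅ ∉ F) (hx : x ∈ F.lits) (hy : y ∈ F.lits) :
    F.Reach x y := by
  obtain ⟨z, hz, hz'⟩ := exists_contradictory_cycle h0 hF.card_le_two hF.unsatisfiable
  obtain ⟨p, m, j, hp0, hp⟩ := exists_lasso hz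
  obtain ⟨p', m', j', hp0', hp'⟩ := exists_lasso (x := z.compl) (by rwa [Lit.compl_compl])
  have hU := hF.eq_union_walkClauses hp hp' (by rw [hp0, hp0'])
  have h1 : ∀ i ≤ m + 1, F.Reach z (p i) ∧ F.Reach (p i) z := fun i hi => by
    have a := hp.reach_of_le (Nat.zero_le i) hi
    have b := hp.reach_last hi
    rw [hp0] at a b
    exact ⟨a, b.trans hz'⟩
  have h2 : ∀ i ≤ m' + 1, F.Reach z (p' i) ∧ F.Reach (p' i) z := fun i hi => by
    have a := hp'.reach_of_le (Nat.zero_le i) hi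
    have b := hp'.reach_last hi
    rw [hp0'] at a b
    rw [Lit.compl_compl] at b
    exact ⟨hz.trans a, b⟩
  have hcompl : ∀ u, F.Reach z u ∧ F.Reach u z → F.Reach z u.compl ∧ F.Reach u.compl z :=
    fun u hu => ⟨hz.trans (Reach.contra hu.2), (Reach.contra hu.1).trans hz'⟩
  have hwalk : ∀ C ∈ F, ∀ u ∈ C, F.Reach z u ∧ F.Reach u z := by
    intro C hC u hu
    rw [← hU, Finset.mem_union] at hC
    rcases hC with hC | hC <;> obtain ⟨i, hi, rfl⟩ := mem_walkClauses.1 hC <;>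
      rcases Finset.mem_insert.1 hu with rfl | hu
    · exact hcompl _ (h1 i (by omega))
    · rw [Finset.mem_singleton.1 hu]; exact h1 _ (by omega)
    · exact hcompl _ (h2 i (by omega))
    · rw [Finset.mem_singleton.1 hu]; exact h2 _ (by omega)
  have hall : ∀ u ∈ F.lits, F.Reach z u ∧ F.Reach u z := by
    intro u hu
    obtain ⟨C, hC, u', hu', hvar⟩ := mem_vars.1 (mem_lits.1 hu)
    rcases Lit.var_eq_iff.1 hvar with h | h
    · exact h ▸ hwalk C hC u' hu'
    · have := hcompl _ (hwalk C hC u' hu')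
      rwa [h, Lit.compl_compl] at this
  exact (hall x hx).2.trans (hall y hy).1

theorem compl_mem_lits : x.compl ∈ F.lits ↔ x ∈ F.lits := by simp [mem_lits]

theorem IsTwoMU.exists_lasso (hF : F.IsTwoMU) (h0 : ∅ ∉ F) (hx : x ∈ F.lits) :
    ∃ (p : ℕ → Lit V) (m j : ℕ), p 0 = x ∧ Lasso F p m j :=
  ClauseSet.exists_lasso (hF.reach h0 hx (compl_mem_lits.2 hx))

theorem Lasso.le_card_vars (h : Lasso F p m j) : m + 1 ≤ F.vars.card := by
  have hsub : (Finset.range (m + 1)).image (fun i => (p i).var) ⊆ F.vars := by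
    intro v hv
    obtain ⟨i, hi, rfl⟩ := Finset.mem_image.1 hv
    exact mem_lits.1 (h.imp i (by simpa [Nat.lt_succ_iff] using hi)).left_mem
  have := Finset.card_le_card hsub
  rwa [Finset.card_image_of_injOn, Finset.card_range] at this
  intro i hi l hl heq
  simp at hi hl
  exact h.inj i hi l hl heq

theorem card_walkClauses_le : (walkClauses p m).card ≤ m + 1 :=
  Finset.card_image_le.trans (by simp)

/-- 2-MUs in which all clauses have length two. -/
structure IsPureTwoMU (F : ClauseSet V) : Prop extends F.IsTwoMU where
  card_eq_two : ∀ C ∈ F, C.card = 2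

/-- The empty clause alone is already unsatisfiable, with deficiency 1. A unit clause is a lasso
with one arc; the opposite lasso has at most as many arcs as there are variables, so the deficiency
is again at most 1. -/
theorem IsTwoMU.isPureTwoMU (hF : F.IsTwoMU) (hd : 2 ≤ F.deficiency) : F.IsPureTwoMU := by
  have hempty : ∅ ∉ F := by
    intro h
    have h1 : ({∅} : ClauseSet V) = F := hF.eq_of_subset (by simpa using h) (by
      rintro ⟨τ, hτ⟩
      obtain ⟨x, hx, -⟩ := hτ ∅ (by simp)
      simp at hx)
    have : F.card = 1 := by simp [← h1]
    unfold deficiency at hd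
    omega
  refine ⟨hF, fun C hC => le_antisymm (hF.card_le_two C hC) ?_⟩
  by_contra! hlt
  obtain ⟨x, y, hxy⟩ := exists_pair (fun h => hempty (h ▸ hC)) (hF.card_le_two C hC)
  have hy : x = y := by
    by_contra hne
    rw [hxy, Finset.card_pair hne] at hlt
    omega
  subst hy
  have himp : F.Imp x.compl x := by simpa [Imp, ← hxy] using hC
  have hl : Lasso F (fun i => if i = 0 then x.compl else x) 0 0 := by
    refine ⟨le_rfl, ?_, by simp, by simp⟩
    intro i hi
    obtain rfl : i = 0 := by omega
    simpa using himp
  obtain ⟨p, m, j, hp0, hp⟩ := hF.exists_lasso hempty himp.right_mem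
  have hU := hF.eq_union_walkClauses hl hp (by simp [hp0])
  have h1 := hp.le_card_vars
  have h2 := Finset.card_union_le (walkClauses (fun i => if i = 0 then x.compl else x) 0)
    (walkClauses p m)
  have h3 := card_walkClauses_le (p := fun i => if i = 0 then x.compl else x) (m := 0)
  have h4 := card_walkClauses_le (p := p) (m := m)
  rw [hU] at h2
  unfold deficiency at hd
  omega

namespace IsPureTwoMU

theorem empty_notMem (hF : F.IsPureTwoMU) : ∅ ∉ F := fun h => by
  simpa using hF.card_eq_two _ h

theorem exists_eq_pair (hF : F.IsPureTwoMU) {C : Clause V} (hC : C ∈ F) (hx : x ∈ C) :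
    ∃ y, y.var ≠ x.var ∧ C = {x, y} := by
  obtain ⟨a, b, hab, rfl⟩ := Finset.card_eq_two.1 (hF.card_eq_two C hC)
  have hcf := hF.clashFree _ hC
  have hvar : a.var ≠ b.var := by
    intro h
    rcases Lit.var_eq_iff.1 h with h | h
    · exact hab h
    · exact hcf b (by simp) (by simp [h])
  rcases Finset.mem_insert.1 hx with rfl | hx
  · exact ⟨b, hvar.symm, rfl⟩
  · rw [Finset.mem_singleton] at hx
    subst hx
    exact ⟨a, hvar, Finset.pair_comm _ _⟩

theorem var_ne (hF : F.IsPureTwoMU) (h : F.Imp x y) : x.var ≠ y.var := by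
  obtain ⟨z, hz, hC⟩ := hF.exists_eq_pair h (x := x.compl) (by simp)
  have : z ∈ ({x.compl, y} : Clause V) := by simp [hC]
  rcases Finset.mem_insert.1 this with rfl | h'
  · exact absurd rfl hz
  · rw [Finset.mem_singleton] at h'
    subst h'
    exact hz.symm

/-- Every literal over the variables of a 2-MU occurs. -/
theorem exists_mem (hF : F.IsPureTwoMU) (hx : x ∈ F.lits) : ∃ C ∈ F, x ∈ C := by
  rcases Relation.ReflTransGen.cases_tail
    (hF.reach hF.empty_notMem (compl_mem_lits.2 hx) hx) with h | ⟨z, -, hz⟩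
  · exact absurd h (by simp)
  · exact ⟨_, hz, by simp⟩

theorem ldeg_pos (hF : F.IsPureTwoMU) (hx : x ∈ F.lits) : 0 < F.ldeg x := by
  obtain ⟨C, hC, hxC⟩ := hF.exists_mem hx
  exact Finset.card_pos.2 ⟨C, Finset.mem_filter.2 ⟨hC, hxC⟩⟩

end IsPureTwoMU

theorem ldeg_eq_one_iff : F.ldeg x = 1 ↔ ∃ C, C ∈ F ∧ x ∈ C ∧ ∀ D ∈ F, x ∈ D → D = C := by
  unfold ldeg
  rw [Finset.card_eq_one]
  constructor
  · rintro ⟨C, hC⟩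
    have h1 : C ∈ F.filter fun C => x ∈ C := by simp [hC]
    refine ⟨C, (Finset.mem_filter.1 h1).1, (Finset.mem_filter.1 h1).2, fun D hD hxD => ?_⟩
    have h2 : D ∈ F.filter fun C => x ∈ C := Finset.mem_filter.2 ⟨hD, hxD⟩
    rwa [hC, Finset.mem_singleton] at h2
  · rintro ⟨C, hC, hxC, h⟩
    refine ⟨C, Finset.eq_singleton_iff_unique_mem.2 ⟨Finset.mem_filter.2 ⟨hC, hxC⟩, ?_⟩⟩
    intro D hD
    exact h D (Finset.mem_filter.1 hD).1 (Finset.mem_filter.1 hD).2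

theorem two_le_ldeg_iff : 2 ≤ F.ldeg x ↔ ∃ C ∈ F, ∃ D ∈ F, x ∈ C ∧ x ∈ D ∧ C ≠ D := by
  unfold ldeg
  rw [← Nat.lt_iff_add_one_le, Finset.one_lt_card]
  simp only [Finset.mem_filter]
  constructor
  · rintro ⟨C, ⟨hC, hx⟩, D, ⟨hD, hx'⟩, hne⟩
    exact ⟨C, hC, D, hD, hx, hx', hne⟩
  · rintro ⟨C, hC, D, hD, hx, hx', hne⟩
    exact ⟨C, ⟨hC, hx⟩, D, ⟨hD, hx'⟩, hne⟩

theorem ldeg_pos_iff : 0 < F.ldeg x ↔ ∃ C ∈ F, x ∈ C := by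
  unfold ldeg
  rw [Finset.card_pos]
  constructor
  · rintro ⟨C, hC⟩
    exact ⟨C, (Finset.mem_filter.1 hC).1, (Finset.mem_filter.1 hC).2⟩
  · rintro ⟨C, hC, hx⟩
    exact ⟨C, Finset.mem_filter.2 ⟨hC, hx⟩⟩

end ClauseSet

end MU2

namespace MU2

/-! ### Arithmetic modulo `2 k` -/

section

variable {k : ℕ}

theorem half_add_half : (k : ZMod (2 * k)) + k = 0 := by
  have := ZMod.natCast_self (2 * k)
  push_cast at this
  linear_combination this

theorem add_half_add_half (i : ZMod (2 * k)) : i + k + k = i := by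
  rw [add_assoc, half_add_half, add_zero]

theorem natCast_ne_zero {n a : ℕ} (h0 : 0 < a) (h : a < n) : (a : ZMod n) ≠ 0 := by
  rw [Ne, ZMod.natCast_eq_zero_iff]
  exact fun hd => absurd (Nat.le_of_dvd h0 hd) (by omega)

theorem add_half_ne [NeZero k] (i : ZMod (2 * k)) : i + k ≠ i := by
  have := NeZero.pos k
  intro h
  exact natCast_ne_zero (n := 2 * k) (a := k) this (by omega) (by linear_combination h)

theorem val_add_natCast {n : ℕ} [NeZero n] (x : ZMod n) {c : ℕ} (hc : c < n) :
    (x + c).val = if x.val + c < n then x.val + c else x.val + c - n := by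
  have hx := x.val_lt
  rw [ZMod.val_add, ZMod.val_natCast, Nat.mod_eq_of_lt hc]
  split_ifs with h
  · exact Nat.mod_eq_of_lt h
  · rw [Nat.mod_eq_sub_mod (by omega), Nat.mod_eq_of_lt (by omega)]

theorem doubled_add_half (w : ZMod k → Bool) (i : ZMod (2 * k)) :
    doubled w (i + k) = doubled w i := by
  simp [doubled]

theorem exists_eq_doubled [NeZero k] {s : ZMod (2 * k) → Bool} (hs : ∀ i, s (i + k) = s i) :
    ∃ w : ZMod k → Bool, s = doubled w := by
  refine ⟨fun i => s (i.val : ZMod (2 * k)), ?_⟩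
  funext i
  have hi := i.val_lt
  have hcast : (ZMod.castHom (dvd_mul_left k 2) (ZMod k) i).val = i.val % k := by
    rw [ZMod.castHom_apply, ZMod.cast_eq_val, ZMod.val_natCast]
  simp only [doubled, hcast]
  conv_lhs => rw [← ZMod.natCast_zmod_val i]
  rcases Nat.lt_or_ge i.val k with h | h
  · rw [Nat.mod_eq_of_lt h]
  · rw [Nat.mod_eq_sub_mod h, Nat.mod_eq_of_lt (by omega), ← hs ((i.val - k : ℕ) : ZMod (2 * k)),
      ← Nat.cast_add, Nat.sub_add_cancel h]

end

/-! ### Presentations as big cycles of small cycles -/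

variable {V : Type*} [LinearOrder V]

/-- A presentation of `F` as a big cycle of `2 k` small cycles with the `i`-th overlap given by
`s i`; the literal `q i` receives the arcs going into the `i`-th overlap. -/
structure Pres (k : ℕ) (F : ClauseSet V) (s : ZMod (2 * k) → Bool) (q : ZMod (2 * k) → Lit V) :
    Prop where
  periodic : ∀ i, s (i + k) = s i
  unsplit : ∀ i, s i = false → q (i + k) = (q i).compl
  inj : ∀ i j, (q i).var = (q j).var → j = i ∨ (j = i + k ∧ s i = false)
  mem : ∀ C, C ∈ F ↔ (∃ i, C = {q i, q (i + k + 1)}) ∨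
    ∃ i, s i = true ∧ C = {(q i).compl, (q (i + k)).compl}

namespace Pres

variable {k : ℕ} {F G : ClauseSet V} {s : ZMod (2 * k) → Bool} {q : ZMod (2 * k) → Lit V}

theorem clause_mem (h : Pres k F s q) (i : ZMod (2 * k)) : ({q i, q (i + k + 1)} : Clause V) ∈ F :=
  (h.mem _).2 (Or.inl ⟨i, rfl⟩)

theorem split_mem (h : Pres k F s q) {i : ZMod (2 * k)} (hi : s i = true) :
    ({(q i).compl, (q (i + k)).compl} : Clause V) ∈ F :=
  (h.mem _).2 (Or.inr ⟨i, hi, rfl⟩)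

/-- If `q i` holds, then `q (i + k)` fails, and the clause at `i + k` forces `q (i + 1)`. Truth thus
runs round the cycle to `q (i + k)`, a contradiction; and if all `q i` fail, so does the clause at
`0`. Only inclusion of the clauses is assumed, so that minimality can then identify the clause-set.
-/
theorem unsat_of_subset (hunsplit : ∀ i, s i = false → q (i + k) = (q i).compl)
    (h1 : ∀ i, ({q i, q (i + k + 1)} : Clause V) ∈ F)
    (h2 : ∀ i, s i = true → ({(q i).compl, (q (i + k)).compl} : Clause V) ∈ F) :
    ¬ F.Satisfiable := by
  rintro ⟨τ, hτ⟩
  have hc : ∀ i, (q i).Holds τ → ¬ (q (i + k)).Holds τ := by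
    intro i hi
    cases hs : s i
    · rw [hunsplit i hs, Lit.holds_compl]
      exact not_not.2 hi
    · obtain ⟨x, hx, hxτ⟩ := hτ _ (h2 i hs)
      change x.Holds τ at hxτ
      simp only [Finset.mem_insert, Finset.mem_singleton] at hx
      rcases hx with rfl | rfl
      · exact absurd hi (Lit.holds_compl.1 hxτ)
      · exact Lit.holds_compl.1 hxτ
  have hor : ∀ i, ¬ (q i).Holds τ → (q (i + k + 1)).Holds τ := by
    intro i hi
    obtain ⟨x, hx, hxτ⟩ := hτ _ (h1 i)
    change x.Holds τ at hxτ
    simp only [Finset.mem_insert, Finset.mem_singleton] at hx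
    rcases hx with rfl | rfl
    · exact absurd hxτ hi
    · exact hxτ
  have hstep : ∀ i, (q i).Holds τ → (q (i + 1)).Holds τ := by
    intro i hi
    have := hor _ (hc i hi)
    rwa [add_half_add_half] at this
  have hall : ∀ i (n : ℕ), (q i).Holds τ → (q (i + n)).Holds τ := by
    intro i n hi
    induction n with
    | zero => simpa using hi
    | succ n ih => rw [Nat.cast_succ, ← add_assoc]; exact hstep _ ih
  have hno : ∀ i, ¬ (q i).Holds τ := fun i hi => hc i hi (hall i k hi)
  exact hno _ (hor 0 (hno 0))

theorem not_satisfiable (h : Pres k F s q) : ¬ F.Satisfiable :=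
  unsat_of_subset h.unsplit h.clause_mem fun _ => h.split_mem

/-- The only distinct indices sharing a variable are `i` and `i + k` at an unsplit overlap, where
the literals are complementary; prescribed truth values are therefore consistent once they are
opposite there. -/
theorem exists_assignment (h : Pres k F s q) (t : ZMod (2 * k) → Prop)
    (ht : ∀ i, s i = false → (t (i + k) ↔ ¬ t i)) :
    ∃ τ : V → Bool, ∀ i, (q i).Holds τ ↔ t i := by
  classical
  refine ⟨fun v => decide (∃ i, (q i).var = v ∧ ((q i).sign = true ↔ t i)), fun i => ?_⟩
  have hiff : (∃ j, (q j).var = (q i).var ∧ ((q j).sign = true ↔ t j)) ↔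
      ((q i).sign = true ↔ t i) := by
    constructor
    · rintro ⟨j, hj, hjt⟩
      rcases h.inj j i hj with rfl | ⟨rfl, hs⟩
      · exact hjt
      · rw [h.unsplit j hs, ht j hs, Lit.compl_sign]
        cases hsg : (q j).sign <;> simp [hsg] at hjt ⊢ <;> exact hjt
    · exact fun hi => ⟨i, rfl, hi⟩
  simp only [Lit.Holds, hiff]
  by_cases hti : t i <;> cases hsg : (q i).sign <;> simp [hti]

theorem one_ne_zero_of_le (hk : 2 ≤ k) : (1 : ZMod (2 * k)) ≠ 0 := by
  have := natCast_ne_zero (n := 2 * k) (a := 1) (by omega) (by omega)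
  simpa using this

theorem half_succ_ne_zero (hk : 2 ≤ k) : (k + 1 : ZMod (2 * k)) ≠ 0 := by
  have := natCast_ne_zero (n := 2 * k) (a := k + 1) (by omega) (by omega)
  simpa using this

theorem clause_var_ne (h : Pres k F s q) (hk : 2 ≤ k) (i : ZMod (2 * k)) :
    (q i).var ≠ (q (i + k + 1)).var := by
  intro he
  rcases h.inj _ _ he with h1 | ⟨h1, -⟩
  · exact half_succ_ne_zero hk (by linear_combination h1)
  · exact one_ne_zero_of_le hk (by linear_combination h1)

theorem split_var_ne (h : Pres k F s q) [NeZero k] {i : ZMod (2 * k)} (hi : s i = true) :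
    (q i).var ≠ (q (i + k)).var := by
  intro he
  rcases h.inj _ _ he with h1 | ⟨-, h1⟩
  · exact add_half_ne i h1
  · simp [hi] at h1

theorem isPureTwoMU (h : Pres k F s q) (hk : 2 ≤ k) : F.IsPureTwoMU := by
  have : NeZero k := ⟨by omega⟩
  have hpair : ∀ {x y : Lit V}, x.var ≠ y.var →
      Clause.ClashFree ({x, y} : Clause V) ∧ ({x, y} : Clause V).card = 2 := by
    intro x y hxy
    refine ⟨?_, Finset.card_pair fun h => hxy (h ▸ rfl)⟩
    intro z hz hz'
    simp only [Finset.mem_insert, Finset.mem_singleton] at hz hz'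
    rcases hz with rfl | rfl <;> rcases hz' with h | h
    · simp at h
    · exact hxy (by rw [← h, Lit.compl_var])
    · exact hxy (by rw [← h, Lit.compl_var])
    · simp at h
  have hall : ∀ C ∈ F, C.ClashFree ∧ C.card = 2 := by
    intro C hC
    rcases (h.mem C).1 hC with ⟨i, rfl⟩ | ⟨i, hi, rfl⟩
    · exact hpair (h.clause_var_ne hk i)
    · exact hpair (x := (q i).compl) (y := (q (i + k)).compl) (h.split_var_ne hi)
  refine ⟨⟨fun C hC => (hall C hC).1, fun C hC => (hall C hC).2.le, h.not_satisfiable, ?_⟩,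
    fun C hC => (hall C hC).2⟩
  -- Here `t i` is the intended truth value of `q i`: consistency first, then the cycle clauses and
  -- the split clauses other than `C`.
  have hkey : ∀ C (t : ZMod (2 * k) → Prop), (∀ i, s i = false → (t (i + k) ↔ ¬ t i)) →
      (∀ i, C ≠ {q i, q (i + k + 1)} → t i ∨ t (i + k + 1)) →
      (∀ i, s i = true → C ≠ {(q i).compl, (q (i + k)).compl} → ¬ t i ∨ ¬ t (i + k)) →
      ClauseSet.Satisfiable (F.erase C) := by
    intro C t h1 h2 h3
    obtain ⟨τ, hτ⟩ := h.exists_assignment t h1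
    refine ⟨τ, fun D hD => ?_⟩
    obtain ⟨hne, hD⟩ := Finset.mem_erase.1 hD
    rcases (h.mem D).1 hD with ⟨i, rfl⟩ | ⟨i, hi, rfl⟩
    · rcases h2 i hne.symm with hi | hi
      · exact ⟨q i, by simp, (hτ i).2 hi⟩
      · exact ⟨_, by simp, (hτ _).2 hi⟩
    · rcases h3 i hi hne.symm with hi | hi
      · exact ⟨(q i).compl, by simp, Lit.holds_compl.2 (mt (hτ i).1 hi)⟩
      · exact ⟨(q (i + k)).compl, by simp, Lit.holds_compl.2 (mt (hτ _).1 hi)⟩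
  have hv1 : ∀ i j : ZMod (2 * k), (i + k - j).val =
      if (i - j).val + k < 2 * k then (i - j).val + k else (i - j).val + k - 2 * k := by
    intro i j
    rw [← val_add_natCast (i - j) (c := k) (by omega)]
    congr 1
    ring
  have hv2 : ∀ i j : ZMod (2 * k), (i + k + 1 - j).val =
      if (i - j).val + (k + 1) < 2 * k then (i - j).val + (k + 1)
      else (i - j).val + (k + 1) - 2 * k := by
    intro i j
    rw [← val_add_natCast (i - j) (c := k + 1) (by omega)]
    congr 1
    push_cast
    ring
  have hzero : ∀ i j : ZMod (2 * k), (i - j).val = 0 → i = j := by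
    intro i j hij
    exact sub_eq_zero.1 ((ZMod.val_eq_zero _).1 hij)
  intro C hC
  rcases (h.mem C).1 hC with ⟨j, rfl⟩ | ⟨j, hj, rfl⟩
  -- Exactly the `k` literals following `q j` are true. Antipodal literals get opposite values, and
  -- only the removed clause, at offsets `0` and `k + 1`, has both members false.
  · refine hkey _ (fun i => 1 ≤ (i - j).val ∧ (i - j).val ≤ k) ?_ ?_ ?_
    · intro i _
      have := (i - j).val_lt
      rw [hv1]
      split_ifs <;> omega
    · intro i hne
      have := (i - j).val_lt
      have h0 : (i - j).val ≠ 0 := fun h0 => hne (by rw [hzero i j h0])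
      rw [hv2]
      split_ifs <;> omega
    · intro i _ _
      have := (i - j).val_lt
      rw [hv1]
      split_ifs <;> omega
  · have hhalf : ∀ i : ZMod (2 * k), (i - j).val = k → i = j + k := by
      intro i hi
      have := ZMod.natCast_zmod_val (i - j)
      rw [hi] at this
      linear_combination -this
    -- Exactly the `k - 1` literals strictly between `q j` and `q (j + k)` are false, so the only
    -- antipodal pair with equal values is the one of the removed clause.
    refine hkey _ (fun i => ¬ (1 ≤ (i - j).val ∧ (i - j).val ≤ k - 1)) ?_ ?_ ?_
    · intro i hi
      have := (i - j).val_lt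
      have h0 : (i - j).val ≠ 0 := fun h0 => by
        rw [hzero i j h0, hj] at hi
        simp at hi
      have h1 : (i - j).val ≠ k := fun h0 => by
        rw [hhalf i h0, h.periodic, hj] at hi
        simp at hi
      rw [hv1]
      split_ifs <;> omega
    · intro i _
      have := (i - j).val_lt
      rw [hv2]
      split_ifs <;> omega
    · intro i _ hne
      have := (i - j).val_lt
      have h0 : (i - j).val ≠ 0 := fun h0 => hne (by rw [hzero i j h0])
      have h1 : (i - j).val ≠ k := fun h0 => hne (by
        rw [hhalf i h0, add_half_add_half, Finset.pair_comm])
      rw [hv1]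
      split_ifs <;> omega

theorem mem_lits (h : Pres k F s q) {x : Lit V} :
    x ∈ F.lits ↔ ∃ i, x = q i ∨ x = (q i).compl := by
  rw [ClauseSet.mem_lits, ClauseSet.mem_vars]
  constructor
  · rintro ⟨C, hC, y, hy, hxy⟩
    have : ∃ i, x.var = (q i).var := by
      rcases (h.mem C).1 hC with ⟨i, rfl⟩ | ⟨i, -, rfl⟩ <;>
        simp only [Finset.mem_insert, Finset.mem_singleton] at hy <;> rcases hy with rfl | rfl
      all_goals exact ⟨_, hxy.symm⟩
    obtain ⟨i, hi⟩ := this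
    exact ⟨i, Lit.var_eq_iff.1 hi⟩
  · rintro ⟨i, hi⟩
    exact ⟨_, h.clause_mem i, q i, by simp, (Lit.var_eq_iff.2 hi).symm⟩

/-- The cycle clauses with indices `i` and `i + k - 1` both contain `q i`. -/
theorem two_le_ldeg (h : Pres k F s q) (hk : 2 ≤ k) (i : ZMod (2 * k)) : 2 ≤ F.ldeg (q i) := by
  refine ClauseSet.two_le_ldeg_iff.2 ⟨_, h.clause_mem i, _, h.clause_mem (i + k - 1), by simp,
    ?_, ?_⟩
  · rw [show i + k - 1 + k + 1 = i from by linear_combination half_add_half (k := k)]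
    simp
  · intro he
    have hmem : q (i + k - 1) ∈ ({q i, q (i + k + 1)} : Clause V) := by rw [he]; simp
    have h2 : (2 : ZMod (2 * k)) ≠ 0 := by
      have := natCast_ne_zero (n := 2 * k) (a := 2) (by omega) (by omega)
      simpa using this
    have h3 : (k - 1 : ZMod (2 * k)) ≠ 0 := by
      have := natCast_ne_zero (n := 2 * k) (a := k - 1) (by omega) (by omega)
      rwa [Nat.cast_sub (by omega), Nat.cast_one] at this
    simp only [Finset.mem_insert, Finset.mem_singleton] at hmem
    rcases hmem with hmem | hmem <;> have hv := congrArg Lit.var hmem <;>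
      rcases h.inj _ _ hv with h4 | ⟨h4, hs⟩
    · exact h3 (by linear_combination -h4)
    · exact one_ne_zero_of_le hk (by linear_combination h4 + half_add_half (k := k))
    · exact h2 (by linear_combination h4)
    · rw [h4, h.unsplit _ hs] at hmem
      simp at hmem

theorem not_oneSingular (h : Pres k F s q) (hk : 2 ≤ k) (v : V) : ¬ F.OneSingular v := by
  rintro ⟨h1, h2⟩
  obtain ⟨C, hC, hx⟩ := ClauseSet.ldeg_pos_iff.1 (h1 ▸ Nat.one_pos)
  have : (⟨v, true⟩ : Lit V) ∈ F.lits := ClauseSet.subset_lits hC hx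
  obtain ⟨i, hi⟩ := h.mem_lits.1 this
  have h3 := h.two_le_ldeg hk i
  rcases hi with hi | hi
  · rw [← hi] at h3
    omega
  · rw [← Lit.compl_eq_iff] at hi
    rw [← hi] at h3
    change 2 ≤ F.ldeg ⟨v, !true⟩ at h3
    simp only [Bool.not_true] at h3
    omega

/-- Transport of a presentation along a map commuting with complements. -/
theorem image (h : Pres k F s q) {f : Lit V → Lit V} (hf : Set.InjOn f F.lits)
    (hc : ∀ x ∈ F.lits, f x.compl = (f x).compl) :
    Pres k (F.image fun C => C.image f) s (f ∘ q) := by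
  have hq : ∀ i, q i ∈ F.lits := fun i => h.mem_lits.2 ⟨i, Or.inl rfl⟩
  refine ⟨h.periodic, ?_, ?_, ?_⟩
  · intro i hi
    simp [h.unsplit i hi, hc _ (hq i)]
  · intro i j hij
    apply h.inj
    rcases Lit.var_eq_iff.1 hij with h1 | h1
    · rw [hf (hq i) (hq j) h1]
    · simp only [Function.comp] at h1
      rw [← hc _ (hq j)] at h1
      rw [hf (hq i) (ClauseSet.compl_mem_lits.2 (hq j)) h1, Lit.compl_var]
  · intro C
    rw [Finset.mem_image]
    constructor
    · rintro ⟨D, hD, rfl⟩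
      rcases (h.mem D).1 hD with ⟨i, rfl⟩ | ⟨i, hi, rfl⟩
      · exact Or.inl ⟨i, by simp [Finset.image_insert]⟩
      · exact Or.inr ⟨i, hi, by simp [Finset.image_insert, hc _ (hq _)]⟩
    · rintro (⟨i, rfl⟩ | ⟨i, hi, rfl⟩)
      · exact ⟨_, h.clause_mem i, by simp [Finset.image_insert]⟩
      · exact ⟨_, h.split_mem hi, by simp [Finset.image_insert, hc _ (hq _)]⟩

theorem ext (h : Pres k F s q) (h' : Pres k G s q) : F = G := by
  ext C
  rw [h.mem, h'.mem]

/-- All coincidences among the literals `q i` and their complements are dictated by `s`, hence are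
the same for both presentations. -/
theorem exists_map (h : Pres k F s q) {q' : ZMod (2 * k) → Lit V} (h' : Pres k G s q') :
    ∃ f : Lit V → Lit V, ∀ i, f (q i) = q' i ∧ f (q i).compl = (q' i).compl := by
  classical
  refine ⟨fun x => if hx : ∃ i, x = q i then q' hx.choose else
    if hx : ∃ i, x = (q i).compl then (q' hx.choose).compl else x, fun i => ?_⟩
  have h1 : ∀ i j, q i = q j → q' i = q' j := by
    intro i j hij
    rcases h.inj i j (congrArg _ hij) with rfl | ⟨rfl, hs⟩
    · rfl
    · rw [h.unsplit i hs] at hij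
      simp at hij
  have h2 : ∀ i j, q i = (q j).compl → q' i = (q' j).compl := by
    intro i j hij
    rcases h.inj i j (by rw [hij, Lit.compl_var]) with rfl | ⟨rfl, hs⟩
    · simp at hij
    · rw [h'.unsplit i hs, Lit.compl_compl]
  constructor
  · have hx : ∃ j, q i = q j := ⟨i, rfl⟩
    simp only [hx, dite_true]
    exact (h1 _ _ hx.choose_spec).symm
  · by_cases hx : ∃ j, (q i).compl = q j
    · simp only [hx, dite_true]
      exact h2 _ _ hx.choose_spec.symm
    · have hx' : ∃ j, (q i).compl = (q j).compl := ⟨i, rfl⟩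
      simp only [hx, hx', dite_true, dite_false]
      rw [h1 _ _ (Lit.compl_injective hx'.choose_spec)]

theorem isomorphic (h : Pres k F s q) {q' : ZMod (2 * k) → Lit V} (h' : Pres k G s q') :
    F.Isomorphic G := by
  obtain ⟨f, hf⟩ := h.exists_map h'
  obtain ⟨g, hg⟩ := h'.exists_map h
  have hgf : ∀ x ∈ F.lits, g (f x) = x := by
    intro x hx
    obtain ⟨i, rfl | rfl⟩ := h.mem_lits.1 hx
    · rw [(hf i).1, (hg i).1]
    · rw [(hf i).2, (hg i).2]
  have hfg : ∀ x ∈ G.lits, f (g x) = x := by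
    intro x hx
    obtain ⟨i, rfl | rfl⟩ := h'.mem_lits.1 hx
    · rw [(hg i).1, (hf i).1]
    · rw [(hg i).2, (hf i).2]
  have hinj : Set.InjOn f (F.lits : Set (Lit V)) := fun x hx y hy hxy => by
    rw [← hgf x hx, hxy, hgf y hy]
  have hc : ∀ x ∈ F.lits, f x.compl = (f x).compl := by
    intro x hx
    obtain ⟨i, rfl | rfl⟩ := h.mem_lits.1 hx
    · rw [(hf i).1, (hf i).2]
    · rw [Lit.compl_compl, (hf i).1, (hf i).2, Lit.compl_compl]
  refine ⟨f, ⟨?_, hinj, ?_⟩, hc, ?_⟩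
  · intro x hx
    obtain ⟨i, rfl | rfl⟩ := h.mem_lits.1 hx
    · exact h'.mem_lits.2 ⟨i, Or.inl (hf i).1⟩
    · exact h'.mem_lits.2 ⟨i, Or.inr (hf i).2⟩
  · intro x hx
    refine ⟨g x, ?_, hfg x hx⟩
    obtain ⟨i, rfl | rfl⟩ := h'.mem_lits.1 hx
    · exact h.mem_lits.2 ⟨i, Or.inl (hg i).1⟩
    · exact h.mem_lits.2 ⟨i, Or.inr (hg i).2⟩
  · have h1 := h.image hinj hc
    have h2 : f ∘ q = q' := funext fun i => (hf i).1
    rw [h2] at h1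
    exact h1.ext h'

theorem of_isomorphic (h : Pres k F s q) (hFG : F.Isomorphic G) : ∃ q', Pres k G s q' := by
  obtain ⟨f, hf, hc, rfl⟩ := hFG
  exact ⟨_, h.image hf.injOn hc⟩

theorem rotate (h : Pres k F s q) (c : ZMod (2 * k)) :
    Pres k F (fun i => s (c + i)) fun i => q (c + i) := by
  refine ⟨?_, ?_, ?_, ?_⟩
  · intro i
    rw [← add_assoc, h.periodic]
  · intro i hi
    rw [← add_assoc, h.unsplit _ hi]
  · intro i j hij
    rcases h.inj _ _ hij with h1 | ⟨h1, hs⟩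
    · exact Or.inl (add_left_cancel h1)
    · exact Or.inr ⟨by linear_combination h1, hs⟩
  · intro C
    rw [h.mem]
    refine or_congr ⟨?_, ?_⟩ ⟨?_, ?_⟩
    · rintro ⟨i, rfl⟩
      exact ⟨i - c, by congr 2 <;> ring_nf⟩
    · rintro ⟨i, rfl⟩
      exact ⟨c + i, by congr 2; ring_nf⟩
    · rintro ⟨i, hi, rfl⟩
      exact ⟨i - c, by simpa using hi, by congr 2 <;> ring_nf⟩
    · rintro ⟨i, hi, rfl⟩
      exact ⟨c + i, hi, by congr 2; ring_nf⟩

/-- A reflection exchanges the two members of every cycle clause, which moves its index from `i` to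
`c - (i + k + 1)`. -/
theorem reflect (h : Pres k F s q) (c : ZMod (2 * k)) :
    Pres k F (fun i => s (c - i)) fun i => q (c - i) := by
  have hneg : ∀ i : ZMod (2 * k), c - (i + k) = c - i + k := fun i => by
    linear_combination -half_add_half (k := k)
  refine ⟨?_, ?_, ?_, ?_⟩
  · intro i
    rw [hneg, h.periodic]
  · intro i hi
    rw [hneg, h.unsplit _ hi]
  · intro i j hij
    rcases h.inj _ _ hij with h1 | ⟨h1, hs⟩
    · exact Or.inl (by linear_combination -h1)
    · exact Or.inr ⟨by linear_combination -h1 - half_add_half (k := k), hs⟩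
  · intro C
    rw [h.mem]
    refine or_congr ⟨?_, ?_⟩ ⟨?_, ?_⟩
    · rintro ⟨i, rfl⟩
      refine ⟨c - (i + k + 1), ?_⟩
      rw [Finset.pair_comm]
      congr 2
      · ring_nf
      · congr 1
        ring
    · rintro ⟨i, rfl⟩
      refine ⟨c - (i + k + 1), ?_⟩
      rw [Finset.pair_comm]
      congr 3
      ring
    · rintro ⟨i, hi, rfl⟩
      refine ⟨c - i, by simpa using hi, ?_⟩
      simp only [hneg, sub_sub_cancel]
    · rintro ⟨i, hi, rfl⟩
      exact ⟨c - i, hi, by rw [hneg]⟩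

end Pres

end MU2

/-! ### Deficiency and existence of presentations -/

namespace MU2
variable {V : Type*} [LinearOrder V]
namespace Pres

variable {k : ℕ} {F : ClauseSet V} {s : ZMod (2 * k) → Bool} {q : ZMod (2 * k) → Lit V}

theorem card_val_lt [NeZero k] : (Finset.univ.filter fun i : ZMod (2 * k) => i.val < k).card = k := by
  have : (Finset.univ.filter fun i : ZMod (2 * k) => i.val < k) =
      (Finset.range k).image fun a : ℕ => (a : ZMod (2 * k)) := by
    ext i
    simp only [Finset.mem_filter, Finset.mem_univ, true_and, Finset.mem_image, Finset.mem_range]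
    constructor
    · exact fun hi => ⟨i.val, hi, ZMod.natCast_zmod_val i⟩
    · rintro ⟨a, ha, rfl⟩
      rwa [ZMod.val_natCast, Nat.mod_eq_of_lt (by omega)]
  rw [this, Finset.card_image_of_injOn, Finset.card_range]
  intro a ha b hb hab
  have ha' : a < k := by simpa using ha
  have hb' : b < k := by simpa using hb
  have := congrArg ZMod.val hab
  simpa [ZMod.val_natCast, Nat.mod_eq_of_lt (show a < 2 * k by omega),
    Nat.mod_eq_of_lt (show b < 2 * k by omega)] using this

theorem val_add_half [NeZero k] (i : ZMod (2 * k)) :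
    (i + k).val = if i.val < k then i.val + k else i.val - k := by
  have hk := NeZero.pos k
  have hi := i.val_lt
  rw [val_add_natCast i (c := k) (by omega)]
  split_ifs <;> omega

/-- With `b` antipodal pairs of split overlaps there are `k + b` variables and `2 * k + b` clauses.
-/
theorem deficiency (h : Pres k F s q) (hk : 2 ≤ k) : F.deficiency = k := by
  have : NeZero k := ⟨by omega⟩
  set B := Finset.univ.filter fun i : ZMod (2 * k) => i.val < k ∧ s i = true with hB
  have hvars : F.vars.card = k + B.card := by
    -- One index per variable: the first half, together with the split indices of the second half.
    set A := Finset.univ.filter fun i : ZMod (2 * k) => i.val < k ∨ s i = true with hA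
    have h1 : F.vars = A.image fun i => (q i).var := by
      ext v
      have hv : v ∈ F.vars ↔ (⟨v, true⟩ : Lit V) ∈ F.lits := by rw [ClauseSet.mem_lits]
      rw [hv, h.mem_lits]
      simp only [hA, Finset.mem_image, Finset.mem_filter, Finset.mem_univ, true_and]
      constructor
      · rintro ⟨i, hi⟩
        have hi' : v = (q i).var := Lit.var_eq_iff.2 hi
        by_cases hc : i.val < k ∨ s i = true
        · exact ⟨i, hc, hi'.symm⟩
        · push Not at hc
          refine ⟨i + k, Or.inl ?_, ?_⟩
          · have := i.val_lt
            rw [val_add_half]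
            split_ifs <;> omega
          · rw [h.unsplit i (by simpa using hc.2), Lit.compl_var, hi']
      · rintro ⟨i, -, rfl⟩
        exact ⟨i, Lit.var_eq_iff.1 rfl⟩
    have h2 : A.card = k + B.card := by
      have h3 : A = (Finset.univ.filter fun i : ZMod (2 * k) => i.val < k) ∪
          B.image fun i => i + (k : ZMod (2 * k)) := by
        ext i
        simp only [hA, hB, Finset.mem_union, Finset.mem_image, Finset.mem_filter, Finset.mem_univ,
          true_and]
        have := i.val_lt
        constructor
        · rintro (hi | hi)
          · exact Or.inl hi
          · by_cases hik : i.val < k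
            · exact Or.inl hik
            · refine Or.inr ⟨i + k, ⟨?_, by rw [h.periodic, hi]⟩, add_half_add_half i⟩
              rw [val_add_half]
              split_ifs <;> omega
        · rintro (hi | ⟨j, ⟨-, hj⟩, rfl⟩)
          · exact Or.inl hi
          · exact Or.inr (by rw [h.periodic, hj])
      rw [h3, Finset.card_union_of_disjoint, card_val_lt,
        Finset.card_image_of_injective _ (add_left_injective _)]
      rw [Finset.disjoint_left]
      simp only [hB, Finset.mem_image, Finset.mem_filter, Finset.mem_univ, true_and]
      rintro _ hi ⟨j, ⟨hj, -⟩, rfl⟩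
      rw [val_add_half] at hi
      split_ifs at hi
      omega
    rw [h1, Finset.card_image_of_injOn, h2]
    intro i hi j hj hij
    simp only [hA, Finset.coe_filter, Finset.mem_univ, true_and, Set.mem_ofPred_eq] at hi hj
    rcases h.inj i j hij with h3 | ⟨rfl, hs⟩
    · exact h3.symm
    · rw [h.periodic, val_add_half, hs] at hj
      rw [hs] at hi
      split_ifs at hj <;> simp at hi hj <;> omega
  have hcard : F.card = 2 * k + B.card := by
    have h1 : F = (Finset.univ.image fun i : ZMod (2 * k) => ({q i, q (i + k + 1)} : Clause V)) ∪
        B.image fun i => ({(q i).compl, (q (i + k)).compl} : Clause V) := by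
      ext C
      simp only [h.mem, hB, Finset.mem_union, Finset.mem_image, Finset.mem_filter, Finset.mem_univ,
          true_and]
      refine or_congr (exists_congr fun i => eq_comm) ⟨?_, ?_⟩
      · rintro ⟨i, hi, rfl⟩
        by_cases hik : i.val < k
        · exact ⟨i, ⟨hik, hi⟩, rfl⟩
        · have := i.val_lt
          refine ⟨i + k, ⟨?_, by rw [h.periodic, hi]⟩, ?_⟩
          · rw [val_add_half]
            split_ifs
            omega
          · rw [add_half_add_half, Finset.pair_comm]
      · rintro ⟨i, ⟨-, hi⟩, rfl⟩
        exact ⟨i, hi, rfl⟩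
    have hq : ∀ i j, q i = q j → i = j := by
      intro i j hij
      rcases h.inj i j (congrArg _ hij) with h3 | ⟨rfl, hs⟩
      · exact h3.symm
      · rw [h.unsplit i hs] at hij
        simp at hij
    rw [h1, Finset.card_union_of_disjoint, Finset.card_image_of_injective,
      Finset.card_image_of_injOn, Finset.card_univ, ZMod.card]
    · intro i hi j hj hij
      simp only [hB, Finset.coe_filter, Finset.mem_univ, true_and, Set.mem_ofPred_eq] at hi hj
      dsimp only at hij
      have hm : (q i).compl ∈ ({(q j).compl, (q (j + k)).compl} : Clause V) := by
        rw [← hij]; simp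
      simp only [Finset.mem_insert, Finset.mem_singleton, Lit.compl_inj] at hm
      rcases hm with hm | hm
      · exact hq _ _ hm
      · have := hq _ _ hm
        rw [this, val_add_half] at hi
        split_ifs at hi <;> omega
    · intro i j hij
      dsimp only at hij
      have hm : q i ∈ ({q j, q (j + k + 1)} : Clause V) := by
        rw [← hij]; simp
      have hm' : q (i + k + 1) ∈ ({q j, q (j + k + 1)} : Clause V) := by
        rw [← hij]; simp
      simp only [Finset.mem_insert, Finset.mem_singleton] at hm hm'
      rcases hm with hm | hm
      · exact hq _ _ hm
      · have e1 := hq _ _ hm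
        rcases hm' with hm' | hm' <;> have e2 := hq _ _ hm'
        · have h2 : (2 : ZMod (2 * k)) = 0 := by
            linear_combination e2 - e1 - half_add_half (k := k)
          have := natCast_ne_zero (n := 2 * k) (a := 2) (by omega) (by omega)
          exact absurd h2 (by simpa using this)
        · linear_combination e2
    · rw [Finset.disjoint_left]
      simp only [hB, Finset.mem_image, Finset.mem_filter, Finset.mem_univ, true_and]
      rintro _ ⟨i, rfl⟩ ⟨j, ⟨-, hj⟩, hij⟩
      have hm : (q j).compl ∈ ({q i, q (i + k + 1)} : Clause V) := by
        rw [← hij]; simp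
      have hno : ∀ l, (q j).compl ≠ q l := by
        intro l hl
        rcases h.inj j l (by rw [← hl, Lit.compl_var]) with rfl | ⟨-, hs⟩
        · simp at hl
        · simp [hj] at hs
      simp only [Finset.mem_insert, Finset.mem_singleton] at hm
      exact hm.elim (hno _) (hno _)
  unfold ClauseSet.deficiency
  rw [hvars, hcard]
  push_cast
  ring

theorem val_mod [NeZero k] (i : ZMod (2 * k)) :
    i.val % k = if i.val < k then i.val else i.val - k := by
  have := i.val_lt
  split_ifs with h
  · exact Nat.mod_eq_of_lt h
  · rw [Nat.mod_eq_sub_mod (by omega), Nat.mod_eq_of_lt (by omega)]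

theorem val_add_half_mod [NeZero k] (i : ZMod (2 * k)) : (i + k).val % k = i.val % k := by
  have := i.val_lt
  rw [val_mod, val_mod, val_add_half]
  split_ifs <;> omega

theorem eq_or_eq_add_half [NeZero k] {i j : ZMod (2 * k)} (hij : i.val % k = j.val % k) :
    j = i ∨ j = i + k := by
  have hi := i.val_lt
  have hj := j.val_lt
  have h1 : j.val = i.val ∨ j.val = (i + k).val := by
    rw [val_mod, val_mod] at hij
    rw [val_add_half]
    split_ifs at hij ⊢ <;> omega
  exact h1.imp (fun h => ZMod.val_injective _ h) fun h => ZMod.val_injective _ h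

/-- Each split index receives a variable of its own; an unsplit antipodal pair shares the variable
numbered by its residue modulo `k`, with opposite signs. Periodicity of `s` keeps the two kinds
apart. -/
theorem exists_pres (V : Type*) [LinearOrder V] [Infinite V] [NeZero k]
    {s : ZMod (2 * k) → Bool} (hs : ∀ i, s (i + k) = s i) :
    ∃ (F : ClauseSet V) (q : ZMod (2 * k) → Lit V), Pres k F s q := by
  let e := Infinite.natEmbedding V
  let q : ZMod (2 * k) → Lit V := fun i =>
    if s i = true then ⟨e i.val, true⟩ else ⟨e (i.val % k), decide (i.val < k)⟩
  refine ⟨(Finset.univ.image fun i : ZMod (2 * k) => ({q i, q (i + k + 1)} : Clause V)) ∪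
    (Finset.univ.filter fun i : ZMod (2 * k) => s i = true).image
      fun i => ({(q i).compl, (q (i + k)).compl} : Clause V), q, hs, ?_, ?_, ?_⟩
  · intro i hi
    have := i.val_lt
    simp only [q, hs, hi, Bool.false_eq_true, if_false, Lit.compl, val_add_half_mod]
    congr 1
    rw [val_add_half]
    split_ifs with h
    · simp [h]
    · have : i.val - k < k := by omega
      simp [h, this]
  · intro i j hij
    cases hi : s i <;> cases hj : s j <;>
      simp only [q, hi, hj, if_true, if_false, Bool.false_eq_true, e.injective.eq_iff] at hij
    · exact (eq_or_eq_add_half hij).imp id fun h => ⟨h, rfl⟩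
    · have : j.val % k = i.val % k := by rw [← hij, Nat.mod_mod]
      rcases eq_or_eq_add_half this.symm with rfl | rfl
      · exact Or.inl rfl
      · rw [hs, hi] at hj
        simp at hj
    · have : j.val % k = i.val % k := by rw [hij, Nat.mod_mod]
      rcases eq_or_eq_add_half this.symm with rfl | rfl
      · exact Or.inl rfl
      · rw [hs, hi] at hj
        simp at hj
    · exact Or.inl (ZMod.val_injective _ hij.symm)
  · intro C
    simp only [Finset.mem_union, Finset.mem_image, Finset.mem_filter, Finset.mem_univ, true_and]
    exact or_congr (exists_congr fun i => eq_comm)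
      (exists_congr fun i => and_congr_right fun _ => eq_comm)

end Pres

/-! ### The implication multigraph of a presented clause-set -/

theorem FinDigraph.toMultigraph_mult {α : Type*} [DecidableEq α] (D : FinDigraph α) (x y : α) :
    D.toMultigraph.mult s(x, y) = if x = y then (if (x, x) ∈ D.arcs then 1 else 0) else
      (if (x, y) ∈ D.arcs then 1 else 0) + if (y, x) ∈ D.arcs then 1 else 0 := by
  have h1 : ∀ a : α × α, s(a.1, a.2) = s(x, y) ↔ a = (x, y) ∨ a = (y, x) := by
    rintro ⟨a, b⟩
    simp
  have h2 : D.toMultigraph.mult s(x, y) =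
      (D.arcs.filter fun a => a = (x, y) ∨ a = (y, x)).card := by
    simp only [FinDigraph.toMultigraph, h1]
  rw [h2]
  by_cases hxy : x = y
  · subst hxy
    simp only [or_self, Finset.filter_eq', if_true]
    split_ifs <;> simp
  · rw [if_neg hxy, Finset.filter_or, Finset.card_union_of_disjoint, Finset.filter_eq',
      Finset.filter_eq']
    · split_ifs <;> simp
    · rw [Finset.disjoint_filter]
      rintro _ - rfl h
      exact hxy (Prod.mk.inj h).1

theorem FinDigraph.isomorphic_toMultigraph {α β : Type*} [DecidableEq α] [DecidableEq β]
    {D : FinDigraph α} {E : FinDigraph β} (f : {x // x ∈ D.verts} ≃ {x // x ∈ E.verts})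
    (hf : ∀ v w, ((f v : β), (f w : β)) ∈ E.arcs ↔ ((v : α), (w : α)) ∈ D.arcs) :
    D.toMultigraph.Isomorphic E.toMultigraph := by
  suffices h : ∀ v w : {x // x ∈ D.verts}, E.toMultigraph.mult s((f v : β), (f w : β)) =
      D.toMultigraph.mult s((v : α), (w : α)) from ⟨f, h⟩
  intro v w
  rw [FinDigraph.toMultigraph_mult, FinDigraph.toMultigraph_mult]
  have h1 : (f v : β) = f w ↔ (v : α) = w := by
    rw [Subtype.coe_inj, f.injective.eq_iff, Subtype.coe_inj]
  have h2 := hf v v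
  have h3 := hf v w
  have h4 := hf w v
  simp only [h1, h2, h3, h4]

theorem ClauseSet.mem_idg_arcs {F : ClauseSet V} {x y : Lit V} :
    (x, y) ∈ F.idg.arcs ↔ F.Imp x y := by
  simp only [ClauseSet.idg, Finset.mem_filter, Finset.mem_product]
  exact ⟨fun h => h.2, fun h => ⟨⟨Imp.left_mem h, Imp.right_mem h⟩, h⟩⟩

theorem mem_nonlinearWDC_arcs {m : ℕ} [NeZero m] {s : ZMod m → Bool} {e : (ZMod m × Bool) × (ZMod m × Bool)} :
    e ∈ (nonlinearWDC m s).arcs ↔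
    ((e.2.1 = e.1.1 + 1 ∨ e.1.1 = e.2.1 + 1) ∧ e.1.2 = s e.1.1 ∧ e.2.2 = false) ∨
    (e.1.1 = e.2.1 ∧ s e.1.1 = true ∧ e.1.2 = false ∧ e.2.2 = true) := by
  simp [nonlinearWDC]

theorem mem_nonlinearWDC_verts {m : ℕ} [NeZero m] {s : ZMod m → Bool} {p : ZMod m × Bool} :
    p ∈ (nonlinearWDC m s).verts ↔ (p.2 = true → s p.1 = true) := by
  simp [nonlinearWDC]

namespace Pres

variable {k : ℕ} {F : ClauseSet V} {s : ZMod (2 * k) → Bool} {q : ZMod (2 * k) → Lit V}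

/-- The receiving vertex of overlap `i` is `q i`, the emitting one is the complement of `q (i + k)`.
At an unsplit overlap these coincide; at a split one the split clause provides the arc between them.
-/
theorem isomorphic_nonlinearWDC (h : Pres k F s q) [NeZero k] :
    (nonlinearWDC (2 * k) s).toMultigraph.Isomorphic F.img := by
  let φ : ZMod (2 * k) × Bool → Lit V := fun p => if p.2 = true then (q (p.1 + k)).compl else q p.1
  have hq : ∀ i j, q i = q j → i = j := by
    intro i j hij
    rcases h.inj i j (congrArg _ hij) with h3 | ⟨rfl, hs⟩
    · exact h3.symm
    · rw [h.unsplit i hs] at hij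
      simp at hij
  have hqc : ∀ i j, s j = true → q i ≠ (q (j + k)).compl := by
    intro i j hj hij
    rcases h.inj (j + k) i (by rw [hij, Lit.compl_var]) with rfl | ⟨-, hs⟩
    · simp at hij
    · rw [h.periodic, hj] at hs
      simp at hs
  -- The vertex `(i, s i)` is the emitting one whether or not `i` is split.
  have hout : ∀ i, φ (i, s i) = (q (i + k)).compl := by
    intro i
    cases hs : s i
    · simp [φ, h.unsplit i hs]
    · simp [φ]
  have hinj : ∀ p p' : ZMod (2 * k) × Bool, p ∈ (nonlinearWDC (2 * k) s).verts →
      p' ∈ (nonlinearWDC (2 * k) s).verts → φ p = φ p' → p = p' := by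
    rintro ⟨i, b⟩ ⟨j, c⟩ hp hp' he
    rw [mem_nonlinearWDC_verts] at hp hp'
    cases b <;> cases c <;> simp only [φ, if_true, if_false, Bool.false_eq_true] at he
    · rw [hq _ _ he]
    · exact absurd he (hqc _ _ (hp' rfl))
    · exact absurd he.symm (hqc _ _ (hp rfl))
    · rw [add_right_cancel (hq _ _ (Lit.compl_injective he))]
  have hmem : ∀ p, φ p ∈ F.lits := by
    intro p
    simp only [φ]
    split_ifs
    · exact h.mem_lits.2 ⟨_, Or.inr rfl⟩
    · exact h.mem_lits.2 ⟨_, Or.inl rfl⟩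
  have hsv : ∀ i, (i, s i) ∈ (nonlinearWDC (2 * k) s).verts := fun i => by
    simp [mem_nonlinearWDC_verts]
  have hfv : ∀ i, (i, false) ∈ (nonlinearWDC (2 * k) s).verts := fun i => by
    simp [mem_nonlinearWDC_verts]
  have hsurj : ∀ x ∈ F.lits, ∃ p ∈ (nonlinearWDC (2 * k) s).verts, φ p = x := by
    intro x hx
    obtain ⟨i, rfl | rfl⟩ := h.mem_lits.1 hx
    · exact ⟨(i, false), hfv i, by simp [φ]⟩
    · exact ⟨(i + k, s (i + k)), hsv _, by rw [hout, add_half_add_half]⟩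
  let f : {x // x ∈ (nonlinearWDC (2 * k) s).verts} → {x // x ∈ F.idg.verts} :=
    fun p => ⟨φ p.1, hmem p.1⟩
  have hbij : Function.Bijective f := by
    constructor
    · rintro ⟨p, hp⟩ ⟨p', hp'⟩ he
      exact Subtype.ext (hinj p p' hp hp' (congrArg Subtype.val he))
    · rintro ⟨x, hx⟩
      obtain ⟨p, hp, hpx⟩ := hsurj x hx
      exact ⟨⟨p, hp⟩, Subtype.ext hpx⟩
  refine FinDigraph.isomorphic_toMultigraph (Equiv.ofBijective f hbij) ?_
  rintro ⟨p, hp⟩ ⟨p', hp'⟩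
  change (φ p, φ p') ∈ F.idg.arcs ↔ (p, p') ∈ _
  rw [ClauseSet.mem_idg_arcs, mem_nonlinearWDC_arcs]
  have pairEq : ∀ {a b c d : Lit V}, ({a, b} : Clause V) = {c, d} → (a = c ∧ b = d) ∨ (a = d ∧ b = c) := by
    intro a b c d habcd
    have : (({a, b} : Finset (Lit V)) : Set (Lit V)) = (({c, d} : Finset (Lit V)) : Set (Lit V)) := by
      rw [habcd]
    push_cast at this
    exact Set.pair_eq_pair_iff.1 this
  constructor
  · intro hi
    rcases (h.mem _).1 hi with ⟨l, hl⟩ | ⟨l, hs, hl⟩ <;> rcases pairEq hl with ⟨e1, e2⟩ | ⟨e1, e2⟩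
    · obtain rfl := hinj p (l + k, s (l + k)) hp (hsv _) (by
        rw [hout, add_half_add_half, ← e1, Lit.compl_compl])
      obtain rfl := hinj p' (l + k + 1, false) hp' (hfv _) (by simp [e2, φ])
      simp
    · obtain rfl := hinj p (l + 1, s (l + 1)) hp (hsv _) (by
        rw [hout, ← Lit.compl_eq_iff, e1]; congr 1; ring)
      obtain rfl := hinj p' (l, false) hp' (hfv _) (by simp [e2, φ])
      simp
    · obtain rfl := hinj p (l, false) hp (hfv _) (by
        simpa [φ] using e1)
      obtain rfl := hinj p' (l, s l) hp' (hsv _) (by rw [hout, e2])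
      simp [hs]
    · obtain rfl := hinj p (l + k, false) hp (hfv _) (by
        simpa [φ] using e1)
      obtain rfl := hinj p' (l + k, s (l + k)) hp' (hsv _) (by rw [hout, e2, add_half_add_half])
      simp [hs, h.periodic]
  · obtain ⟨i, b⟩ := p
    obtain ⟨j, c⟩ := p'
    rintro (⟨hij, hb, hc⟩ | ⟨hij, hs, hb, hc⟩)
    · simp only at hij hb hc
      subst hb hc
      rw [ClauseSet.Imp, hout, Lit.compl_compl]
      simp only [φ, Bool.false_eq_true, if_false]
      rcases hij with rfl | rfl
      · have := h.clause_mem (i + k)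
        rwa [add_half_add_half] at this
      · have := h.clause_mem j
        rwa [Finset.pair_comm, show j + k + 1 = j + 1 + k by ring] at this
    · simp only at hij hb hc hs
      subst hij hb hc
      simpa [ClauseSet.Imp, φ] using h.split_mem hs

end Pres
end MU2

namespace MU2
variable {V : Type*} [LinearOrder V]
namespace ClauseSet

/-! ### Nonsingular 2-MUs -/

variable {F : ClauseSet V} {p p' : ℕ → Lit V} {m m' j j' : ℕ}

namespace Lasso

theorem exists_var_eq (h : Lasso F p m j) {C : Clause V} (hC : C ∈ walkClauses p m) {x : Lit V}
    (hx : x ∈ C) : ∃ i ≤ m, x.var = (p i).var := by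
  obtain ⟨i, hi, rfl⟩ := mem_walkClauses.1 hC
  simp only [Finset.mem_insert, Finset.mem_singleton] at hx
  rcases hx with rfl | rfl
  · exact ⟨i, hi, rfl⟩
  · rcases hi.lt_or_eq with hi | rfl
    · exact ⟨i + 1, hi, rfl⟩
    · exact ⟨j, h.le, by rw [h.last, Lit.compl_var]⟩

theorem zero_notMem (h : Lasso F p m j) {C : Clause V} (hC : C ∈ walkClauses p m) : p 0 ∉ C := by
  obtain ⟨i, hi, rfl⟩ := mem_walkClauses.1 hC
  intro hx
  simp only [Finset.mem_insert, Finset.mem_singleton] at hx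
  rcases hx with hx | hx
  · obtain rfl := h.inj 0 (Nat.zero_le _) i hi (by rw [hx, Lit.compl_var])
    simp at hx
  · rcases hi.lt_or_eq with hi | rfl
    · have := h.inj 0 (Nat.zero_le _) (i + 1) hi (by rw [hx])
      omega
    · rw [h.last] at hx
      obtain rfl := h.inj 0 (Nat.zero_le _) j h.le (by rw [hx, Lit.compl_var])
      simp at hx

theorem eq_of_compl_zero_mem (h : Lasso F p m j) (hj : j ≠ 0) {C : Clause V}
    (hC : C ∈ walkClauses p m) (hx : (p 0).compl ∈ C) : C = {(p 0).compl, p 1} := by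
  obtain ⟨i, hi, rfl⟩ := mem_walkClauses.1 hC
  simp only [Finset.mem_insert, Finset.mem_singleton] at hx
  rcases hx with hx | hx
  · obtain rfl := h.inj 0 (Nat.zero_le _) i hi (by rw [Lit.compl_injective hx])
    rfl
  · rcases hi.lt_or_eq with hi | rfl
    · have := h.inj 0 (Nat.zero_le _) (i + 1) hi (by rw [← hx, Lit.compl_var])
      omega
    · rw [h.last] at hx
      exact absurd (h.inj 0 (Nat.zero_le _) j h.le (by rw [Lit.compl_injective hx])).symm hj

theorem eq_of_mem (h : Lasso F p m 0) {i : ℕ} (hi0 : i ≠ 0) (hi : i ≤ m) {C : Clause V}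
    (hC : C ∈ walkClauses p m) (hx : p i ∈ C) : C = {(p (i - 1)).compl, p i} := by
  obtain ⟨l, hl, rfl⟩ := mem_walkClauses.1 hC
  simp only [Finset.mem_insert, Finset.mem_singleton] at hx
  rcases hx with hx | hx
  · obtain rfl := h.inj i hi l hl (by rw [hx, Lit.compl_var])
    simp at hx
  · rcases hl.lt_or_eq with hl | rfl
    · obtain rfl := h.inj i hi (l + 1) hl (by rw [hx])
      rfl
    · rw [h.last] at hx
      exact absurd (h.inj i hi 0 (Nat.zero_le _) (by rw [hx, Lit.compl_var])) hi0

theorem zero_mem_lits (h : Lasso F p m j) : p 0 ∈ F.lits := (h.imp 0 (Nat.zero_le _)).left_mem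

theorem exists_opposite (h : Lasso F p m j) (hF : F.IsPureTwoMU) :
    ∃ (p' : ℕ → Lit V) (m' j' : ℕ), Lasso F p' m' j' ∧ p' 0 = (p 0).compl ∧
      walkClauses p m ∪ walkClauses p' m' = F := by
  obtain ⟨p', m', j', h0, h'⟩ :=
    hF.exists_lasso hF.empty_notMem (compl_mem_lits.2 h.zero_mem_lits)
  exact ⟨p', m', j', h', h0, hF.eq_union_walkClauses h h' h0⟩

/-- No clause of the opposite lasso contains its own starting literal, the complement of `p 0`. If
`j ≠ 0`, that literal then occurs only in the clause of the first arc of the given lasso, against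
degree two. -/
theorem eq_zero (h : Lasso F p m j) (hF : F.IsPureTwoMU) (hns : ∀ x ∈ F.lits, 2 ≤ F.ldeg x) :
    j = 0 := by
  by_contra hj
  obtain ⟨p', m', j', h', h0, hU⟩ := h.exists_opposite hF
  obtain ⟨C, hC, D, hD, hxC, hxD, hne⟩ :=
    two_le_ldeg_iff.1 (hns _ (compl_mem_lits.2 h.zero_mem_lits))
  have key : ∀ C ∈ F, (p 0).compl ∈ C → C = {(p 0).compl, p 1} := by
    intro C hC hx
    rw [← hU, Finset.mem_union] at hC
    rcases hC with hC | hC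
    · exact h.eq_of_compl_zero_mem hj hC hx
    · rw [← h0] at hx
      exact absurd hx (h'.zero_notMem hC)
  exact hne ((key C hC hxC).trans (key D hD hxD).symm)

/-- A variable missed by the lasso occurs only in clauses of the opposite lasso, which also closes
at its start; there each literal `p' i` with `i ≠ 0` lies in a single clause. -/
theorem exists_index (h : Lasso F p m j) (hF : F.IsPureTwoMU) (hns : ∀ x ∈ F.lits, 2 ≤ F.ldeg x)
    {v : V} (hv : v ∈ F.vars) : ∃ i ≤ m, (p i).var = v := by
  by_contra! hno
  obtain ⟨p', m', j', h', h0, hU⟩ := h.exists_opposite hF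
  obtain rfl := h'.eq_zero hF hns
  have key : ∀ C ∈ F, ∀ x ∈ C, x.var = v → C ∈ walkClauses p' m' := by
    intro C hC x hx hxv
    rw [← hU, Finset.mem_union] at hC
    refine hC.resolve_left fun hC => ?_
    obtain ⟨i, hi, hxi⟩ := h.exists_var_eq hC hx
    exact hno i hi (by rw [← hxi, hxv])
  obtain ⟨C, hC, x, hx, hxv⟩ := mem_vars.1 hv
  obtain ⟨i, hi, hxi⟩ := h'.exists_var_eq (key C hC x hx hxv) hx
  have hi0 : i ≠ 0 := by
    rintro rfl
    apply hno 0 (Nat.zero_le _)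
    rw [← hxv, hxi, h0, Lit.compl_var]
  obtain ⟨C, hC, D, hD, hxC, hxD, hne⟩ := two_le_ldeg_iff.1 (hns (p' i) (by
    rw [mem_lits, ← hxi, hxv]; exact hv))
  have e1 := h'.eq_of_mem hi0 hi (key C hC _ hxC (hxi ▸ hxv)) hxC
  have e2 := h'.eq_of_mem hi0 hi (key D hD _ hxD (hxi ▸ hxv)) hxD
  exact hne (e1.trans e2.symm)

theorem succ_eq_card (h : Lasso F p m j) (hF : F.IsPureTwoMU)
    (hns : ∀ x ∈ F.lits, 2 ≤ F.ldeg x) : m + 1 = F.vars.card := by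
  refine le_antisymm h.le_card_vars ?_
  have hsub : F.vars ⊆ (Finset.range (m + 1)).image fun i => (p i).var := by
    intro v hv
    obtain ⟨i, hi, hiv⟩ := h.exists_index hF hns hv
    exact Finset.mem_image.2 ⟨i, Finset.mem_range.2 (by omega), hiv⟩
  exact (Finset.card_le_card hsub).trans (Finset.card_image_le.trans (by simp))

theorem reverse (h : Lasso F p m 0) : Lasso F (fun l => (p (m + 1 - l)).compl) m 0 := by
  refine ⟨Nat.zero_le _, ?_, by simp [h.last], ?_⟩
  · intro i hi
    have := (h.imp (m - i) (by omega)).contra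
    rwa [show m - i + 1 = m + 1 - i by omega, show m - i = m + 1 - (i + 1) by omega] at this
  · intro i hi l hl hil
    simp only [Lit.compl_var] at hil
    have hz : (p (m + 1)).var = (p 0).var := by rw [h.last, Lit.compl_var]
    rcases Nat.eq_zero_or_pos i with rfl | hi0 <;> rcases Nat.eq_zero_or_pos l with rfl | hl0
    · rfl
    · rw [Nat.sub_zero, hz] at hil
      have := h.inj _ (by omega) _ (by omega) hil
      omega
    · rw [Nat.sub_zero, hz] at hil
      have := h.inj _ (by omega) _ (by omega) hil
      omega
    · have := h.inj _ (by omega) _ (by omega) hil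
      omega

/-- The arc closes a shorter path: from the complement of `p i` to `p 0` and on to `p i`. As every
lasso visits all variables, this one must be just as long as the given one. -/
theorem index_eq_of_imp (h : Lasso F p m 0) (hF : F.IsPureTwoMU)
    (hns : ∀ x ∈ F.lits, 2 ≤ F.ldeg x) {i : ℕ} (hi : i ≤ m)
    (himp : F.Imp (p 0).compl (p i)) : i = m := by
  have hl : Lasso F (fun l => if l = 0 then (p i).compl else p (l - 1)) i 0 := by
    refine ⟨Nat.zero_le _, ?_, by simp, ?_⟩
    · intro l hl
      rcases Nat.eq_zero_or_pos l with rfl | hl0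
      · simpa using himp.contra
      · have := h.imp (l - 1) (by omega)
        rw [show l - 1 + 1 = l by omega] at this
        simpa [hl0.ne'] using this
    · intro a ha b hb hab
      rcases Nat.eq_zero_or_pos a with rfl | ha0 <;> rcases Nat.eq_zero_or_pos b with rfl | hb0
      · rfl
      · simp only [if_true, hb0.ne', if_false, Lit.compl_var] at hab
        have := h.inj _ (by omega) _ (by omega) hab
        omega
      · simp only [if_true, ha0.ne', if_false, Lit.compl_var] at hab
        have := h.inj _ (by omega) _ (by omega) hab
        omega
      · simp only [ha0.ne', hb0.ne', if_false] at hab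
        have := h.inj _ (by omega) _ (by omega) hab
        omega
  have h1 := hl.succ_eq_card hF hns
  have h2 := h.succ_eq_card hF hns
  omega

/-- Since `p 0` lies in two clauses, its complement has two outgoing arcs. By `index_eq_of_imp`,
applied to the path and to its reverse, their heads can only be `p m` and the complement of `p 1`,
so both occur. -/
theorem imp_compl (h : Lasso F p m 0) (hF : F.IsPureTwoMU) (hns : ∀ x ∈ F.lits, 2 ≤ F.ldeg x) :
    F.Imp (p 0).compl (p 1).compl := by
  have hout : ∀ d, F.Imp (p 0).compl d → d = (p 1).compl ∨ d = p m := by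
    intro d hd
    obtain ⟨i, hi, hid⟩ := h.exists_index hF hns (mem_lits.1 hd.right_mem)
    have hi0 : i ≠ 0 := by
      rintro rfl
      exact hF.var_ne hd hid
    rcases Lit.var_eq_iff.1 hid with hid | hid
    · subst hid
      exact Or.inr (by rw [h.index_eq_of_imp hF hns hi hd])
    · rw [← Lit.compl_eq_iff] at hid
      subst hid
      have := h.reverse.index_eq_of_imp hF hns (i := m + 1 - i) (by omega) (by
        rw [show m + 1 - 0 = m + 1 from rfl, h.last, show m + 1 - (m + 1 - i) = i by omega]
        simpa using hd)
      obtain rfl : i = 1 := by omega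
      exact Or.inl rfl
  obtain ⟨C, hC, D, hD, hxC, hxD, hne⟩ := two_le_ldeg_iff.1 (hns _ h.zero_mem_lits)
  obtain ⟨c, -, rfl⟩ := hF.exists_eq_pair hC hxC
  obtain ⟨d, -, rfl⟩ := hF.exists_eq_pair hD hxD
  have hc : F.Imp (p 0).compl c := by simpa [Imp] using hC
  have hd : F.Imp (p 0).compl d := by simpa [Imp] using hD
  rcases hout c hc with rfl | rfl
  · exact hc
  · rcases hout d hd with rfl | rfl
    · exact hd
    · exact absurd rfl hne

/-- The continuation of a closed path to a closed walk through all literals. -/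
theorem exists_pres (h : Lasso F p m 0) (hF : F.IsPureTwoMU) (hns : ∀ x ∈ F.lits, 2 ≤ F.ldeg x) :
    ∃ q, Pres (m + 1) F (fun _ => false) q := by
  set n := m + 1 with hn
  -- The path continued antiperiodically: shifting by `n` complements.
  let c : ℕ → Lit V := fun i => if i / n % 2 = 0 then p (i % n) else (p (i % n)).compl
  have hcvar : ∀ i, (c i).var = (p (i % n)).var := by
    intro i
    simp only [c]
    split_ifs <;> rfl
  have hcn : ∀ i, c (i + n) = (c i).compl := by
    intro i
    simp only [c, Nat.add_mod_right, Nat.add_div_right i (show 0 < n by omega)]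
    rcases Nat.mod_two_eq_zero_or_one (i / n) with h1 | h1 <;>
      simp [Nat.add_mod, h1]
  have hcp : ∀ i < n, c i = p i := by
    intro i hi
    simp [c, Nat.div_eq_of_lt hi, Nat.mod_eq_of_lt hi]
  have hinj : ∀ i l, (c i).var = (c l).var → i % n = l % n := by
    intro i l hil
    rw [hcvar, hcvar] at hil
    exact h.inj _ (by have := Nat.mod_lt i (show 0 < n by omega); omega) _
      (by have := Nat.mod_lt l (show 0 < n by omega); omega) hil
  -- Every window of length `n` is again a lasso closing at its start, and `imp_compl` for the
  -- window starting at `t` supplies the next arc, out of `c (t + n)`.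
  have himp : ∀ t, ∀ i < t + n, F.Imp (c i) (c (i + 1)) := by
    intro t
    induction t with
    | zero =>
      intro i hi
      rw [hcp i (by omega)]
      rcases (show i + 1 < n ∨ i = m by omega) with h1 | rfl
      · rw [hcp _ h1]
        exact h.imp i (by omega)
      · have e : c (i + 1) = (p 0).compl := by
          have := hcn 0
          rwa [zero_add, hcp 0 (by omega)] at this
        rw [e, ← h.last]
        exact h.imp i le_rfl
    | succ t ih =>
      intro i hi
      rcases (show i < t + n ∨ i = t + n by omega) with hi | rfl
      · exact ih i hi
      · have hl : Lasso F (fun l => c (t + l)) m 0 := by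
          refine ⟨Nat.zero_le _, fun i hi => ih _ (by omega), hcn t, ?_⟩
          intro a ha b hb hab
          have h1 : a ≡ b [MOD n] := Nat.ModEq.add_left_cancel' t (hinj _ _ hab)
          exact Nat.ModEq.eq_of_lt_of_lt h1 (by omega) (by omega)
        have := hl.imp_compl hF hns
        rw [hcn, show t + n + 1 = t + 1 + n by omega, hcn]
        exact this
  have hper : Function.Periodic c (2 * n) := by
    intro i
    rw [two_mul, ← add_assoc, hcn, hcn, Lit.compl_compl]
  let q : ZMod (2 * n) → Lit V := fun i => c i.val
  have hq : ∀ a : ℕ, q a = c a := by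
    intro a
    simp only [q, ZMod.val_natCast]
    exact hper.map_mod_nat a
  have hcast : ∀ i : ZMod (2 * n), ∃ a : ℕ, i = a := fun i => ⟨i.val, by simp⟩
  have hunsplit : ∀ i, q (i + n) = (q i).compl := by
    intro i
    obtain ⟨a, rfl⟩ := hcast i
    rw [← Nat.cast_add, hq, hq, hcn]
  have hmem : ∀ i, ({q i, q (i + n + 1)} : Clause V) ∈ F := by
    intro i
    obtain ⟨a, rfl⟩ := hcast i
    have := himp (a + n + 1) (a + n) (by omega)
    rw [Imp, hcn, Lit.compl_compl] at this
    rw [← Nat.cast_add, ← Nat.cast_succ, hq, hq]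
    exact this
  -- The clauses of the closed walk are already unsatisfiable, so minimality makes them all of `F`.
  have hset : (Finset.univ.image fun i : ZMod (2 * n) => ({q i, q (i + n + 1)} : Clause V)) = F := by
    refine hF.eq_of_subset ?_ ?_
    · intro C hC
      obtain ⟨i, -, rfl⟩ := Finset.mem_image.1 hC
      exact hmem i
    · exact Pres.unsat_of_subset (s := fun _ => false) (fun i _ => hunsplit i)
        (fun i => Finset.mem_image_of_mem _ (Finset.mem_univ _)) (by simp)
  refine ⟨q, fun _ => rfl, fun i _ => hunsplit i, ?_, ?_⟩
  · intro i l hil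
    exact (Pres.eq_or_eq_add_half (hinj _ _ hil)).imp id fun h => ⟨h, rfl⟩
  · intro C
    rw [← hset]
    simp [eq_comm]

end Lasso

theorem IsPureTwoMU.lits_nonempty (hF : F.IsPureTwoMU) : ∃ x, x ∈ F.lits := by
  by_contra! hno
  apply hF.unsatisfiable
  refine ⟨fun _ => true, fun C hC => ?_⟩
  obtain ⟨x, hx⟩ : C.Nonempty := Finset.card_pos.1 (by rw [hF.card_eq_two C hC]; omega)
  exact absurd (subset_lits hC hx) (hno x)

/-- The classification of nonsingular 2-MUs. -/
theorem IsPureTwoMU.exists_pres_of_nonsingular (hF : F.IsPureTwoMU)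
    (hns : ∀ x ∈ F.lits, 2 ≤ F.ldeg x) {k : ℕ} (hd : F.deficiency = k) :
    ∃ q, Pres k F (fun _ => false) q := by
  obtain ⟨x, hx⟩ := hF.lits_nonempty
  obtain ⟨p, m, j, -, h⟩ := hF.exists_lasso hF.empty_notMem hx
  obtain rfl := h.eq_zero hF hns
  have hm : m ≠ 0 := by
    rintro rfl
    apply hF.var_ne (h.imp 0 le_rfl)
    rw [h.last, Lit.compl_var]
  obtain ⟨q, hq⟩ := h.exists_pres hF hns
  have h1 := hq.deficiency (by omega)
  rw [hd] at h1
  obtain rfl : k = m + 1 := by exact_mod_cast h1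
  exact ⟨q, hq⟩

end ClauseSet
end MU2

namespace MU2
variable {V : Type*} [LinearOrder V]
namespace ClauseSet

/-! ### Elimination of a literal occurring once -/

variable {F : ClauseSet V} {x a : Lit V}

theorem oneSingular_var_iff : F.OneSingular x.var ↔ F.ldeg x = 1 ∧ F.ldeg x.compl = 1 := by
  obtain ⟨v, b⟩ := x
  cases b
  · exact and_comm
  · exact Iff.rfl

/-- The clause `{x, a}` is the only one containing the literal `x`. -/
structure Sole (F : ClauseSet V) (x a : Lit V) : Prop where
  mem : ({x, a} : Clause V) ∈ F
  uniq : ∀ C ∈ F, x ∈ C → C = {x, a}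

/-- The substitution of `a` for the complement of `x`. -/
def substLit (x a z : Lit V) : Lit V := if z = x.compl then a else z

/-- Elimination of the variable of a literal `x` which occurs only in the clause `{x, a}`. -/
def elim (F : ClauseSet V) (x a : Lit V) : ClauseSet V :=
  (F.erase {x, a}).image fun C => C.image (substLit x a)

theorem substLit_compl : substLit x a x.compl = a := if_pos rfl

theorem substLit_of_ne {z : Lit V} (h : z ≠ x.compl) : substLit x a z = z := if_neg h

theorem IsPureTwoMU.exists_sole (hF : F.IsPureTwoMU) (hx : F.ldeg x = 1) : ∃ a, F.Sole x a := by
  obtain ⟨C, hC, hxC, h⟩ := ldeg_eq_one_iff.1 hx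
  obtain ⟨a, -, rfl⟩ := hF.exists_eq_pair hC hxC
  exact ⟨a, hC, h⟩

namespace Sole

theorem ldeg_eq_one (h : F.Sole x a) : F.ldeg x = 1 :=
  ldeg_eq_one_iff.2 ⟨_, h.mem, by simp, h.uniq⟩

theorem var_ne (h : F.Sole x a) (hF : F.IsPureTwoMU) : a.var ≠ x.var := by
  have : F.Imp x.compl a := by simpa [Imp] using h.mem
  exact (hF.var_ne this).symm

theorem notMem_erase (h : F.Sole x a) {C : Clause V} (hC : C ∈ F.erase {x, a}) : x ∉ C :=
  fun hx => (Finset.mem_erase.1 hC).1 (h.uniq C (Finset.mem_erase.1 hC).2 hx)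

theorem subst_satisfied {τ : V → Bool} (h : ∃ z ∈ ({x, a} : Clause V), z.Holds τ)
    {C : Clause V} (hC : ∃ z ∈ C, z.Holds τ) : ∃ z ∈ C.image (substLit x a), z.Holds τ := by
  obtain ⟨z, hz, hzτ⟩ := hC
  by_cases hzx : z = x.compl
  · subst hzx
    obtain ⟨y, hy, hyτ⟩ := h
    simp only [Finset.mem_insert, Finset.mem_singleton] at hy
    rcases hy with rfl | rfl
    · exact absurd hyτ (Lit.holds_compl.1 hzτ)
    · exact ⟨y, Finset.mem_image.2 ⟨_, hz, substLit_compl⟩, hyτ⟩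
  · exact ⟨z, Finset.mem_image.2 ⟨z, hz, substLit_of_ne hzx⟩, hzτ⟩

/-- An assignment violating only `E` satisfies `{x, a}`: if the complement of `x` is true then so is
`a`, and the substitution keeps all clauses other than `E` satisfied. -/
theorem exists_critical (h : F.Sole x a) (hF : F.IsPureTwoMU) {E : Clause V}
    (hE : E ∈ F.erase {x, a}) : ∃ τ : V → Bool, ∀ C ∈ F.erase {x, a}, C ≠ E →
      ∃ z ∈ C.image (substLit x a), z.Holds τ := by
  obtain ⟨hne, hEF⟩ := Finset.mem_erase.1 hE
  obtain ⟨τ, hτ⟩ := hF.minimal E hEF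
  refine ⟨τ, fun C hC hCE => subst_satisfied ?_ ?_⟩
  · exact hτ _ (Finset.mem_erase.2 ⟨hne.symm, h.mem⟩)
  · exact hτ _ (Finset.mem_erase.2 ⟨hCE, (Finset.mem_erase.1 hC).2⟩)

/-- A satisfying assignment would extend to `F` by making `x` true exactly when `a` is false. -/
theorem elim_not_satisfiable (h : F.Sole x a) (hF : F.IsPureTwoMU) :
    ¬ (F.elim x a).Satisfiable := by
  classical
  rintro ⟨τ, hτ⟩
  apply hF.unsatisfiable
  have hax := h.var_ne hF
  let τ' : V → Bool := fun v => if v = x.var then (if a.Holds τ then !x.sign else x.sign) else τ v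
  have h1 : ∀ z : Lit V, z.var ≠ x.var → (z.Holds τ' ↔ z.Holds τ) := by
    intro z hz
    simp [Lit.Holds, τ', hz]
  have h2 : x.Holds τ' ↔ ¬ a.Holds τ := by
    by_cases ha : a.Holds τ <;> simp [Lit.Holds, τ'] <;> simp [Lit.Holds] at ha <;> simp [ha]
  refine ⟨τ', fun C hC => ?_⟩
  by_cases hxC : x ∈ C
  · rw [h.uniq C hC hxC]
    by_cases ha : a.Holds τ
    · exact ⟨a, by simp, (h1 a hax).2 ha⟩
    · exact ⟨x, by simp, h2.2 ha⟩
  · obtain ⟨y, hy, hyτ⟩ := hτ (C.image (substLit x a)) (Finset.mem_image_of_mem _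
      (Finset.mem_erase.2 ⟨by rintro rfl; simp at hxC, hC⟩))
    obtain ⟨z, hz, rfl⟩ := Finset.mem_image.1 hy
    by_cases hzx : z = x.compl
    · subst hzx
      rw [substLit_compl] at hyτ
      exact ⟨_, hz, Lit.holds_compl.2 fun hx => h2.1 hx hyτ⟩
    · rw [substLit_of_ne hzx] at hyτ
      refine ⟨z, hz, (h1 z fun hv => ?_).2 hyτ⟩
      rcases Lit.var_eq_iff.1 hv with rfl | hv
      · exact hxC hz
      · exact hzx hv

/-- If two clauses had the same image, the critical assignment for one of them would satisfy the
whole eliminated clause-set. -/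
theorem injOn (h : F.Sole x a) (hF : F.IsPureTwoMU) :
    Set.InjOn (fun C : Clause V => C.image (substLit x a)) (F.erase {x, a} : Finset (Clause V)) := by
  intro E hE E' hE' hEE'
  by_contra hne
  obtain ⟨τ, hτ⟩ := h.exists_critical hF hE
  refine h.elim_not_satisfiable hF ⟨τ, fun D hD => ?_⟩
  obtain ⟨C, hC, rfl⟩ := Finset.mem_image.1 hD
  by_cases hCE : C = E
  · subst hCE
    dsimp only at hEE' ⊢
    rw [hEE']
    exact hτ E' hE' (Ne.symm hne)
  · exact hτ C hC hCE

theorem elim_vars (h : F.Sole x a) (hF : F.IsPureTwoMU) : (F.elim x a).vars = F.vars.erase x.var := by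
  have hax := h.var_ne hF
  ext v
  rw [mem_vars, Finset.mem_erase, mem_vars]
  constructor
  · rintro ⟨D, hD, y, hy, rfl⟩
    obtain ⟨C, hC, rfl⟩ := Finset.mem_image.1 hD
    obtain ⟨z, hz, rfl⟩ := Finset.mem_image.1 hy
    by_cases hzx : z = x.compl
    · subst hzx
      rw [substLit_compl]
      exact ⟨hax, _, h.mem, a, by simp, rfl⟩
    · rw [substLit_of_ne hzx]
      refine ⟨fun hv => ?_, C, (Finset.mem_erase.1 hC).2, z, hz, rfl⟩
      rcases Lit.var_eq_iff.1 hv with rfl | hv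
      · exact h.notMem_erase hC hz
      · exact hzx hv
  · rintro ⟨hv, C, hC, z, hz, rfl⟩
    by_cases hCx : C = {x, a}
    · subst hCx
      simp only [Finset.mem_insert, Finset.mem_singleton] at hz
      rcases hz with rfl | rfl
      · exact absurd rfl hv
      · obtain ⟨E, hE, hxE⟩ := hF.exists_mem (x := x.compl)
          (compl_mem_lits.2 (subset_lits h.mem (by simp)))
        refine ⟨_, Finset.mem_image_of_mem _ (Finset.mem_erase.2 ⟨?_, hE⟩), z,
          Finset.mem_image.2 ⟨_, hxE, substLit_compl⟩, rfl⟩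
        rintro rfl
        exact hF.clashFree _ hE x (by simp) hxE
    · refine ⟨_, Finset.mem_image_of_mem _ (Finset.mem_erase.2 ⟨hCx, hC⟩), z,
          Finset.mem_image.2 ⟨_, hz, substLit_of_ne ?_⟩, rfl⟩
      rintro rfl
      exact hv rfl

theorem elim_deficiency (h : F.Sole x a) (hF : F.IsPureTwoMU) :
    (F.elim x a).deficiency = F.deficiency := by
  have h1 : x.var ∈ F.vars := var_mem_vars h.mem (by simp)
  have h2 := Finset.card_pos.2 ⟨_, h1⟩
  have h3 := Finset.card_pos.2 ⟨_, h.mem⟩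
  rw [deficiency, deficiency, h.elim_vars hF, elim, Finset.card_image_of_injOn (h.injOn hF),
    Finset.card_erase_of_mem h.mem, Finset.card_erase_of_mem h1]
  omega

theorem elim_isTwoMU (h : F.Sole x a) (hF : F.IsPureTwoMU) : (F.elim x a).IsTwoMU := by
  refine ⟨?_, ?_, h.elim_not_satisfiable hF, ?_⟩
  -- A clashing image is satisfied by every assignment, so the critical assignment for its preimage
  -- would satisfy everything.
  · intro D hD y hy hy'
    obtain ⟨E, hE, rfl⟩ := Finset.mem_image.1 hD
    obtain ⟨τ, hτ⟩ := h.exists_critical hF hE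
    refine h.elim_not_satisfiable hF ⟨τ, fun D hD => ?_⟩
    obtain ⟨C, hC, rfl⟩ := Finset.mem_image.1 hD
    by_cases hCE : C = E
    · subst hCE
      by_cases hyτ : y.Holds τ
      · exact ⟨y, hy, hyτ⟩
      · exact ⟨_, hy', Lit.holds_compl.2 hyτ⟩
    · exact hτ C hC hCE
  · intro D hD
    obtain ⟨E, hE, rfl⟩ := Finset.mem_image.1 hD
    exact Finset.card_image_le.trans (hF.card_le_two E (Finset.mem_erase.1 hE).2)
  · intro D hD
    obtain ⟨E, hE, rfl⟩ := Finset.mem_image.1 hD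
    obtain ⟨τ, hτ⟩ := h.exists_critical hF hE
    refine ⟨τ, fun D hD => ?_⟩
    obtain ⟨hne, hD⟩ := Finset.mem_erase.1 hD
    obtain ⟨C, hC, rfl⟩ := Finset.mem_image.1 hD
    exact hτ C hC fun hCE => hne (by rw [hCE])

theorem elim_isPureTwoMU (h : F.Sole x a) (hF : F.IsPureTwoMU) (hd : 2 ≤ F.deficiency) :
    (F.elim x a).IsPureTwoMU :=
  (h.elim_isTwoMU hF).isPureTwoMU (by rwa [h.elim_deficiency hF])

theorem ldeg_elim (h : F.Sole x a) (hF : F.IsPureTwoMU) (y : Lit V) :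
    (F.elim x a).ldeg y = ((F.erase {x, a}).filter fun C => y ∈ C.image (substLit x a)).card := by
  rw [ldeg, elim, Finset.filter_image, Finset.card_image_of_injOn]
  exact (h.injOn hF).mono fun C hC => (Finset.mem_filter.1 hC).1

theorem ldeg_elim_of_ne (h : F.Sole x a) (hF : F.IsPureTwoMU) {y : Lit V} (hy : y.var ≠ x.var)
    (hya : y ≠ a) : (F.elim x a).ldeg y = F.ldeg y := by
  rw [h.ldeg_elim hF, ldeg]
  congr 1
  ext C
  simp only [Finset.mem_filter, Finset.mem_erase, Finset.mem_image]
  constructor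
  · rintro ⟨⟨-, hC⟩, z, hz, rfl⟩
    by_cases hzx : z = x.compl
    · rw [hzx, substLit_compl] at hya
      exact absurd rfl hya
    · rw [substLit_of_ne hzx]
      exact ⟨hC, hz⟩
  · rintro ⟨hC, hyC⟩
    refine ⟨⟨?_, hC⟩, y, hyC, substLit_of_ne fun he => hy (by rw [he, Lit.compl_var])⟩
    rintro rfl
    simp only [Finset.mem_insert, Finset.mem_singleton] at hyC
    exact hyC.elim (fun he => hy (by rw [he])) hya

/-- The substitution would contract this clause to the unit clause `{a}`, which no 2-MU of
deficiency at least two contains. -/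
theorem compl_pair_notMem (h : F.Sole x a) (hF : F.IsPureTwoMU) (hd : 2 ≤ F.deficiency) :
    ({x.compl, a} : Clause V) ∉ F := by
  intro hmem
  have hax := h.var_ne hF
  have hne : ({x.compl, a} : Clause V) ≠ {x, a} := by
    intro he
    have hx : x ∈ ({x.compl, a} : Clause V) := by rw [he]; simp
    simp only [Finset.mem_insert, Finset.mem_singleton] at hx
    rcases hx with hx | hx
    · simp at hx
    · exact hax (by rw [hx])
  have h1 : (({x.compl, a} : Clause V).image (substLit x a)) ∈ F.elim x a :=
    Finset.mem_image_of_mem _ (Finset.mem_erase.2 ⟨hne, hmem⟩)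
  have h2 := (h.elim_isPureTwoMU hF hd).card_eq_two _ h1
  rw [Finset.image_insert, Finset.image_singleton, substLit_compl, substLit_of_ne
    (fun he => hax (by rw [he, Lit.compl_var]))] at h2
  simp at h2

/-- The literal `a` loses the clause `{x, a}` and gains those of the complement of `x`; by
`compl_pair_notMem` none is counted twice. -/
theorem ldeg_elim_self (h : F.Sole x a) (hF : F.IsPureTwoMU) (hd : 2 ≤ F.deficiency) :
    (F.elim x a).ldeg a + 1 = F.ldeg a + F.ldeg x.compl := by
  have hax := h.var_ne hF
  have hxa : a ≠ x.compl := fun he => hax (by rw [he, Lit.compl_var])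
  have h1 : ((F.erase {x, a}).filter fun C => a ∈ C.image (substLit x a)) =
      ((F.filter fun C => a ∈ C).erase {x, a}) ∪ F.filter fun C => x.compl ∈ C := by
    ext C
    simp only [Finset.mem_filter, Finset.mem_erase, Finset.mem_image, Finset.mem_union]
    constructor
    · rintro ⟨⟨hne, hC⟩, z, hz, hza⟩
      by_cases hzx : z = x.compl
      · exact Or.inr ⟨hC, hzx ▸ hz⟩
      · rw [substLit_of_ne hzx] at hza
        exact Or.inl ⟨hne, hC, hza ▸ hz⟩
    · rintro (⟨hne, hC, ha⟩ | ⟨hC, hx⟩)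
      · exact ⟨⟨hne, hC⟩, a, ha, substLit_of_ne hxa⟩
      · refine ⟨⟨?_, hC⟩, _, hx, substLit_compl⟩
        rintro rfl
        exact hF.clashFree _ hC x (by simp) hx
  have h2 : Disjoint ((F.filter fun C => a ∈ C).erase {x, a}) (F.filter fun C => x.compl ∈ C) := by
    rw [Finset.disjoint_left]
    intro C hC hC'
    simp only [Finset.mem_filter, Finset.mem_erase] at hC hC'
    obtain ⟨b, -, rfl⟩ := hF.exists_eq_pair hC'.1 hC'.2
    have ha := hC.2.2
    simp only [Finset.mem_insert, Finset.mem_singleton] at ha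
    rcases ha with ha | rfl
    · exact hxa ha
    · exact h.compl_pair_notMem hF hd hC'.1
  have h3 : ({x, a} : Clause V) ∈ F.filter fun C => a ∈ C := by
    simp [h.mem]
  rw [h.ldeg_elim hF, h1, Finset.card_union_of_disjoint h2, Finset.card_erase_of_mem h3]
  have h4 := Finset.card_pos.2 ⟨_, h3⟩
  unfold ldeg
  omega

end Sole

end ClauseSet

/-! ### Literal degrees in a presentation -/

namespace Pres

variable {k : ℕ} {F : ClauseSet V} {s : ZMod (2 * k) → Bool} {q : ZMod (2 * k) → Lit V}

theorem injective (h : Pres k F s q) : Function.Injective q := by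
  intro i j hij
  rcases h.inj i j (congrArg _ hij) with h3 | ⟨rfl, hs⟩
  · exact h3.symm
  · rw [h.unsplit i hs] at hij
    simp at hij

theorem ne_compl_of_split (h : Pres k F s q) {i : ZMod (2 * k)} (hi : s i = true)
    (j : ZMod (2 * k)) : q j ≠ (q i).compl := by
  intro hij
  rcases h.inj i j (by rw [hij, Lit.compl_var]) with rfl | ⟨-, hs⟩
  · simp at hij
  · simp [hi] at hs

theorem ldeg_le_two (h : Pres k F s q) (i : ZMod (2 * k)) : F.ldeg (q i) ≤ 2 := by
  have hsub : (F.filter fun C => q i ∈ C) ⊆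
      {({q i, q (i + k + 1)} : Clause V), ({q (i + k - 1), q i} : Clause V)} := by
    intro C hC
    obtain ⟨hC, hi⟩ := Finset.mem_filter.1 hC
    rw [Finset.mem_insert, Finset.mem_singleton]
    rcases (h.mem C).1 hC with ⟨j, rfl⟩ | ⟨j, hj, rfl⟩ <;>
      simp only [Finset.mem_insert, Finset.mem_singleton] at hi
    · rcases hi with hi | hi
      · rw [h.injective hi]
        exact Or.inl rfl
      · rw [h.injective hi]
        refine Or.inr ?_
        congr 2
        linear_combination -half_add_half (k := k)
    · rcases hi with hi | hi
      · exact absurd hi (h.ne_compl_of_split hj i)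
      · exact absurd hi (h.ne_compl_of_split (by rw [h.periodic, hj]) i)
  exact (Finset.card_le_card hsub).trans Finset.card_le_two

theorem ldeg_compl_of_split (h : Pres k F s q) {i : ZMod (2 * k)} (hi : s i = true) :
    F.ldeg (q i).compl = 1 := by
  refine ClauseSet.ldeg_eq_one_iff.2 ⟨_, h.split_mem hi, by simp, fun D hD hiD => ?_⟩
  rcases (h.mem D).1 hD with ⟨j, rfl⟩ | ⟨j, hj, rfl⟩ <;>
    simp only [Finset.mem_insert, Finset.mem_singleton] at hiD
  · rcases hiD with hiD | hiD <;> exact absurd hiD.symm (h.ne_compl_of_split hi _)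
  · rcases hiD with hiD | hiD
    · rw [h.injective (Lit.compl_injective hiD)]
    · rw [h.injective (Lit.compl_injective hiD), add_half_add_half, Finset.pair_comm]

end Pres

namespace ClauseSet

variable {F : ClauseSet V} {k : ℕ}

/-- Reinserting an eliminated literal splits an overlap of a presentation. -/
theorem Sole.pres_of_elim {x a : Lit V} (h : F.Sole x a) (hF : F.IsPureTwoMU) (hk : 2 ≤ k)
    (ha : F.ldeg a = 1) {s : ZMod (2 * k) → Bool} {q : ZMod (2 * k) → Lit V}
    (hG : Pres k (F.elim x a) s q) {i : ZMod (2 * k)} (hi : s i = false) (hqi : q i = a) :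
    Pres k F (fun j => s j || (decide (j = i) || decide (j = i + k)))
      fun j => if j = i then x.compl else q j := by
  have : NeZero k := ⟨by omega⟩
  have hax := h.var_ne hF
  have hxa : a ≠ x.compl := fun he => hax (by rw [he, Lit.compl_var])
  have hik := add_half_ne i
  have hqx : ∀ j, (q j).var ≠ x.var := by
    intro j hj
    have h1 : q j ∈ (F.elim x a).lits := hG.mem_lits.2 ⟨j, Or.inl rfl⟩
    rw [ClauseSet.mem_lits, h.elim_vars hF, Finset.mem_erase] at h1
    exact h1.1 hj
  have hhalf : ∀ j, j + k = i ↔ j = i + k := by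
    intro j
    constructor
    · rintro rfl
      rw [add_half_add_half]
    · rintro rfl
      rw [add_half_add_half]
  have hshalf : ∀ j, s j = true → j ≠ i ∧ j ≠ i + k := by
    intro j hj
    constructor
    · rintro rfl
      simp [hi] at hj
    · rintro rfl
      rw [hG.periodic, hi] at hj
      simp at hj
  -- Every `a` after the elimination therefore stems from the complement of `x`, which makes the
  -- substitution invertible.
  have hasole : ∀ C ∈ F.erase {x, a}, a ∉ C := by
    obtain ⟨D, -, -, hD⟩ := ldeg_eq_one_iff.1 ha
    intro C hC haC
    obtain ⟨hne, hC⟩ := Finset.mem_erase.1 hC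
    exact hne ((hD C hC haC).trans (hD _ h.mem (by simp)).symm)
  -- `ρ` is the inverse substitution
  let ρ : Lit V → Lit V := fun z => if z = a then x.compl else z
  have hρ : F.erase {x, a} = (F.elim x a).image fun C => C.image ρ := by
    rw [elim, Finset.image_image]
    conv_lhs => rw [← Finset.image_id (s := F.erase {x, a})]
    refine Finset.image_congr fun C hC => ?_
    simp only [Function.comp, Finset.image_image, id]
    conv_lhs => rw [← Finset.image_id (s := C)]
    refine Finset.image_congr fun z hz => ?_
    simp only [id, Function.comp, ρ]
    by_cases hzx : z = x.compl
    · rw [hzx, substLit_compl, if_pos rfl]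
    · rw [substLit_of_ne hzx, if_neg]
      rintro rfl
      exact hasole C hC hz
  have hρq : ∀ j, ρ (q j) = if j = i then x.compl else q j := by
    intro j
    by_cases hj : j = i
    · simp [ρ, hj, hqi]
    · have : q j ≠ a := fun he => hj (hG.injective (he.trans hqi.symm))
      simp [ρ, hj, this]
  have hρc : ∀ j, s j = true → ρ (q j).compl = (q j).compl := by
    intro j hj
    refine if_neg fun he => ?_
    rw [← hqi] at he
    exact hG.ne_compl_of_split hj i he.symm
  have hF' : ∀ C, C ∈ F ↔ C = {x, a} ∨ ∃ D ∈ F.elim x a, D.image ρ = C := by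
    intro C
    rw [← Finset.mem_image, ← hρ, Finset.mem_erase]
    constructor
    · intro hC
      by_cases he : C = {x, a}
      · exact Or.inl he
      · exact Or.inr ⟨he, hC⟩
    · rintro (rfl | ⟨-, hC⟩)
      · exact h.mem
      · exact hC
  refine ⟨?_, ?_, ?_, ?_⟩
  · intro j
    have h1 : (j + k = i + k) ↔ j = i := add_left_inj _
    simp only [hG.periodic, h1, hhalf]
    cases s j <;> simp [Bool.or_comm]
  · intro j hj
    simp only [Bool.or_eq_false_iff, decide_eq_false_iff_not] at hj
    have h1 : ¬ (j + k = i) := fun he => hj.2.2 ((hhalf j).1 he)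
    rw [if_neg h1, if_neg hj.2.1, hG.unsplit j hj.1]
  · intro j l hjl
    by_cases hj : j = i <;> by_cases hl : l = i
    · exact Or.inl (hl.trans hj.symm)
    · rw [if_pos hj, if_neg hl, Lit.compl_var] at hjl
      exact absurd hjl.symm (hqx l)
    · rw [if_pos hl, if_neg hj, Lit.compl_var] at hjl
      exact absurd hjl (hqx j)
    · rw [if_neg hl, if_neg hj] at hjl
      refine (hG.inj j l hjl).imp id fun ⟨h1, h2⟩ => ⟨h1, ?_⟩
      have h3 : j ≠ i + k := fun he => hl (by rw [h1, he, add_half_add_half])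
      simp [h2, hj, h3]
  · intro C
    rw [hF']
    constructor
    · rintro (rfl | ⟨D, hD, rfl⟩)
      -- The restored clause `{x, a}` is the split clause of the new overlap: `q i` has become the
      -- complement of `x`, and `q (i + k)` is that of `a`.
      · refine Or.inr ⟨i, by simp, ?_⟩
        rw [if_pos rfl, if_neg hik, hG.unsplit i hi, hqi]
        simp
      · rcases (hG.mem D).1 hD with ⟨j, rfl⟩ | ⟨j, hj, rfl⟩
        · refine Or.inl ⟨j, ?_⟩
          rw [Finset.image_insert, Finset.image_singleton, hρq, hρq]
        · have hj' : s (j + k) = true := by rw [hG.periodic, hj]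
          refine Or.inr ⟨j, by simp [hj], ?_⟩
          rw [Finset.image_insert, Finset.image_singleton, hρc _ hj, hρc _ hj',
            if_neg (hshalf _ hj).1, if_neg (hshalf _ hj').1]
    · rintro (⟨j, rfl⟩ | ⟨j, hj, rfl⟩)
      · refine Or.inr ⟨_, hG.clause_mem j, ?_⟩
        rw [Finset.image_insert, Finset.image_singleton, hρq, hρq]
      · simp only [Bool.or_eq_true, decide_eq_true_eq] at hj
        rcases hj with hj | rfl | rfl
        · have hj' : s (j + k) = true := by rw [hG.periodic, hj]
          refine Or.inr ⟨_, hG.split_mem hj, ?_⟩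
          rw [Finset.image_insert, Finset.image_singleton, hρc _ hj, hρc _ hj',
            if_neg (hshalf _ hj).1, if_neg (hshalf _ hj').1]
        · left
          rw [if_pos rfl, if_neg hik, hG.unsplit j hi, hqi]
          simp
        · left
          rw [add_half_add_half, if_pos rfl, if_neg hik, hG.unsplit i hi, hqi, Finset.pair_comm]
          simp

/-- The classification of 2-MUs without 1-singular variables. -/
theorem IsPureTwoMU.exists_pres {F : ClauseSet V} (hF : F.IsPureTwoMU) (hk : 2 ≤ k)
    (hd : F.deficiency = k) (hns : ∀ v, ¬ F.OneSingular v) : ∃ s q, Pres k F s q := by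
  induction hn : F.vars.card using Nat.strong_induction_on generalizing F with
  | _ n ih =>
  by_cases hall : ∀ x ∈ F.lits, 2 ≤ F.ldeg x
  · exact ⟨_, hF.exists_pres_of_nonsingular hall hd⟩
  push Not at hall
  obtain ⟨x, hx, hlt⟩ := hall
  have hx1 : F.ldeg x = 1 := by
    have := hF.ldeg_pos hx
    omega
  obtain ⟨a, h⟩ := hF.exists_sole hx1
  have hd2 : 2 ≤ F.deficiency := by rw [hd]; exact_mod_cast hk
  have hax := h.var_ne hF
  have hxc : 2 ≤ F.ldeg x.compl := by
    have h1 := hF.ldeg_pos (compl_mem_lits.2 hx)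
    have h2 : F.ldeg x.compl ≠ 1 := fun h2 => hns x.var (oneSingular_var_iff.2 ⟨hx1, h2⟩)
    omega
  have ha1 : 0 < F.ldeg a := hF.ldeg_pos (subset_lits h.mem (by simp))
  have hself := h.ldeg_elim_self hF hd2
  have hac : (F.elim x a).ldeg a.compl = F.ldeg a.compl :=
    h.ldeg_elim_of_ne hF (by simpa using hax) (by simp)
  have hGF := h.elim_isPureTwoMU hF hd2
  obtain ⟨s, q, hG⟩ := ih _ (by
      rw [h.elim_vars hF, ← hn]
      exact Finset.card_erase_lt_of_mem (ClauseSet.mem_lits.1 hx)) hGF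
    (by rw [h.elim_deficiency hF, hd]) (by
      -- Among the literals of the remaining variables only `a` changes degree, and it ends with
      -- degree at least two, so no 1-singular variable arises.
      intro v hv
      have hvx : v ≠ x.var := by
        rintro rfl
        have h1 := ldeg_pos_iff.1 (by rw [hv.1]; exact Nat.one_pos)
        obtain ⟨C, hC, hxC⟩ := h1
        have h2 := var_mem_vars hC hxC
        rw [h.elim_vars hF] at h2
        simp at h2
      by_cases hva : v = a.var
      · subst hva
        have := (oneSingular_var_iff.1 hv).1
        omega
      · refine hns v ⟨?_, ?_⟩
        · rw [← h.ldeg_elim_of_ne hF (y := ⟨v, true⟩) hvx (by rintro rfl; exact hva rfl), hv.1]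
        · rw [← h.ldeg_elim_of_ne hF (y := ⟨v, false⟩) hvx (by rintro rfl; exact hva rfl), hv.2])
    rfl
  have haG : a ∈ (F.elim x a).lits := by
    rw [ClauseSet.mem_lits, h.elim_vars hF, Finset.mem_erase]
    exact ⟨hax, var_mem_vars h.mem (by simp)⟩
  obtain ⟨i, hqi⟩ : ∃ i, q i = a := by
    obtain ⟨i, hi | hi⟩ := hG.mem_lits.1 haG
    · exact ⟨i, hi.symm⟩
    · cases hs : s i
      · exact ⟨i + k, by rw [hG.unsplit i hs, hi]⟩
      · have := hG.ldeg_compl_of_split hs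
        rw [← hi] at this
        omega
  have h2 := hG.ldeg_le_two i
  rw [hqi] at h2
  -- After the elimination `a` has degree at most two; since the complement of `x` contributed at
  -- least two clauses, `a` itself occurred only in `{x, a}`.
  have ha : F.ldeg a = 1 := by omega
  -- At a split overlap the complement of `a` would also occur once, making the variable of `a`
  -- 1-singular in `F`.
  have hs : s i = false := by
    by_contra hs
    have := hG.ldeg_compl_of_split (i := i) (by simpa using hs)
    rw [hqi, hac] at this
    exact hns a.var (oneSingular_var_iff.2 ⟨ha, this⟩)
  exact ⟨_, _, h.pres_of_elim hF hk ha hG hs hqi⟩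

end ClauseSet
end MU2

namespace MU2
variable {V : Type*} [LinearOrder V]
namespace ClauseSet

/-! ### 1-singular DP-reduction -/

variable {F : ClauseSet V} {x y a b c d : Lit V}

theorem pair_eq_pair_iff {a b c d : Lit V} :
    ({a, b} : Clause V) = {c, d} ↔ (a = c ∧ b = d) ∨ (a = d ∧ b = c) := by
  rw [← Finset.coe_inj]
  push_cast
  exact Set.pair_eq_pair_iff

/-- The only clauses containing the variable of `x` are `{x, a}` and `{x.compl, b}`. -/
structure Bridge (F : ClauseSet V) (x a b : Lit V) : Prop where
  pos : F.Sole x a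
  neg : F.Sole x.compl b

theorem Bridge.symm (h : F.Bridge x a b) : F.Bridge x.compl b a :=
  ⟨h.neg, by rw [Lit.compl_compl]; exact h.pos⟩

/-- The two clauses containing the variable of `x` are replaced by their resolvent. -/
def bypass (F : ClauseSet V) (x a b : Lit V) : ClauseSet V :=
  insert {a, b} ((F.erase {x, a}).erase {x.compl, b})

theorem bypass_compl : F.bypass x.compl b a = F.bypass x a b := by
  rw [bypass, bypass, Lit.compl_compl, Finset.erase_right_comm, Finset.pair_comm b a]

theorem mem_bypass {C : Clause V} : C ∈ F.bypass x a b ↔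
    C = {a, b} ∨ (C ≠ {x.compl, b} ∧ C ≠ {x, a} ∧ C ∈ F) := by
  rw [bypass, Finset.mem_insert, Finset.mem_erase, Finset.mem_erase]

theorem IsPureTwoMU.exists_bridge (hF : F.IsPureTwoMU) (hx : F.OneSingular x.var) :
    ∃ a b, F.Bridge x a b := by
  rw [oneSingular_var_iff] at hx
  obtain ⟨a, ha⟩ := hF.exists_sole hx.1
  obtain ⟨b, hb⟩ := hF.exists_sole hx.2
  exact ⟨a, b, ha, hb⟩

namespace Bridge

theorem left_var_ne (h : F.Bridge x a b) (hF : F.IsPureTwoMU) : a.var ≠ x.var := h.pos.var_ne hF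

theorem right_var_ne (h : F.Bridge x a b) (hF : F.IsPureTwoMU) : b.var ≠ x.var := h.neg.var_ne hF

theorem clause_ne (h : F.Bridge x a b) (hF : F.IsPureTwoMU) :
    ({x.compl, b} : Clause V) ≠ {x, a} := by
  rw [Ne, pair_eq_pair_iff]
  rintro (⟨h1, -⟩ | ⟨h1, -⟩)
  · simp at h1
  · exact h.left_var_ne hF (by rw [← h1, Lit.compl_var])

/-- The complement of `x` occurs only in `{x.compl, b}`, so the substitution changes just this
clause, into the resolvent. All results on elimination thus apply to DP-reduction. -/
theorem elim_eq_bypass (h : F.Bridge x a b) (hF : F.IsPureTwoMU) :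
    F.elim x a = F.bypass x a b := by
  have hbx := h.right_var_ne hF
  have h1 : ({x.compl, b} : Clause V).image (substLit x a) = {a, b} := by
    rw [Finset.image_insert, Finset.image_singleton, substLit_compl,
      substLit_of_ne fun he => hbx (by rw [he, Lit.compl_var])]
  have h2 : ∀ C ∈ F, C ≠ {x.compl, b} → C.image (substLit x a) = C := by
    intro C hC hne
    conv_rhs => rw [← Finset.image_id (s := C)]
    refine Finset.image_congr fun z hz => substLit_of_ne ?_
    rintro rfl
    exact hne (h.neg.uniq C hC hz)
  ext C
  rw [mem_bypass, elim, Finset.mem_image]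
  constructor
  · rintro ⟨D, hD, rfl⟩
    obtain ⟨hne, hD⟩ := Finset.mem_erase.1 hD
    by_cases he : D = {x.compl, b}
    · subst he
      exact Or.inl h1
    · rw [h2 D hD he]
      exact Or.inr ⟨he, hne, hD⟩
  · rintro (rfl | ⟨h3, h4, h5⟩)
    · exact ⟨_, Finset.mem_erase.2 ⟨h.clause_ne hF, h.neg.mem⟩, h1⟩
    · exact ⟨C, Finset.mem_erase.2 ⟨h4, h5⟩, h2 C h5 h3⟩

theorem bypass_isPureTwoMU (h : F.Bridge x a b) (hF : F.IsPureTwoMU) (hd : 2 ≤ F.deficiency) :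
    (F.bypass x a b).IsPureTwoMU := by
  rw [← h.elim_eq_bypass hF]
  exact h.pos.elim_isPureTwoMU hF hd

theorem ends_var_ne (h : F.Bridge x a b) (hF : F.IsPureTwoMU) (hd : 2 ≤ F.deficiency) :
    a.var ≠ b.var := by
  have h1 : (F.bypass x a b).Imp a.compl b := by
    simp [Imp, mem_bypass]
  simpa using (h.bypass_isPureTwoMU hF hd).var_ne h1

/-- The substitution sends both `{x.compl, b}` and `{a, b}` to `{a, b}`, contradicting its
injectivity. -/
theorem resolvent_notMem (h : F.Bridge x a b) (hF : F.IsPureTwoMU) : ({a, b} : Clause V) ∉ F := by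
  intro hmem
  have hbx := h.right_var_ne hF
  have hax := h.left_var_ne hF
  have hne : ∀ z : Lit V, z.var ≠ x.var → z ≠ x.compl := fun z hz he =>
    hz (by rw [he, Lit.compl_var])
  have h0 : ({a, b} : Clause V) ≠ {x, a} := by
    rw [Ne, pair_eq_pair_iff]
    rintro (⟨rfl, -⟩ | ⟨-, rfl⟩)
    · exact hax rfl
    · exact hbx rfl
  have h1 := h.pos.injOn hF (Finset.mem_erase.2 ⟨h0, hmem⟩)
    (Finset.mem_erase.2 ⟨h.clause_ne hF, h.neg.mem⟩) (by
      simp [Finset.image_insert, substLit_compl, substLit_of_ne (hne _ hbx),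
        substLit_of_ne (hne _ hax)])
  rw [pair_eq_pair_iff] at h1
  rcases h1 with ⟨h1, -⟩ | ⟨-, h1⟩
  · exact hne _ hax h1
  · exact hne _ hbx h1

theorem dp_eq (h : F.Bridge x a b) (hF : F.IsPureTwoMU) (hd : 2 ≤ F.deficiency) :
    dp x.var F = F.bypass x a b := by
  wlog hx : x = ⟨x.var, true⟩ generalizing x a b
  · have hx' : x.compl = ⟨x.compl.var, true⟩ := by
      obtain ⟨v, s⟩ := x
      cases s
      · rfl
      · exact absurd rfl hx
    have := this h.symm hx'
    rwa [bypass_compl, Lit.compl_var] at this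
  have hxc : (⟨x.var, false⟩ : Lit V) = x.compl := by
    rw [hx]; rfl
  have hax := h.left_var_ne hF
  have hbx := h.right_var_ne hF
  have hab := h.ends_var_ne hF hd
  have hocc : ∀ C ∈ F, x.var ∈ C.image Lit.var ↔ C = {x, a} ∨ C = {x.compl, b} := by
    intro C hC
    rw [Finset.mem_image]
    constructor
    · rintro ⟨z, hz, hzx⟩
      rcases Lit.var_eq_iff.1 hzx with rfl | rfl
      · exact Or.inl (h.pos.uniq C hC hz)
      · exact Or.inr (h.neg.uniq C hC hz)
    · rintro (rfl | rfl)
      · exact ⟨x, by simp, rfl⟩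
      · exact ⟨x.compl, by simp, rfl⟩
  have hxa : x ≠ a := fun he => hax (by rw [he])
  have hxb : x.compl ≠ b := fun he => hbx (by rw [← he, Lit.compl_var])
  -- As `a` and `b` have different variables, `x` is the only clash, so the resolvent is really
  -- formed.
  have hinter : ({x, a} : Clause V) ∩ ({x.compl, b} : Clause V).image Lit.compl = {x} := by
    ext z
    simp only [Finset.image_insert, Finset.image_singleton, Lit.compl_compl, Finset.mem_inter,
      Finset.mem_insert, Finset.mem_singleton]
    constructor
    · rintro ⟨rfl | rfl, h2⟩
      · rfl
      · rcases h2 with rfl | rfl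
        · rfl
        · exact absurd rfl hab
    · rintro rfl
      exact ⟨Or.inl rfl, Or.inl rfl⟩
  have herase : ({x, a} : Clause V).erase x ∪ ({x.compl, b} : Clause V).erase x.compl = {a, b} := by
    rw [Finset.erase_insert (by simpa using hxa), Finset.erase_insert (by simpa using hxb)]
    rfl
  ext C
  rw [mem_bypass, dp, Finset.mem_union, Finset.mem_filter, ← hx, hxc, or_comm]
  refine or_congr ⟨?_, ?_⟩ ⟨?_, ?_⟩
  · intro hC
    obtain ⟨⟨D, E⟩, hDE, rfl⟩ := Finset.mem_image.1 hC
    rw [Finset.mem_filter, Finset.mem_product] at hDE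
    obtain ⟨⟨hD, hE⟩, hDE⟩ := hDE
    dsimp only at hD hE hDE ⊢
    have h1 : x ∈ D ∩ E.image Lit.compl := by rw [hDE]; simp
    obtain ⟨h1, h2⟩ := Finset.mem_inter.1 h1
    obtain ⟨z, hz, hzx⟩ := Finset.mem_image.1 h2
    rw [Lit.compl_eq_iff] at hzx
    subst hzx
    rw [h.pos.uniq D hD h1, h.neg.uniq E hE hz, herase]
  · rintro rfl
    exact Finset.mem_image.2 ⟨({x, a}, {x.compl, b}), Finset.mem_filter.2
      ⟨Finset.mem_product.2 ⟨h.pos.mem, h.neg.mem⟩, hinter⟩, herase⟩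
  · rintro ⟨hC, hv⟩
    rw [hocc C hC] at hv
    push Not at hv
    exact ⟨hv.2, hv.1, hC⟩
  · rintro ⟨h1, h2, hC⟩
    refine ⟨hC, ?_⟩
    rw [hocc C hC]
    exact fun h3 => h3.elim h2 h1

theorem ldeg_bypass (h : F.Bridge x a b) (hF : F.IsPureTwoMU) (hd : 2 ≤ F.deficiency)
    (hy : y.var ≠ x.var) : (F.bypass x a b).ldeg y = F.ldeg y := by
  rw [← h.elim_eq_bypass hF]
  by_cases hya : y = a
  · subst hya
    have h1 := h.pos.ldeg_elim_self hF hd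
    have h2 := h.neg.ldeg_eq_one
    omega
  · exact h.pos.ldeg_elim_of_ne hF hy hya

theorem bridge_bypass_of_ne (h' : F.Bridge y c d) (hxy : x.var ≠ y.var)
    (ha : a.var ≠ y.var) (hb : b.var ≠ y.var) : (F.bypass x a b).Bridge y c d := by
  have key : ∀ {z e : Lit V}, z.var = y.var → F.Sole z e → (F.bypass x a b).Sole z e := by
    intro z e hz hs
    have h1 : ∀ {C D : Clause V}, z ∈ C → z ∉ D → C ≠ D := by
      rintro C _ h2 h3 rfl
      exact h3 h2
    have hzn : ∀ u v : Lit V, u.var ≠ y.var → v.var ≠ y.var → z ∉ ({u, v} : Clause V) := by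
      intro u v hu hv hm
      simp only [Finset.mem_insert, Finset.mem_singleton] at hm
      rcases hm with rfl | rfl
      · exact hu hz
      · exact hv hz
    refine ⟨mem_bypass.2 (Or.inr ⟨h1 (by simp) (hzn _ _ hxy hb),
      h1 (by simp) (hzn _ _ hxy ha), hs.mem⟩), fun C hC hzC => ?_⟩
    rcases mem_bypass.1 hC with rfl | ⟨-, -, hC⟩
    · exact absurd hzC (hzn _ _ ha hb)
    · exact hs.uniq C hC hzC
  exact ⟨key rfl h'.pos, key rfl h'.neg⟩

/-- Here the two variables share the clause `{x, y}`. Once `x` is bypassed, `b` takes its place as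
the partner of `y`. -/
theorem bridge_bypass_of_eq (h : F.Bridge x y b) (h' : F.Bridge y x d) (hF : F.IsPureTwoMU)
    (hd : 2 ≤ F.deficiency) : (F.bypass x y b).Bridge y b d := by
  have hyb := h.ends_var_ne hF hd
  have hxy := h.left_var_ne hF
  refine ⟨⟨mem_bypass.2 (Or.inl rfl), fun C hC hyC => ?_⟩,
    ⟨mem_bypass.2 (Or.inr ⟨?_, ?_, h'.neg.mem⟩), fun C hC hyC => ?_⟩⟩
  · rcases mem_bypass.1 hC with rfl | ⟨-, hne, hC⟩
    · rfl
    · exact absurd ((h'.pos.uniq C hC hyC).trans (Finset.pair_comm _ _)) hne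
  · rw [Ne, pair_eq_pair_iff]
    rintro (⟨h1, -⟩ | ⟨h1, -⟩)
    · exact hxy (by rw [Lit.compl_injective h1])
    · exact hyb (by rw [← h1, Lit.compl_var])
  · rw [Ne, pair_eq_pair_iff]
    rintro (⟨h1, -⟩ | ⟨h1, -⟩)
    · exact hxy (by rw [← h1, Lit.compl_var])
    · simp at h1
  · rcases mem_bypass.1 hC with rfl | ⟨-, hne, hC⟩
    · simp only [Finset.mem_insert, Finset.mem_singleton] at hyC
      rcases hyC with h1 | h1
      · simp at h1
      · exact absurd (by rw [← h1, Lit.compl_var]) hyb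
    · exact h'.neg.uniq C hC hyC

theorem bypass_deficiency (h : F.Bridge x a b) (hF : F.IsPureTwoMU) :
    (F.bypass x a b).deficiency = F.deficiency := by
  rw [← h.elim_eq_bypass hF, h.pos.elim_deficiency hF]

theorem bypass_vars (h : F.Bridge x a b) (hF : F.IsPureTwoMU) :
    (F.bypass x a b).vars = F.vars.erase x.var := by
  rw [← h.elim_eq_bypass hF, h.pos.elim_vars hF]

/-- No clause contains both variables, so the two replacements do not interfere. -/
theorem dp_comm_of_ne (h : F.Bridge x a b) (h' : F.Bridge y c d) (hF : F.IsPureTwoMU)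
    (hd : 2 ≤ F.deficiency) (hxy : x.var ≠ y.var) (ha : a.var ≠ y.var) (hb : b.var ≠ y.var) :
    dp y.var (F.bypass x a b) = dp x.var (F.bypass y c d) := by
  have hcx : ∀ {z u : Lit V}, z.var = y.var → ({z, u} : Clause V) ∈ F → u.var ≠ x.var := by
    intro z u hz hm hu
    rcases Lit.var_eq_iff.1 hu with rfl | rfl
    · have := h.pos.uniq _ hm (by simp)
      rw [pair_eq_pair_iff] at this
      rcases this with ⟨rfl, -⟩ | ⟨rfl, -⟩
      · exact hxy hz
      · exact ha hz
    · have := h.neg.uniq _ hm (by simp)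
      rw [pair_eq_pair_iff] at this
      rcases this with ⟨rfl, -⟩ | ⟨rfl, -⟩
      · exact hxy hz
      · exact hb hz
  have hc : c.var ≠ x.var := hcx rfl h'.pos.mem
  have hdx : d.var ≠ x.var := hcx (z := y.compl) rfl h'.neg.mem
  have h1 := h'.bridge_bypass_of_ne hxy ha hb
  have h2 := h.bridge_bypass_of_ne hxy.symm hc hdx
  rw [h1.dp_eq (h.bypass_isPureTwoMU hF hd) (by rwa [h.bypass_deficiency hF]),
    h2.dp_eq (h'.bypass_isPureTwoMU hF hd) (by rwa [h'.bypass_deficiency hF])]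
  have hnp : ∀ u v z w : Lit V, u.var ≠ z.var → v.var ≠ z.var → ({u, v} : Clause V) ≠ {z, w} := by
    intro u v z w hu hv
    rw [Ne, pair_eq_pair_iff]
    rintro (⟨rfl, -⟩ | ⟨-, rfl⟩)
    · exact hu rfl
    · exact hv rfl
  have e1 := hnp a b y c ha hb
  have e2 := hnp a b y.compl d ha hb
  have e3 := hnp c d x a hc hdx
  have e4 := hnp c d x.compl b hc hdx
  ext C
  simp only [mem_bypass]
  grind

theorem dp_comm_of_eq (h : F.Bridge x y b) (h' : F.Bridge y c d) (hF : F.IsPureTwoMU)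
    (hd : 2 ≤ F.deficiency) : dp y.var (F.bypass x y b) = dp x.var (F.bypass y c d) := by
  have hxy := h.left_var_ne hF
  obtain rfl : c = x := by
    have := h'.pos.uniq _ h.pos.mem (by simp)
    rw [pair_eq_pair_iff] at this
    rcases this with ⟨h1, -⟩ | ⟨h1, -⟩
    · exact absurd (by rw [h1]) hxy
    · exact h1.symm
  have h1 := h.bridge_bypass_of_eq h' hF hd
  have h2 := h'.bridge_bypass_of_eq h hF hd
  rw [h1.dp_eq (h.bypass_isPureTwoMU hF hd) (by rwa [h.bypass_deficiency hF]),
    h2.dp_eq (h'.bypass_isPureTwoMU hF hd) (by rwa [h'.bypass_deficiency hF])]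
  -- The intermediate resolvents do not belong to `F`, so the second reduction erases no further
  -- clause of `F` along with them.
  have e1 := h.resolvent_notMem hF
  have e2 := h'.resolvent_notMem hF
  have e3 := Finset.pair_comm c y
  have e4 := Finset.pair_comm b d
  ext C
  simp only [mem_bypass]
  grind

theorem dp_comm (h : F.Bridge x a b) (h' : F.Bridge y c d) (hF : F.IsPureTwoMU)
    (hd : 2 ≤ F.deficiency) (hxy : x.var ≠ y.var) :
    dp y.var (F.bypass x a b) = dp x.var (F.bypass y c d) := by
  by_cases ha : a.var = y.var
  · rcases Lit.var_eq_iff.1 ha with rfl | rfl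
    · exact h.dp_comm_of_eq h' hF hd
    · have := h.dp_comm_of_eq h'.symm hF hd
      rwa [bypass_compl, Lit.compl_var] at this
  by_cases hb : b.var = y.var
  · rcases Lit.var_eq_iff.1 hb with rfl | rfl
    · have := h.symm.dp_comm_of_eq h' hF hd
      rwa [bypass_compl, Lit.compl_var] at this
    · have := h.symm.dp_comm_of_eq h'.symm hF hd
      rwa [bypass_compl, bypass_compl, Lit.compl_var, Lit.compl_var] at this
  exact h.dp_comm_of_ne h' hF hd hxy ha hb

end Bridge

theorem OneSingular.mem_vars {v : V} (hv : F.OneSingular v) : v ∈ F.vars := by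
  obtain ⟨C, hC, h⟩ := ldeg_pos_iff.1 (hv.1 ▸ Nat.one_pos)
  exact var_mem_vars hC h

theorem IsPureTwoMU.exists_bridge_dp (hF : F.IsPureTwoMU) (hd : 2 ≤ F.deficiency) {v : V}
    (hv : F.OneSingular v) :
    ∃ a b, F.Bridge ⟨v, true⟩ a b ∧ dp v F = F.bypass ⟨v, true⟩ a b := by
  obtain ⟨a, b, h⟩ := hF.exists_bridge (x := ⟨v, true⟩) hv
  exact ⟨a, b, h, h.dp_eq hF hd⟩

theorem IsPureTwoMU.dp_isPureTwoMU (hF : F.IsPureTwoMU) (hd : 2 ≤ F.deficiency) {v : V}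
    (hv : F.OneSingular v) : (dp v F).IsPureTwoMU ∧ (dp v F).deficiency = F.deficiency ∧
      (dp v F).vars.card < F.vars.card := by
  obtain ⟨a, b, h, hdp⟩ := hF.exists_bridge_dp hd hv
  rw [hdp, h.bypass_vars hF]
  exact ⟨h.bypass_isPureTwoMU hF hd, h.bypass_deficiency hF,
    Finset.card_erase_lt_of_mem hv.mem_vars⟩

theorem IsPureTwoMU.dp_dp_comm (hF : F.IsPureTwoMU) (hd : 2 ≤ F.deficiency) {v w : V}
    (hv : F.OneSingular v) (hw : F.OneSingular w) (hvw : v ≠ w) :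
    (dp v F).OneSingular w ∧
      dp w (dp v F) = dp v (dp w F) := by
  obtain ⟨a, b, h, hdp⟩ := hF.exists_bridge_dp hd hv
  obtain ⟨c, d, h', hdp'⟩ := hF.exists_bridge_dp hd hw
  rw [hdp, hdp']
  refine ⟨⟨?_, ?_⟩, h.dp_comm h' hF hd hvw⟩
  · rw [h.ldeg_bypass hF hd hvw.symm, hw.1]
  · rw [h.ldeg_bypass hF hd hvw.symm, hw.2]

theorem IsPureTwoMU.exists_normalForm (hF : F.IsPureTwoMU) (hd : 2 ≤ F.deficiency) :
    ∃ N, F.IsOneDPNormalForm N := by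
  induction hn : F.vars.card using Nat.strong_induction_on generalizing F with
  | _ n ih =>
  by_cases h : ∃ v, F.OneSingular v
  · obtain ⟨v, hv⟩ := h
    obtain ⟨h1, h2, h3⟩ := hF.dp_isPureTwoMU hd hv
    obtain ⟨N, hN⟩ := ih _ (hn ▸ h3) h1 (h2 ▸ hd) rfl
    exact ⟨N, .head ⟨v, hv, rfl⟩ hN.1, hN.2⟩
  · exact ⟨F, .refl, not_exists.1 h⟩

/-- Normal forms under 1-singular DP-reduction are unique. -/
theorem IsOneDPNormalForm.unique {M N : ClauseSet V} (hM : F.IsOneDPNormalForm M)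
    (hN : F.IsOneDPNormalForm N) (hF : F.IsPureTwoMU) (hd : 2 ≤ F.deficiency) : M = N := by
  induction hn : F.vars.card using Nat.strong_induction_on generalizing F M N with
  | _ n ih =>
  rcases hM.1.cases_head with rfl | ⟨G, ⟨v, hv, rfl⟩, hGM⟩
  · rcases hN.1.cases_head with rfl | ⟨H, ⟨w, hw, rfl⟩, hHN⟩
    · rfl
    · exact absurd hw (hM.2 w)
  · rcases hN.1.cases_head with rfl | ⟨H, ⟨w, hw, rfl⟩, hHN⟩
    · exact absurd hv (hN.2 v)
    · obtain ⟨h1, h2, h3⟩ := hF.dp_isPureTwoMU hd hv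
      obtain ⟨h1', h2', h3'⟩ := hF.dp_isPureTwoMU hd hw
      by_cases hvw : v = w
      · subst hvw
        exact ih _ (hn ▸ h3) ⟨hGM, hM.2⟩ ⟨hHN, hN.2⟩ h1 (h2 ▸ hd) rfl
      -- Each variable stays 1-singular after reducing the other, and the two results agree. A
      -- normal form `L` of this common reduct equals both given ones by induction.
      · obtain ⟨hw', hcomm⟩ := hF.dp_dp_comm hd hv hw hvw
        have hv' := (hF.dp_dp_comm hd hw hv (Ne.symm hvw)).1
        obtain ⟨g1, g2, -⟩ := h1.dp_isPureTwoMU (h2 ▸ hd) hw'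
        obtain ⟨L, hL⟩ := g1.exists_normalForm (by rw [g2, h2]; exact hd)
        have e1 := ih _ (hn ▸ h3) ⟨hGM, hM.2⟩ (N := L) ⟨.head ⟨w, hw', rfl⟩ hL.1, hL.2⟩ h1
          (h2 ▸ hd) rfl
        have e2 := ih _ (hn ▸ h3') ⟨hHN, hN.2⟩ (N := L)
          ⟨.head ⟨v, hv', hcomm⟩ hL.1, hL.2⟩ h1' (h2' ▸ hd) rfl
        exact e1.trans e2.symm

end ClauseSet
end MU2

namespace MU2

/-! ### Smoothing -/

namespace Multigraph

variable {α : Type*} [DecidableEq α]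

theorem ext {G H : Multigraph α} (hv : G.verts = H.verts)
    (hm : ∀ x y, G.mult s(x, y) = H.mult s(x, y)) : G = H := by
  obtain ⟨v, m, h⟩ := G
  obtain ⟨v', m', h'⟩ := H
  obtain rfl : v = v' := hv
  obtain rfl : m = m' := by
    funext e
    induction e with
    | _ x y => exact hm x y
  rfl

/-- The vertex `v` is joined by single edges to two distinct other vertices `u` and `w`, and has no
other edges. -/
structure Linear (G : Multigraph α) (v u w : α) : Prop where
  mem : v ∈ G.verts
  ne : u ≠ w
  left_ne : u ≠ v
  right_ne : w ≠ v
  mult_eq : ∀ y, G.mult s(v, y) = if y = u ∨ y = w then 1 else 0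

namespace Linear

variable {G : Multigraph α} {v u w : α}

theorem left_mem (h : G.Linear v u w) : u ∈ G.verts :=
  G.mem_verts s(v, u) (by simp [h.mult_eq]) u (by simp)

theorem right_mem (h : G.Linear v u w) : w ∈ G.verts :=
  G.mem_verts s(v, w) (by simp [h.mult_eq]) w (by simp)

theorem nbrs_eq (h : G.Linear v u w) : G.nbrs v = {u, w} := by
  ext y
  simp only [nbrs, Finset.mem_filter, h.mult_eq, Finset.mem_insert, Finset.mem_singleton]
  constructor
  · rintro ⟨-, hy⟩
    by_contra hno
    simp [hno] at hy
  · intro hy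
    refine ⟨?_, by simp [hy]⟩
    rcases hy with rfl | rfl
    · exact h.left_mem
    · exact h.right_mem

theorem mem_smoothable (h : G.Linear v u w) : v ∈ G.smoothable := by
  refine Finset.mem_filter.2 ⟨h.mem, ?_, ?_⟩
  · have : (G.verts.filter fun y => y = u ∨ y = w) = {u, w} := by
      ext y
      simp only [Finset.mem_filter, Finset.mem_insert, Finset.mem_singleton, and_iff_right_iff_imp]
      rintro (rfl | rfl)
      · exact h.left_mem
      · exact h.right_mem
    simp only [deg, h.mult_eq]
    rw [← Finset.card_filter, this, Finset.card_pair h.ne]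
  · rw [h.nbrs_eq, Finset.mem_insert, Finset.mem_singleton]
    rintro (he | he)
    · exact h.left_ne he.symm
    · exact h.right_ne he.symm

theorem smoothAt_mult (h : G.Linear v u w) {y z : α} (hy : y ≠ v) (hz : z ≠ v) :
    (G.smoothAt v).mult s(y, z) = G.mult s(y, z) + if s(y, z) = s(u, w) then 1 else 0 := by
  have h1 : v ∉ s(y, z) := by
    rw [Sym2.mem_iff]
    rintro (he | he)
    · exact hy he.symm
    · exact hz he.symm
  have h2 : (s(y, z) : Sym2 α).toFinset = G.nbrs v ↔ s(y, z) = s(u, w) := by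
    rw [h.nbrs_eq, Sym2.toFinset_mk_eq, ← Finset.coe_inj, Sym2.eq_iff]
    push_cast
    exact Set.pair_eq_pair_iff
  simp only [smoothAt, h1, if_false, h2]

/-- Each of the two distinct neighbours of `v` trades its edge to `v` for the new edge. -/
theorem smoothAt_deg (h : G.Linear v u w) {y : α} (hy : y ≠ v) :
    (G.smoothAt v).deg y = G.deg y := by
  have h1 : ∀ z ∈ G.verts.erase v, (G.smoothAt v).mult s(y, z) =
      G.mult s(y, z) + if s(y, z) = s(u, w) then 1 else 0 := fun z hz =>
    h.smoothAt_mult hy (Finset.mem_erase.1 hz).1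
  have h2 : (∑ z ∈ G.verts.erase v, if s(y, z) = s(u, w) then 1 else 0) = G.mult s(y, v) := by
    rw [Sym2.eq_swap (a := y) (b := v), h.mult_eq]
    by_cases hyu : y = u
    · subst hyu
      have : ∀ z, s(y, z) = s(y, w) ↔ z = w := fun z => Sym2.congr_right
      simp only [this, true_or, if_true]
      rw [Finset.sum_ite_eq', if_pos (Finset.mem_erase.2 ⟨h.right_ne, h.right_mem⟩)]
    · by_cases hyw : y = w
      · subst hyw
        have : ∀ z, s(y, z) = s(u, y) ↔ z = u := fun z => by
          rw [Sym2.eq_swap (a := u)]; exact Sym2.congr_right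
        simp only [this, or_true, if_true]
        rw [Finset.sum_ite_eq', if_pos (Finset.mem_erase.2 ⟨h.left_ne, h.left_mem⟩)]
      · have : ∀ z, ¬ s(y, z) = s(u, w) := fun z => by
          rw [Sym2.eq_iff]
          rintro (⟨he, -⟩ | ⟨he, -⟩)
          · exact hyu he
          · exact hyw he
        simp [this, hyu, hyw]
  change ∑ z ∈ G.verts.erase v, (G.smoothAt v).mult s(y, z) = ∑ z ∈ G.verts, G.mult s(y, z)
  rw [Finset.sum_congr rfl h1, Finset.sum_add_distrib, h2, Finset.sum_erase_add _ _ h.mem]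

end Linear

theorem smooth_of_isLeast {β : Type*} [LinearOrder β] {G : Multigraph β} {v : β}
    (hv : v ∈ G.smoothable) (h : ∀ y ∈ G.smoothable, v ≤ y) : G.smooth = (G.smoothAt v).smooth := by
  have hne : G.smoothable.Nonempty := ⟨v, hv⟩
  rw [smooth, dif_pos hne]
  congr 2
  exact le_antisymm (Finset.min'_le _ _ hv) (h _ (Finset.min'_mem _ _))

theorem smooth_of_smoothable_eq_empty {β : Type*} [LinearOrder β] {G : Multigraph β}
    (h : G.smoothable = ∅) : G.smooth = G := by
  rw [smooth, dif_neg (by simp [h])]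

end Multigraph

variable {V : Type*} [LinearOrder V]

theorem Lit.le_iff {x y : Lit V} : x ≤ y ↔ x.var < y.var ∨ x.var = y.var ∧ x.sign ≤ y.sign := by
  change toLex (x.var, x.sign) ≤ toLex (y.var, y.sign) ↔ _
  rw [Prod.Lex.toLex_le_toLex]

namespace ClauseSet

variable {F : ClauseSet V} {x y a b : Lit V}

theorem IsPureTwoMU.not_imp_self (hF : F.IsPureTwoMU) : ¬ F.Imp x x := fun h => hF.var_ne h rfl

open Classical in
theorem IsPureTwoMU.img_mult (hF : F.IsPureTwoMU) (x y : Lit V) :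
    F.img.mult s(x, y) = (if F.Imp x y then 1 else 0) + if F.Imp y x then 1 else 0 := by
  rw [img, FinDigraph.toMultigraph_mult]
  simp only [mem_idg_arcs]
  by_cases hxy : x = y
  · subst hxy
    simp [hF.not_imp_self]
  · simp [hxy]

theorem img_verts : F.img.verts = F.lits := rfl

open Classical in
theorem IsPureTwoMU.card_imp (hF : F.IsPureTwoMU) (x : Lit V) :
    (F.lits.filter fun y => F.Imp x y).card = F.ldeg x.compl := by
  refine Finset.card_bij (fun y _ => {x.compl, y}) ?_ ?_ ?_
  · intro y hy
    exact Finset.mem_filter.2 ⟨(Finset.mem_filter.1 hy).2, by simp⟩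
  · intro y hy z hz hyz
    have h1 := hF.var_ne (Finset.mem_filter.1 hy).2
    rw [pair_eq_pair_iff] at hyz
    rcases hyz with ⟨-, h⟩ | ⟨-, h⟩
    · exact h
    · exact absurd (by rw [h, Lit.compl_var]) h1
  · intro C hC
    obtain ⟨hC, hx⟩ := Finset.mem_filter.1 hC
    obtain ⟨y, -, rfl⟩ := hF.exists_eq_pair hC hx
    exact ⟨y, Finset.mem_filter.2 ⟨subset_lits hC (by simp), hC⟩, rfl⟩

/-- Arcs leaving `x` are clauses containing its complement; arcs entering `x` are contrapositives of
arcs leaving the complement, hence clauses containing `x`. -/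
theorem IsPureTwoMU.img_deg (hF : F.IsPureTwoMU) (x : Lit V) :
    F.img.deg x = F.ldeg x.compl + F.ldeg x := by
  classical
  have h1 : ∀ y, F.Imp y x ↔ F.Imp x.compl y.compl := fun y =>
    ⟨Imp.contra, fun h => by simpa using h.contra⟩
  have h2 := hF.card_imp x.compl
  rw [Lit.compl_compl] at h2
  have h3 : (F.lits.filter fun y => F.Imp y x).card =
      (F.lits.filter fun y => F.Imp x.compl y).card := by
    refine Finset.card_bij (fun y _ => y.compl) ?_ (fun y _ z _ h => Lit.compl_injective h) ?_
    · intro y hy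
      rw [Finset.mem_filter] at hy ⊢
      exact ⟨compl_mem_lits.2 hy.1, (h1 y).1 hy.2⟩
    · intro y hy
      rw [Finset.mem_filter] at hy
      refine ⟨y.compl, Finset.mem_filter.2 ⟨compl_mem_lits.2 hy.1, ?_⟩, y.compl_compl⟩
      rw [h1, Lit.compl_compl]
      exact hy.2
  unfold Multigraph.deg
  simp only [hF.img_mult]
  rw [Finset.sum_add_distrib, ← Finset.card_filter, ← Finset.card_filter, img_verts,
    hF.card_imp, h3, h2]

/-- Both literals of an occurring variable have positive degree, so total degree two means one
occurrence each. -/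
theorem IsPureTwoMU.mem_smoothable_img (hF : F.IsPureTwoMU) :
    x ∈ F.img.smoothable ↔ F.OneSingular x.var := by
  classical
  have h1 : x ∉ F.img.nbrs x := by
    simp [Multigraph.nbrs, hF.img_mult, hF.not_imp_self]
  rw [oneSingular_var_iff, Multigraph.smoothable, Finset.mem_filter, hF.img_deg, img_verts]
  constructor
  · rintro ⟨hx, h2, -⟩
    have h3 := hF.ldeg_pos hx
    have h4 := hF.ldeg_pos (compl_mem_lits.2 hx)
    omega
  · rintro ⟨h2, h3⟩
    refine ⟨?_, by omega, h1⟩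
    obtain ⟨C, hC, hx⟩ := ldeg_pos_iff.1 (h2 ▸ Nat.one_pos)
    exact subset_lits hC hx

theorem Bridge.linear_img (h : F.Bridge x a b) (hF : F.IsPureTwoMU) (hd : 2 ≤ F.deficiency) :
    F.img.Linear x a.compl b := by
  classical
  have hax := h.left_var_ne hF
  have hbx := h.right_var_ne hF
  have hab := h.ends_var_ne hF hd
  have hne : a.compl ≠ b := fun he => hab (by rw [← he, Lit.compl_var])
  refine ⟨subset_lits h.pos.mem (by simp), hne, ?_, ?_, ?_⟩
  · rintro he
    exact hax (by rw [← he, Lit.compl_var])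
  · rintro rfl
    exact hbx rfl
  · intro y
    have h1 : F.Imp x y ↔ y = b := by
      constructor
      · intro hi
        have := h.neg.uniq _ hi (by simp)
        rw [pair_eq_pair_iff] at this
        rcases this with ⟨-, h1⟩ | ⟨h1, -⟩
        · exact h1
        · exact absurd (by rw [← h1, Lit.compl_var]) hbx
      · rintro rfl
        exact h.neg.mem
    have h2 : F.Imp y x ↔ y = a.compl := by
      constructor
      · intro hi
        have := h.pos.uniq _ hi (by simp)
        rw [pair_eq_pair_iff] at this
        rcases this with ⟨-, h1⟩ | ⟨h1, -⟩
        · exact absurd (by rw [h1]) hax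
        · rw [← h1, Lit.compl_compl]
      · rintro rfl
        rw [Imp, Lit.compl_compl, Finset.pair_comm]
        exact h.pos.mem
    rw [hF.img_mult]
    simp only [h1, h2]
    by_cases hya : y = a.compl
    · simp [hya, hne]
    · simp [hya]

/-- Smoothing `x` adds an edge between `a.compl` and `b`, smoothing `x.compl` one between `b.compl`
and `a`. These are the two arcs of the resolvent, and they are new arcs by `resolvent_notMem`, so
the multiplicities add up. -/
theorem Bridge.img_bypass (h : F.Bridge x a b) (hF : F.IsPureTwoMU) (hd : 2 ≤ F.deficiency)
    (h1 : (F.img.smoothAt x).Linear x.compl b.compl a) :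
    (F.img.smoothAt x).smoothAt x.compl = (F.bypass x a b).img := by
  classical
  have hG := h.bypass_isPureTwoMU hF hd
  have h0 := h.linear_img hF hd
  have hab := h.ends_var_ne hF hd
  have hverts : (F.lits.erase x).erase x.compl = (F.bypass x a b).lits := by
    ext y
    rw [Finset.mem_erase, Finset.mem_erase, mem_lits, mem_lits, h.bypass_vars hF, Finset.mem_erase,
      Ne, Ne, Ne, Lit.var_eq_iff]
    tauto
  refine Multigraph.ext hverts fun y z => ?_
  have hout : ∀ (G : Multigraph (Lit V)) (y z : Lit V), y ∉ G.verts ∨ z ∉ G.verts →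
      G.mult s(y, z) = 0 := by
    intro G y z hyz
    by_contra hne
    rcases hyz with hyz | hyz
    · exact hyz (G.mem_verts _ hne y (by simp))
    · exact hyz (G.mem_verts _ hne z (by simp))
  by_cases hyz : y ∉ (F.bypass x a b).lits ∨ z ∉ (F.bypass x a b).lits
  · rw [hout ((F.img.smoothAt x).smoothAt x.compl) y z (by rw [← hverts] at hyz; exact hyz),
      hout (F.bypass x a b).img y z hyz]
  push Not at hyz
  rw [← hverts] at hyz
  simp only [Finset.mem_erase] at hyz
  obtain ⟨⟨hyc, hyx, -⟩, hzc, hzx, -⟩ := hyz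
  rw [h1.smoothAt_mult hyc hzc, h0.smoothAt_mult hyx hzx, hF.img_mult, hG.img_mult]
  have himp : ∀ y z : Lit V, y ≠ x → y ≠ x.compl → z ≠ x → z ≠ x.compl →
      ((if (F.bypass x a b).Imp y z then 1 else 0) = (if F.Imp y z then 1 else 0) +
        ((if y = a.compl ∧ z = b then 1 else 0) + if y = b.compl ∧ z = a then 1 else 0)) := by
    intro y z hyx hyc hzx hzc
    have e1 : ({y.compl, z} : Clause V) ≠ {x.compl, b} := by
      rw [Ne, pair_eq_pair_iff]
      rintro (⟨h, -⟩ | ⟨-, h⟩)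
      · exact hyx (Lit.compl_injective h)
      · exact hzc h
    have e2 : ({y.compl, z} : Clause V) ≠ {x, a} := by
      rw [Ne, pair_eq_pair_iff]
      rintro (⟨h, -⟩ | ⟨-, h⟩)
      · exact hyc (Lit.compl_eq_iff.1 h)
      · exact hzx h
    have e3 : (F.bypass x a b).Imp y z ↔ (y = a.compl ∧ z = b ∨ y = b.compl ∧ z = a) ∨ F.Imp y z := by
      rw [Imp, mem_bypass, pair_eq_pair_iff, Lit.compl_eq_iff, Lit.compl_eq_iff]
      simp [e1, e2, Imp]
    have e4 : (y = a.compl ∧ z = b ∨ y = b.compl ∧ z = a) → ¬ F.Imp y z := by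
      intro he hi
      apply h.resolvent_notMem hF
      rw [Imp] at hi
      rcases he with ⟨rfl, rfl⟩ | ⟨rfl, rfl⟩
      · rwa [Lit.compl_compl] at hi
      · rwa [Lit.compl_compl, Finset.pair_comm] at hi
    have e5 : ¬ ((y = a.compl ∧ z = b) ∧ (y = b.compl ∧ z = a)) := by
      rintro ⟨⟨-, rfl⟩, -, rfl⟩
      exact hab rfl
    rw [if_congr e3 rfl rfl]
    by_cases p1 : F.Imp y z <;> by_cases p2 : y = a.compl ∧ z = b <;>
      by_cases p3 : y = b.compl ∧ z = a <;> simp only [p1, p2, p3, if_true, if_false, or_true,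
        true_or, or_false, and_self] at * <;> simp_all
  rw [himp y z hyx hyc hzx hzc, himp z y hzx hzc hyx hyc]
  have e1 : s(y, z) = s(a.compl, b) ↔ (y = a.compl ∧ z = b) ∨ (z = a.compl ∧ y = b) := by
    rw [Sym2.eq_iff, and_comm (a := y = b)]
  have e2 : s(y, z) = s(b.compl, a) ↔ (y = b.compl ∧ z = a) ∨ (z = b.compl ∧ y = a) := by
    rw [Sym2.eq_iff, and_comm (a := y = a)]
  have e3 : ¬ ((y = a.compl ∧ z = b) ∧ (z = a.compl ∧ y = b)) := by
    rintro ⟨⟨-, rfl⟩, h3, -⟩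
    exact hab (by rw [h3, Lit.compl_var])
  have e4 : ¬ ((y = b.compl ∧ z = a) ∧ (z = b.compl ∧ y = a)) := by
    rintro ⟨⟨-, rfl⟩, h3, -⟩
    exact hab (by rw [h3, Lit.compl_var])
  have hsum : ∀ (p q : Prop) [Decidable p] [Decidable q] [Decidable (p ∨ q)], ¬ (p ∧ q) →
      (if p ∨ q then 1 else 0) = (if p then 1 else 0) + if q then 1 else 0 := by
    intro p q _ _ _ hpq
    by_cases hp : p <;> by_cases hq : q <;> simp [hp, hq] at hpq ⊢
  rw [if_congr e1 rfl rfl, if_congr e2 rfl rfl, hsum _ _ e3, hsum _ _ e4]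
  omega

/-- Smoothing of the implication multigraph performs a 1-singular DP-reduction. -/
theorem IsPureTwoMU.exists_smooth_dp (hF : F.IsPureTwoMU) (hd : 2 ≤ F.deficiency)
    (hs : ∃ v, F.OneSingular v) :
    ∃ v, F.OneSingular v ∧ F.img.smooth = (dp v F).img.smooth := by
  classical
  obtain ⟨v, hv⟩ := hs
  have hne : F.img.smoothable.Nonempty := ⟨⟨v, true⟩, hF.mem_smoothable_img.2 hv⟩
  set x := F.img.smoothable.min' hne with hx
  have hxs : x ∈ F.img.smoothable := Finset.min'_mem _ _
  have hxmin : ∀ y ∈ F.img.smoothable, x ≤ y := fun y hy => Finset.min'_le _ _ hy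
  have hxv := hF.mem_smoothable_img.1 hxs
  obtain ⟨a, b, h⟩ := hF.exists_bridge hxv
  refine ⟨x.var, hxv, ?_⟩
  have h0 := h.linear_img hF hd
  have h0' := h.symm.linear_img hF hd
  have h1 : (F.img.smoothAt x).Linear x.compl b.compl a := by
    refine ⟨Finset.mem_erase.2 ⟨x.compl_ne, h0'.mem⟩, h0'.ne, h0'.left_ne, h0'.right_ne, ?_⟩
    intro y
    by_cases hyx : y = x
    · subst hyx
      have e1 : ¬ (x = b.compl ∨ x = a) := by
        rintro (he | he)
        · exact h.right_var_ne hF (by rw [he, Lit.compl_var])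
        · exact h.left_var_ne hF (by rw [he])
      rw [if_neg e1]
      simp [Multigraph.smoothAt]
    · rw [h0.smoothAt_mult x.compl_ne hyx, h0'.mult_eq, if_neg (c := s(x.compl, y) = _), add_zero]
      rw [Sym2.eq_iff]
      rintro (⟨he, -⟩ | ⟨he, -⟩)
      · exact h.left_var_ne hF (by rw [Lit.compl_injective he])
      · exact h.right_var_ne hF (by rw [← he, Lit.compl_var])
  rw [h.dp_eq hF hd, Multigraph.smooth_of_isLeast hxs hxmin,
    Multigraph.smooth_of_isLeast h1.mem_smoothable ?_, h.img_bypass hF hd h1]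
  have hxc : x ≤ x.compl := hxmin _ (hF.mem_smoothable_img.2 (by simpa using hxv))
  -- Smoothing `x` keeps the degrees of the other vertices, so any vertex still smoothable was so
  -- before and is not below `x`. If it is not `x.compl`, its variable is larger, and it comes after
  -- `x.compl` as well.
  intro y hy
  obtain ⟨hyv, hydeg, -⟩ := Finset.mem_filter.1 hy
  obtain ⟨hyx, hyF⟩ := Finset.mem_erase.1 hyv
  rw [h0.smoothAt_deg hyx] at hydeg
  have hyS : y ∈ F.img.smoothable := by
    refine Finset.mem_filter.2 ⟨hyF, hydeg, ?_⟩
    simp [Multigraph.nbrs, hF.img_mult, hF.not_imp_self]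
  have hle := hxmin y hyS
  by_cases hyc : y = x.compl
  · exact hyc.ge
  · have hvar : x.var ≠ y.var := fun he => by
      rcases Lit.var_eq_iff.1 he.symm with he | he
      · exact hyx he
      · exact hyc he
    rw [Lit.le_iff] at hle ⊢
    exact Or.inl (hle.resolve_right fun h => hvar h.1)

/-- The smoothing of the implication multigraph is the implication multigraph of a normal form. -/
theorem IsPureTwoMU.exists_smooth_eq (hF : F.IsPureTwoMU) (hd : 2 ≤ F.deficiency) :
    ∃ N, F.IsOneDPNormalForm N ∧ N.IsTwoMU ∧ N.deficiency = F.deficiency ∧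
      F.img.smooth = N.img := by
  induction hn : F.vars.card using Nat.strong_induction_on generalizing F with
  | _ n ih =>
  by_cases h : ∃ v, F.OneSingular v
  · obtain ⟨v, hv, hs⟩ := hF.exists_smooth_dp hd h
    obtain ⟨h1, h2, h3⟩ := hF.dp_isPureTwoMU hd hv
    obtain ⟨N, hN, hN', hNd, hNs⟩ := ih _ (hn ▸ h3) h1 (h2 ▸ hd) rfl
    exact ⟨N, ⟨.head ⟨v, hv, rfl⟩ hN.1, hN.2⟩, hN', hNd.trans h2, hs.trans hNs⟩
  · push Not at h
    refine ⟨F, ⟨.refl, h⟩, hF.toIsTwoMU, rfl, Multigraph.smooth_of_smoothable_eq_empty ?_⟩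
    exact Finset.eq_empty_of_forall_notMem fun x hx => h _ (hF.mem_smoothable_img.1 hx)

end ClauseSet
end MU2

namespace MU2

/-! ### Rigidity of big cycles of small cycles -/

theorem Multigraph.Isomorphic.exists_bijOn {α : Type*} {G H : Multigraph α}
    (h : G.Isomorphic H) : ∃ g : α → α, Set.BijOn g G.verts H.verts ∧
      ∀ x ∈ G.verts, ∀ y ∈ G.verts, H.mult s(g x, g y) = G.mult s(x, y) := by
  classical
  obtain ⟨f, hf⟩ := h
  let g : α → α := fun x => if hx : x ∈ G.verts then f ⟨x, hx⟩ else x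
  have hg : ∀ x (hx : x ∈ G.verts), g x = f ⟨x, hx⟩ := fun x hx => dif_pos hx
  refine ⟨g, ⟨?_, ?_, ?_⟩, ?_⟩
  · intro x hx
    rw [hg x hx]
    exact (f _).2
  · intro x hx y hy hxy
    rw [hg x hx, hg y hy] at hxy
    exact congrArg Subtype.val (f.injective (Subtype.ext hxy))
  · intro y hy
    refine ⟨f.symm ⟨y, hy⟩, (f.symm ⟨y, hy⟩).2, ?_⟩
    rw [hg _ (f.symm ⟨y, hy⟩).2]
    simp
  · intro x hx y hy
    rw [hg x hx, hg y hy]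
    exact hf ⟨x, hx⟩ ⟨y, hy⟩

theorem Multigraph.deg_eq_of_bijOn {α : Type*} [DecidableEq α] {G H : Multigraph α} {g : α → α}
    (hg : Set.BijOn g G.verts H.verts)
    (hm : ∀ x ∈ G.verts, ∀ y ∈ G.verts, H.mult s(g x, g y) = G.mult s(x, y)) {x : α}
    (hx : x ∈ G.verts) : H.deg (g x) = G.deg x :=
  (Finset.sum_nbij g (fun _ hy => hg.mapsTo hy) hg.injOn hg.surjOn
    fun y hy => (hm x hx y hy).symm).symm

namespace NonlinearWDC

variable {m : ℕ} [NeZero m] {s : ZMod m → Bool}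

theorem one_ne (hm : 4 ≤ m) : (1 : ZMod m) ≠ 0 := by
  simpa using natCast_ne_zero (n := m) (a := 1) (by omega) (by omega)

theorem two_ne (hm : 4 ≤ m) : (2 : ZMod m) ≠ 0 := by
  simpa using natCast_ne_zero (n := m) (a := 2) (by omega) (by omega)

theorem three_ne (hm : 4 ≤ m) : (3 : ZMod m) ≠ 0 := by
  simpa using natCast_ne_zero (n := m) (a := 3) (by omega) (by omega)

theorem notMem_arcs_self (hm : 4 ≤ m) (p : ZMod m × Bool) :
    (p, p) ∉ (nonlinearWDC m s).arcs := by
  rw [mem_nonlinearWDC_arcs]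
  rintro (⟨h | h, -⟩ | ⟨-, -, h, h'⟩)
  · exact one_ne hm (by linear_combination -h)
  · exact one_ne hm (by linear_combination -h)
  · exact absurd (h.symm.trans h') (by simp)

theorem mult_eq (hm : 4 ≤ m) (p p' : ZMod m × Bool) :
    (nonlinearWDC m s).toMultigraph.mult s(p, p') =
      (if (p, p') ∈ (nonlinearWDC m s).arcs then 1 else 0) +
        if (p', p) ∈ (nonlinearWDC m s).arcs then 1 else 0 := by
  rw [FinDigraph.toMultigraph_mult]
  by_cases h : p = p'
  · subst h
    simp [notMem_arcs_self hm]
  · simp [h]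

theorem mult_ne_zero_iff (hm : 4 ≤ m) {p p' : ZMod m × Bool} :
    (nonlinearWDC m s).toMultigraph.mult s(p, p') ≠ 0 ↔
      (p, p') ∈ (nonlinearWDC m s).arcs ∨ (p', p) ∈ (nonlinearWDC m s).arcs := by
  rw [mult_eq hm]
  by_cases h1 : (p, p') ∈ (nonlinearWDC m s).arcs <;>
    by_cases h2 : (p', p) ∈ (nonlinearWDC m s).arcs <;> simp [h1, h2]

theorem fst_of_mult_ne_zero (hm : 4 ≤ m) {p p' : ZMod m × Bool}
    (h : (nonlinearWDC m s).toMultigraph.mult s(p, p') ≠ 0) :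
    p'.1 = p.1 ∨ p'.1 = p.1 + 1 ∨ p'.1 = p.1 - 1 := by
  rw [mult_ne_zero_iff hm, mem_nonlinearWDC_arcs, mem_nonlinearWDC_arcs] at h
  rcases h with (⟨h | h, -⟩ | ⟨h, -⟩) | (⟨h | h, -⟩ | ⟨h, -⟩)
  · exact Or.inr (Or.inl h)
  · exact Or.inr (Or.inr (by simp only at h; linear_combination -h))
  · exact Or.inl h.symm
  · exact Or.inr (Or.inr (by simp only at h; linear_combination -h))
  · exact Or.inr (Or.inl h)
  · exact Or.inl h

theorem exists_adj (hm : 4 ≤ m) (p : ZMod m × Bool) (hp : p ∈ (nonlinearWDC m s).verts) :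
    ∃ p' ∈ (nonlinearWDC m s).verts, p'.1 + 1 = p.1 ∧
      (nonlinearWDC m s).toMultigraph.mult s(p', p) ≠ 0 := by
  obtain ⟨i, b⟩ := p
  rw [mem_nonlinearWDC_verts] at hp
  cases b
  · refine ⟨(i - 1, s (i - 1)), by simp [mem_nonlinearWDC_verts], by simp, ?_⟩
    rw [mult_ne_zero_iff hm, mem_nonlinearWDC_arcs]
    exact Or.inl (Or.inl ⟨Or.inl (by simp), rfl, rfl⟩)
  · refine ⟨(i - 1, false), by simp [mem_nonlinearWDC_verts], by simp, ?_⟩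
    rw [mult_ne_zero_iff hm, mem_nonlinearWDC_arcs, mem_nonlinearWDC_arcs]
    exact Or.inr (Or.inl ⟨Or.inr (by simp), (hp rfl).symm, rfl⟩)

theorem sub_one_ne_add_one (hm : 4 ≤ m) (i : ZMod m) : i - 1 ≠ i + 1 := fun h =>
  two_ne hm (by linear_combination -h)

theorem out_eq (i : ZMod m) : ((nonlinearWDC m s).verts.filter fun y =>
    ((i, s i), y) ∈ (nonlinearWDC m s).arcs) = {(i - 1, false), (i + 1, false)} := by
  ext ⟨j, c⟩
  simp only [Finset.mem_filter, mem_nonlinearWDC_verts, mem_nonlinearWDC_arcs,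
    Finset.mem_insert, Finset.mem_singleton, Prod.mk.injEq]
  constructor
  · rintro ⟨-, ⟨h | h, -, rfl⟩ | ⟨-, h, h', -⟩⟩
    · exact Or.inr ⟨h, rfl⟩
    · exact Or.inl ⟨by linear_combination -h, rfl⟩
    · simp [h] at h'
  · rintro (⟨rfl, rfl⟩ | ⟨rfl, rfl⟩)
    · exact ⟨by simp, Or.inl ⟨Or.inr (by ring), trivial, rfl⟩⟩
    · exact ⟨by simp, Or.inl ⟨Or.inl rfl, trivial, rfl⟩⟩

theorem in_eq (i : ZMod m) : ((nonlinearWDC m s).verts.filter fun y =>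
    (y, (i, false)) ∈ (nonlinearWDC m s).arcs) =
      {(i - 1, s (i - 1)), (i + 1, s (i + 1))} := by
  ext ⟨j, c⟩
  simp only [Finset.mem_filter, mem_nonlinearWDC_verts, mem_nonlinearWDC_arcs,
    Finset.mem_insert, Finset.mem_singleton, Prod.mk.injEq]
  constructor
  · rintro ⟨-, ⟨h | h, rfl, -⟩ | ⟨-, -, -, h⟩⟩
    · obtain rfl : j = i - 1 := by linear_combination -h
      exact Or.inl ⟨rfl, rfl⟩
    · exact Or.inr ⟨h, by rw [h]⟩
    · simp at h
  · rintro (⟨rfl, rfl⟩ | ⟨rfl, rfl⟩)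
    · exact ⟨id, Or.inl ⟨Or.inl (by ring), rfl, trivial⟩⟩
    · exact ⟨id, Or.inl ⟨Or.inr rfl, rfl, trivial⟩⟩

theorem out_split_eq {i : ZMod m} (hi : s i = true) : ((nonlinearWDC m s).verts.filter fun y =>
    ((i, false), y) ∈ (nonlinearWDC m s).arcs) = {(i, true)} := by
  ext ⟨j, c⟩
  simp only [Finset.mem_filter, mem_nonlinearWDC_verts, mem_nonlinearWDC_arcs,
    Finset.mem_singleton, Prod.mk.injEq]
  constructor
  · rintro ⟨-, ⟨-, h, -⟩ | ⟨h, -, -, h'⟩⟩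
    · simp [hi] at h
    · exact ⟨h.symm, h'⟩
  · rintro ⟨rfl, rfl⟩
    simp [hi]

theorem in_split_eq {i : ZMod m} (hi : s i = true) : ((nonlinearWDC m s).verts.filter fun y =>
    (y, (i, true)) ∈ (nonlinearWDC m s).arcs) = {(i, false)} := by
  ext ⟨j, c⟩
  simp only [Finset.mem_filter, mem_nonlinearWDC_verts, mem_nonlinearWDC_arcs,
    Finset.mem_singleton, Prod.mk.injEq]
  constructor
  · rintro ⟨-, ⟨-, -, h⟩ | ⟨h, -, h', -⟩⟩
    · simp at h
    · exact ⟨h, h'⟩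
  · rintro ⟨rfl, rfl⟩
    simp [hi]

/-- An unsplit vertex has two incoming and two outgoing arcs; a vertex of a split overlap has one of
these pairs replaced by the arc of the split. -/
theorem deg_eq (hm : 4 ≤ m) {p : ZMod m × Bool} (hp : p ∈ (nonlinearWDC m s).verts) :
    (nonlinearWDC m s).toMultigraph.deg p = if s p.1 = true then 3 else 4 := by
  obtain ⟨i, b⟩ := p
  rw [mem_nonlinearWDC_verts] at hp
  have hv : (nonlinearWDC m s).toMultigraph.verts = (nonlinearWDC m s).verts := rfl
  have hne : ∀ b c : Bool, ((i - 1, b) : ZMod m × Bool) ≠ (i + 1, c) := fun b c h =>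
    sub_one_ne_add_one hm i (congrArg Prod.fst h)
  have h1 : (nonlinearWDC m s).toMultigraph.deg (i, b) =
      ((nonlinearWDC m s).verts.filter fun y => ((i, b), y) ∈ (nonlinearWDC m s).arcs).card +
      ((nonlinearWDC m s).verts.filter fun y => (y, (i, b)) ∈ (nonlinearWDC m s).arcs).card := by
    unfold Multigraph.deg
    simp only [mult_eq hm]
    rw [Finset.sum_add_distrib, ← Finset.card_filter, ← Finset.card_filter, hv]
  rw [h1]
  cases hs : s i <;> cases b
  · have := out_eq (s := s) i
    rw [hs] at this
    rw [this, in_eq, Finset.card_pair (hne _ _), Finset.card_pair (hne _ _)]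
    simp
  · simp [hs] at hp
  · rw [out_split_eq hs, in_eq, Finset.card_pair (hne _ _)]
    simp
  · have := out_eq (s := s) i
    rw [hs] at this
    rw [this, in_split_eq hs, Finset.card_pair (hne _ _)]
    simp

variable {s' : ZMod m → Bool}

/-- An isomorphism of big cycles rotates or reflects the string of overlaps. -/
theorem exists_symmetry (hm : 4 ≤ m)
    (h : (nonlinearWDC m s).toMultigraph.Isomorphic (nonlinearWDC m s').toMultigraph) :
    ∃ c : ZMod m, (∀ i, s i = s' (c + i)) ∨ ∀ i, s i = s' (c - i) := by
  obtain ⟨g, hg, hmult⟩ := h.exists_bijOn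
  have hdeg : ∀ p ∈ (nonlinearWDC m s).verts, s' (g p).1 = s p.1 := by
    intro p hp
    have h1 := Multigraph.deg_eq_of_bijOn hg hmult hp
    rw [deg_eq hm hp, deg_eq hm (hg.mapsTo hp)] at h1
    cases e1 : s p.1 <;> cases e2 : s' (g p).1 <;> simp [e1, e2] at h1 ⊢
  have hfv : ∀ i, (i, false) ∈ (nonlinearWDC m s).verts := fun i => by
    simp [mem_nonlinearWDC_verts]
  -- Without an unsplit overlap to anchor the map, no geometry is needed: degrees force the other
  -- string to be constant too.
  by_cases hall : ∀ i, s i = true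
  · refine ⟨0, Or.inl fun i => ?_⟩
    obtain ⟨p, hp, hpi⟩ := hg.surjOn (show (0 + i, false) ∈ (nonlinearWDC m s').verts by
      simp [mem_nonlinearWDC_verts])
    have := hdeg p hp
    rw [hpi] at this
    rw [this, hall, hall]
  push Not at hall
  obtain ⟨i₀, hi₀⟩ := hall
  have hi₀ : s i₀ = false := by simpa using hi₀
  set c₀ := (g (i₀, false)).1 with hc₀
  have hadj : ∀ p ∈ (nonlinearWDC m s).verts, ∀ p' ∈ (nonlinearWDC m s).verts,
      (nonlinearWDC m s).toMultigraph.mult s(p, p') ≠ 0 →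
      (g p').1 = (g p).1 ∨ (g p').1 = (g p).1 + 1 ∨ (g p').1 = (g p).1 - 1 := by
    intro p hp p' hp' hpp
    refine fst_of_mult_ne_zero hm (s := s') ?_
    rwa [hmult p hp p' hp']
  -- An overlap mapped into overlap `c` fills it, since by `hdeg` both have the same number of
  -- vertices.
  have hfill : ∀ i c, (∀ p ∈ (nonlinearWDC m s).verts, p.1 = i → (g p).1 = c) →
      ∀ p ∈ (nonlinearWDC m s).verts, (g p).1 = c → p.1 = i := by
    intro i c hic p hp hpc
    have h1 := hic _ (hfv i) rfl
    have h2 := hdeg _ (hfv i)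
    rw [h1] at h2
    by_cases he : (g p).2 = (g (i, false)).2
    · have : p = (i, false) := hg.injOn hp (hfv i) (Prod.ext (hpc.trans h1.symm) he)
      rw [this]
    · have hs : s i = true := by
        by_contra hs
        simp only at h2
        have h3 := (mem_nonlinearWDC_verts.1 (hg.mapsTo hp))
        have h4 := (mem_nonlinearWDC_verts.1 (hg.mapsTo (hfv i)))
        rw [hpc, h2] at h3
        rw [h1, h2] at h4
        simp only [hs, imp_false, Bool.not_eq_true] at h3 h4
        exact he (h3.trans h4.symm)
      have htv : (i, true) ∈ (nonlinearWDC m s).verts := by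
        simp [mem_nonlinearWDC_verts, hs]
      have h5 := hic _ htv rfl
      have h6 : (g (i, true)).2 ≠ (g (i, false)).2 := by
        intro h6
        have := hg.injOn htv (hfv i) (Prod.ext (h5.trans h1.symm) h6)
        simp at this
      have h7 : (g p).2 = (g (i, true)).2 := by
        revert he h6
        cases (g p).2 <;> cases (g (i, true)).2 <;> cases (g (i, false)).2 <;> simp
      have : p = (i, true) := hg.injOn hp htv (Prod.ext (hpc.trans h5.symm) h7)
      rw [this]
  have hP0 : ∀ p ∈ (nonlinearWDC m s).verts, p.1 = i₀ → (g p).1 = c₀ := by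
    rintro ⟨i, b⟩ hp rfl
    rw [mem_nonlinearWDC_verts] at hp
    cases b
    · rfl
    · simp [hi₀] at hp
  have hne1 := one_ne hm
  have hne2 := two_ne hm
  have hne3 := three_ne hm
  have hstep1 : ∀ p ∈ (nonlinearWDC m s).verts, p.1 = i₀ + 1 →
      (g p).1 = c₀ + 1 ∨ (g p).1 = c₀ - 1 := by
    intro p hp hpi
    obtain ⟨p', hp', h1, h2⟩ := exists_adj hm p hp
    have h3 : p'.1 = i₀ := by linear_combination h1 + hpi
    have h4 := hadj p' hp' p hp h2
    rw [hP0 p' hp' h3] at h4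
    refine h4.resolve_left fun h5 => ?_
    have h6 := hfill i₀ c₀ hP0 p hp h5
    exact hne1 (by linear_combination h6 - hpi)
  -- The direction in which the map runs. The two vertices of a split overlap `i₀ + 1` are adjacent,
  -- so they cannot go to the two sides of `c₀`; for `m ≥ 4` these sides are neither equal nor
  -- neighbouring.
  obtain ⟨ε, hε, hP1⟩ : ∃ ε : ZMod m, (ε = 1 ∨ ε = -1) ∧
      ∀ p ∈ (nonlinearWDC m s).verts, p.1 = i₀ + 1 → (g p).1 = c₀ + ε := by
    obtain ⟨ε, hε, h1⟩ : ∃ ε : ZMod m, (ε = 1 ∨ ε = -1) ∧ (g (i₀ + 1, false)).1 = c₀ + ε := by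
      rcases hstep1 _ (hfv (i₀ + 1)) rfl with h | h
      · exact ⟨1, Or.inl rfl, h⟩
      · exact ⟨-1, Or.inr rfl, by rw [h, sub_eq_add_neg]⟩
    refine ⟨ε, hε, ?_⟩
    rintro ⟨i, b⟩ hp hpi
    simp only at hpi
    subst hpi
    cases b
    · exact h1
    have hs : s (i₀ + 1) = true := mem_nonlinearWDC_verts.1 hp rfl
    have h2 := hadj _ (hfv (i₀ + 1)) _ hp (by
      rw [mult_ne_zero_iff hm, mem_nonlinearWDC_arcs]
      exact Or.inl (Or.inr ⟨rfl, hs, rfl, rfl⟩))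
    rw [h1] at h2
    rcases hε with rfl | rfl <;> rcases hstep1 _ hp rfl with h | h <;> rw [h] at h2 ⊢
    · exfalso
      rcases h2 with h2 | h2 | h2
      · exact hne2 (by linear_combination -h2)
      · exact hne3 (by linear_combination -h2)
      · exact hne1 (by linear_combination -h2)
    · exfalso
      rcases h2 with h2 | h2 | h2
      · exact hne2 (by linear_combination h2)
      · exact hne1 (by linear_combination h2)
      · exact hne3 (by linear_combination h2)
    · ring
  -- Two consecutive overlaps are carried through the induction: the next one lands next to the
  -- image of the last, and both that image and the one before are already filled.
  have hP : ∀ j : ℕ, (∀ p ∈ (nonlinearWDC m s).verts, p.1 = i₀ + j → (g p).1 = c₀ + ε * j) ∧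
      ∀ p ∈ (nonlinearWDC m s).verts, p.1 = i₀ + j + 1 → (g p).1 = c₀ + ε * j + ε := by
    intro j
    induction j with
    | zero => exact ⟨by simpa only [Nat.cast_zero, mul_zero, add_zero] using hP0, by
        simpa only [Nat.cast_zero, mul_zero, add_zero] using hP1⟩
    | succ j ih =>
      obtain ⟨ih0, ih1⟩ := ih
      refine ⟨fun p hp hpi => ?_, fun p hp hpi => ?_⟩
      · rw [ih1 p hp (by rw [hpi]; push_cast; ring)]
        push_cast
        ring
      · obtain ⟨p', hp', h1, h2⟩ := exists_adj hm p hp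
        push_cast at hpi ⊢
        have h3 : p'.1 = i₀ + j + 1 := by linear_combination h1 + hpi
        have h4 := hadj p' hp' p hp h2
        rw [ih1 p' hp' h3] at h4
        have h5 : (g p).1 ≠ c₀ + ε * j := fun h5 => hne2 (by
          linear_combination hfill _ _ ih0 p hp h5 - hpi)
        have h6 : (g p).1 ≠ c₀ + ε * j + ε := fun h6 => hne1 (by
          linear_combination hfill _ _ ih1 p hp h6 - hpi)
        have h7 := h4.resolve_left h6
        rcases hε with rfl | rfl
        · rcases h7 with h7 | h7
          · rw [h7]; ring
          · exact absurd (by rw [h7]; ring) h5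
        · rcases h7 with h7 | h7
          · exact absurd (by rw [h7]; ring) h5
          · rw [h7]; ring
  have hfinal : ∀ i, s i = s' (c₀ + ε * (i - i₀)) := by
    intro i
    have h1 := (hP (i - i₀).val).1 (i, false) (hfv i) (by simp)
    have h2 := hdeg _ (hfv i)
    rw [h1] at h2
    simpa using h2.symm
  rcases hε with rfl | rfl
  · exact ⟨c₀ - i₀, Or.inl fun i => by rw [hfinal]; congr 1; ring⟩
  · exact ⟨c₀ + i₀, Or.inr fun i => by rw [hfinal]; congr 1; ring⟩

end NonlinearWDC

variable {k : ℕ}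

theorem bracelet_eq_of_doubled [NeZero k] {w w' : ZMod k → Bool} {c : ZMod (2 * k)}
    (h : (∀ i, doubled w i = doubled w' (c + i)) ∨ ∀ i, doubled w i = doubled w' (c - i)) :
    Bracelet.mk w' = Bracelet.mk w := by
  refine Quotient.sound ⟨ZMod.castHom (dvd_mul_left k 2) (ZMod k) c, h.imp ?_ ?_⟩
  all_goals
    intro h i
    obtain ⟨j, rfl⟩ := ZMod.ringHom_surjective (ZMod.castHom (dvd_mul_left k 2) (ZMod k)) i
    simpa only [doubled, map_add, map_sub] using h j

theorem bracelet_eq_of_isomorphic [NeZero k] (hk : 2 ≤ k) {w w' : ZMod k → Bool}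
    (h : (braceletMultigraph w).Isomorphic (braceletMultigraph w')) :
    Bracelet.mk w = Bracelet.mk w' := by
  obtain ⟨c, hc⟩ := NonlinearWDC.exists_symmetry (m := 2 * k) (by omega) h
  exact (bracelet_eq_of_doubled hc).symm

/-! ### The classification -/

variable {V : Type*} [LinearOrder V] {F G : ClauseSet V}

theorem Pres.isomorphic_img [NeZero k] {w : ZMod k → Bool} {q : ZMod (2 * k) → Lit V}
    (h : Pres k F (doubled w) q) : F.img.Isomorphic (braceletMultigraph w) :=
  h.isomorphic_nonlinearWDC.symm

/-- A symmetry of the string of length `k` lifts to one of the doubled string, by which the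
presentation is reindexed. -/
theorem Pres.of_bracelet_eq {w w' : ZMod k → Bool} {q : ZMod (2 * k) → Lit V}
    (h : Pres k F (doubled w) q) (hw : Bracelet.mk w = Bracelet.mk w') :
    ∃ q', Pres k F (doubled w') q' := by
  obtain ⟨c, hc⟩ := Quotient.exact hw
  obtain ⟨c, rfl⟩ := ZMod.ringHom_surjective (ZMod.castHom (dvd_mul_left k 2) (ZMod k)) c
  rcases hc with hc | hc
  · have e : doubled w' = fun i => doubled w (c + i) := by
      funext i
      simp only [doubled, hc, map_add]
    exact ⟨_, e ▸ h.rotate c⟩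
  · have e : doubled w' = fun i => doubled w (c - i) := by
      funext i
      simp only [doubled, hc, map_sub]
    exact ⟨_, e ▸ h.reflect c⟩

theorem ClauseSet.IsPureTwoMU.exists_pres_doubled [NeZero k] (hF : F.IsPureTwoMU) (hk : 2 ≤ k)
    (hd : F.deficiency = k) (hns : ∀ v, ¬ F.OneSingular v) :
    ∃ w q, Pres k F (doubled w) q := by
  obtain ⟨s, q, h⟩ := hF.exists_pres hk hd hns
  obtain ⟨w, rfl⟩ := exists_eq_doubled h.periodic
  exact ⟨w, q, h⟩

end MU2

/-! ### The two bijections with bracelets -/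

namespace MU2

variable {V : Type*} [LinearOrder V] {k : ℕ}

theorem isPureTwoMU_of_deficiency {F : ClauseSet V} (hk : 2 ≤ k) (hF : F.IsTwoMU)
    (hd : F.deficiency = k) : F.IsPureTwoMU :=
  hF.isPureTwoMU (by rw [hd]; exact_mod_cast hk)

theorem TwoMU.exists_normalForm [NeZero k] (hk : 2 ≤ k) (F : TwoMU V k) :
    ∃ (N : TwoMUPlus V k) (w : ZMod k → Bool) (q : ZMod (2 * k) → Lit V),
      F.1.IsOneDPNormalForm N.1 ∧ F.1.img.smooth = N.1.img ∧ Pres k N.1 (doubled w) q := by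
  obtain ⟨F, hF, hd⟩ := F
  have hF' := isPureTwoMU_of_deficiency hk hF hd
  obtain ⟨N, hN, hNM, hNd, hs⟩ := hF'.exists_smooth_eq (by rw [hd]; exact_mod_cast hk)
  rw [hd] at hNd
  obtain ⟨w, q, hp⟩ := (isPureTwoMU_of_deficiency hk hNM hNd).exists_pres_doubled hk hNd hN.2
  exact ⟨⟨N, hNM, hNd, hN.2⟩, w, q, hN, hs, hp⟩

/-- A clause-set without 1-singular variables as an element of the larger class. -/
def TwoMUPlus.toTwoMU (N : TwoMUPlus V k) : TwoMU V k := ⟨N.1, N.2.1, N.2.2.1⟩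

theorem TwoMUPlus.smooth_img (hk : 2 ≤ k) (N : TwoMUPlus V k) : N.1.img.smooth = N.1.img :=
  Multigraph.smooth_of_smoothable_eq_empty (Finset.eq_empty_of_forall_notMem fun _ hx =>
    N.2.2.2 _ ((isPureTwoMU_of_deficiency hk N.2.1 N.2.2.1).mem_smoothable_img.1 hx))

theorem TwoMUPlus.exists_pres [NeZero k] (hk : 2 ≤ k) (N : TwoMUPlus V k) :
    ∃ w q, Pres k N.1 (doubled w) q :=
  (isPureTwoMU_of_deficiency hk N.2.1 N.2.2.1).exists_pres_doubled hk N.2.2.1 N.2.2.2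

theorem TwoMU.exists_bracelet [NeZero k] (hk : 2 ≤ k) (F : TwoMU V k) :
    ∃ β : Bracelet k, ∀ w, β = Bracelet.mk w ↔
      F.1.img.smooth.Isomorphic (braceletMultigraph w) := by
  obtain ⟨N, w, q, -, hs, hp⟩ := F.exists_normalForm hk
  refine ⟨Bracelet.mk w, fun w' => ?_⟩
  rw [hs]
  constructor
  · intro hw
    obtain ⟨q', hp'⟩ := hp.of_bracelet_eq hw
    exact hp'.isomorphic_img
  · exact fun h => bracelet_eq_of_isomorphic hk (hp.isomorphic_img.symm.trans h)

/-- The bracelet encoding the smoothing of the implication multigraph. -/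
noncomputable def TwoMU.bracelet [NeZero k] (hk : 2 ≤ k) (F : TwoMU V k) : Bracelet k :=
  (F.exists_bracelet hk).choose

theorem TwoMU.bracelet_eq_mk_iff [NeZero k] (hk : 2 ≤ k) (F : TwoMU V k) (w : ZMod k → Bool) :
    F.bracelet hk = Bracelet.mk w ↔ F.1.img.smooth.Isomorphic (braceletMultigraph w) :=
  (F.exists_bracelet hk).choose_spec w

theorem TwoMU.bracelet_eq_iff [NeZero k] (hk : 2 ≤ k) (F G : TwoMU V k) :
    F.bracelet hk = G.bracelet hk ↔ F.1.img.Homeomorphic G.1.img := by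
  obtain ⟨w, hw⟩ : ∃ w, Bracelet.mk w = G.bracelet hk := Quotient.exists_rep _
  have h1 := (G.bracelet_eq_mk_iff hk w).1 hw.symm
  rw [← hw, bracelet_eq_mk_iff]
  exact ⟨fun h => h.trans h1.symm, fun h => h.trans h1⟩

theorem TwoMUPlus.bracelet_eq_mk_of_pres [NeZero k] (hk : 2 ≤ k) (N : TwoMUPlus V k)
    {w : ZMod k → Bool} {q : ZMod (2 * k) → Lit V} (h : Pres k N.1 (doubled w) q) :
    N.toTwoMU.bracelet hk = Bracelet.mk w := by
  rw [TwoMU.bracelet_eq_mk_iff]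
  change N.1.img.smooth.Isomorphic _
  rw [N.smooth_img hk]
  exact h.isomorphic_img

/-- Equal bracelets allow presentations by the same string, which determines the clause-set up to
isomorphism; conversely an isomorphism transports a presentation with its string. -/
theorem TwoMUPlus.bracelet_eq_iff [NeZero k] (hk : 2 ≤ k) (M N : TwoMUPlus V k) :
    M.toTwoMU.bracelet hk = N.toTwoMU.bracelet hk ↔ M.1.Isomorphic N.1 := by
  obtain ⟨w, q, h⟩ := M.exists_pres hk
  obtain ⟨w', q', h'⟩ := N.exists_pres hk
  rw [M.bracelet_eq_mk_of_pres hk h, N.bracelet_eq_mk_of_pres hk h']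
  constructor
  · intro hw
    obtain ⟨q'', h''⟩ := h.of_bracelet_eq hw
    exact h''.isomorphic h'
  · intro hMN
    obtain ⟨q'', h''⟩ := h.of_isomorphic hMN
    rw [← N.bracelet_eq_mk_of_pres hk h', N.bracelet_eq_mk_of_pres hk h'']

theorem TwoMUPlus.exists_bracelet_eq [Infinite V] [NeZero k] (hk : 2 ≤ k) (β : Bracelet k) :
    ∃ N : TwoMUPlus V k, N.toTwoMU.bracelet hk = β := by
  obtain ⟨w, rfl⟩ : ∃ w, Bracelet.mk w = β := Quotient.exists_rep _
  obtain ⟨F, q, h⟩ := Pres.exists_pres V (doubled_add_half w)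
  exact ⟨⟨F, (h.isPureTwoMU hk).toIsTwoMU, h.deficiency hk, h.not_oneSingular hk⟩,
    TwoMUPlus.bracelet_eq_mk_of_pres hk _ h⟩

end MU2

theorem mainTheorem8 {V : Type*} [LinearOrder V] [Infinite V] (k : ℕ) [NeZero k] (hk : 2 ≤ k) :
    ∃ (Φ : MU2.HomeoType V k ≃ MU2.Bracelet k) (Ψ : MU2.PlusIsoType V k ≃ MU2.Bracelet k),
      (∀ (F : MU2.TwoMU V k) (w : ZMod k → Bool),
        Φ F.homeoType = MU2.Bracelet.mk w ↔
          F.1.img.smooth.Isomorphic (MU2.braceletMultigraph w)) ∧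
      (∀ F : MU2.TwoMU V k, ∃ N : MU2.TwoMUPlus V k,
        (∀ M : MU2.ClauseSet V, F.1.IsOneDPNormalForm M ↔ M = N.1) ∧
        Ψ N.isoType = Φ F.homeoType) := by
  let φ : MU2.HomeoType V k → MU2.Bracelet k :=
    Quotient.lift (fun F : MU2.TwoMU V k => F.bracelet hk)
      fun F G h => (MU2.TwoMU.bracelet_eq_iff hk F G).2 h
  let ψ : MU2.PlusIsoType V k → MU2.Bracelet k :=
    Quotient.lift (fun N : MU2.TwoMUPlus V k => N.toTwoMU.bracelet hk)
      fun M N h => (MU2.TwoMUPlus.bracelet_eq_iff hk M N).2 h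
  have hφ : Function.Bijective φ := by
    constructor
    · rintro ⟨F⟩ ⟨G⟩ h
      exact Quotient.sound ((MU2.TwoMU.bracelet_eq_iff hk F G).1 h)
    · intro β
      obtain ⟨N, hN⟩ := MU2.TwoMUPlus.exists_bracelet_eq (V := V) hk β
      exact ⟨N.toTwoMU.homeoType, hN⟩
  have hψ : Function.Bijective ψ := by
    constructor
    · rintro ⟨M⟩ ⟨N⟩ h
      exact Quotient.sound ((MU2.TwoMUPlus.bracelet_eq_iff hk M N).1 h)
    · intro β
      obtain ⟨N, hN⟩ := MU2.TwoMUPlus.exists_bracelet_eq (V := V) hk β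
      exact ⟨N.isoType, hN⟩
  refine ⟨Equiv.ofBijective φ hφ, Equiv.ofBijective ψ hψ,
    fun F w => MU2.TwoMU.bracelet_eq_mk_iff hk F w, fun F => ?_⟩
  obtain ⟨N, w, q, hN, hs, hp⟩ := F.exists_normalForm hk
  refine ⟨N, fun M => ⟨fun hM => ?_, fun hM => hM ▸ hN⟩, ?_⟩
  · exact hM.unique hN (MU2.isPureTwoMU_of_deficiency hk F.2.1 F.2.2)
      (by rw [F.2.2]; exact_mod_cast hk)
  -- The smoothing of `F` is the implication multigraph of `N`, so one string encodes both.
  · change N.toTwoMU.bracelet hk = F.bracelet hk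
    rw [N.bracelet_eq_mk_of_pres hk hp, eq_comm, MU2.TwoMU.bracelet_eq_mk_iff, hs]
    exact hp.isomorphic_img
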